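/- **Corollary 5.3 (QPTAS).** Consider the Steiner Tree problem: given a connected graph $G=(V,E)$ with $n=|V|$ and a set $S\subseteq V$ of terminals, find a subtree of $G$ that contains all terminals and has as few edges as possible. For a function $\psi:\mathbb N\to(0,\infty)$, an instance $(G,S)$ is called $\psi(n)$-dense if every terminal has at least $|V\setminus S|/\psi(n)$ neighbors in $V\setminus S$. Let $\psi(n)=\operatorname{polylog}(n)$, i.e. $\psi(n)=O((\log n)^k)$ for some $k\in\mathbb N$. Then the Steiner Tree problem restricted to $\psi(n)$-dense instances admits a quasi-polynomial-time approximation scheme: there is one deterministic algorithm (Turing machine) which, given a rational $\delta>0$ and a $\psi(n)$-dense instance $(G,S)$, outputs a subtree of $G$ that contains $S$ and whose number of edges is at most $(1+\delta)$ times the minimum, and for every fixed $\delta$ there are constants $C,c$ such that its running time is at most $\exp\bigl(C(\log n)^{c}\bigr)$ on all $\psi(n)$-dense instances with $n\ge 2$ vertices. -/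

import Mathlib

/-- An instance of the Steiner Tree problem: a connected graph on the vertices `0, …, n - 1`
together with a set of terminals. -/
structure SteinerInstance where
  n : ℕ
  G : SimpleGraph (Fin n)
  connected : G.Connected
  S : Finset (Fin n)

namespace SteinerInstance

/-- Every terminal has at least `|V ∖ S| / ψ(n)` neighbours in `V ∖ S`, where `n = |V|`. -/
def IsDense (ψ : ℕ → ℝ) (I : SteinerInstance) : Prop :=
  ∀ t ∈ I.S, ((I.S : Set (Fin I.n))ᶜ.ncard : ℝ) / ψ I.n ≤
    ((I.G.neighborSet t \ (I.S : Set (Fin I.n))).ncard : ℝ)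

/-- A Steiner tree: a subgraph of `G` that is a tree and contains all terminals. -/
def IsSteinerTree (I : SteinerInstance) (T : I.G.Subgraph) : Prop :=
  T.coe.IsTree ∧ (I.S : Set (Fin I.n)) ⊆ T.verts

/-- The size of a tree is its number of edges. -/
noncomputable def size (I : SteinerInstance) (T : I.G.Subgraph) : ℕ :=
  T.edgeSet.ncard

/-- `T` is a Steiner tree whose size is at most `1 + δ` times that of every Steiner tree. -/
def IsApproxSolution (I : SteinerInstance) (δ : ℚ) (T : I.G.Subgraph) : Prop :=
  I.IsSteinerTree T ∧
    ∀ T' : I.G.Subgraph, I.IsSteinerTree T' → (I.size T : ℚ) ≤ (1 + δ) * (I.size T' : ℚ)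

end SteinerInstance

/-- The characteristic bit string of a subset of `Fin n`. -/
noncomputable def setBits {n : ℕ} (A : Set (Fin n)) : List Bool :=
  open scoped Classical in List.ofFn fun i => decide (i ∈ A)

/-- The adjacency matrix of a relation on `Fin n`, row by row, as a bit string. -/
noncomputable def matrixBits {n : ℕ} (r : Fin n → Fin n → Prop) : List Bool :=
  (List.ofFn fun i => setBits {j | r i j}).flatten

/-- A natural number in self-delimiting unary: `1ᵐ0`. -/
def unaryBits (m : ℕ) : List Bool :=
  List.replicate m true ++ [false]

/-- The input of an approximation scheme: the accuracy `δ` (numerator and denominator), the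
number of vertices, the set of terminals and the adjacency matrix of the graph. The numbers are
in unary, so that a bit string of length polynomial in `n` results for each fixed `δ`. -/
noncomputable def encodeInput (δ : ℚ) (I : SteinerInstance) : List Bool :=
  unaryBits δ.num.toNat ++ unaryBits δ.den ++ unaryBits I.n ++
    setBits (I.S : Set (Fin I.n)) ++ matrixBits I.G.Adj

/-- The output of an approximation scheme: the vertex set and the adjacency matrix of a
subgraph. -/
noncomputable def encodeOutput {I : SteinerInstance} (T : I.G.Subgraph) : List Bool :=
  setBits T.verts ++ matrixBits T.Adj

/-- `ψ(n) = polylog(n)`, that is, `ψ(n) = O((log n)^k)` for some `k`. -/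
def IsPolylog (ψ : ℕ → ℝ) : Prop :=
  ∃ k : ℕ, ψ =O[Filter.atTop] fun n : ℕ => Real.log n ^ k

/-- `t(n) ≤ exp(C (log n)^k)` for some constants `C`, `k` and all `n ≥ 2`. -/
def IsQuasiPolynomial (t : ℕ → ℕ) : Prop :=
  ∃ (C : ℝ) (k : ℕ), ∀ n : ℕ, 2 ≤ n → (t n : ℝ) ≤ Real.exp (C * Real.log n ^ k)

/-- The machine `M` is a quasi-polynomial-time approximation scheme for the Steiner Tree instances
with property `P`: it is one deterministic (multi-stack Turing) machine which receives `δ > 0` and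
an instance with property `P`, and outputs a `(1 + δ)`-approximate Steiner tree; for each fixed
`δ`, its number of steps is at most quasi-polynomial in the number `n` of vertices. -/
def IsQPTAS (P : SteinerInstance → Prop) (M : Turing.TM2ComputableAux Bool Bool) : Prop :=
  ∀ δ : ℚ, 0 < δ → ∃ t : ℕ → ℕ, IsQuasiPolynomial t ∧
    ∀ I : SteinerInstance, P I → ∃ T : I.G.Subgraph, I.IsApproxSolution δ T ∧
      Nonempty (Turing.TM2OutputsInTime M.tm
        ((encodeInput δ I).map M.inputAlphabet.symm)
        (some ((encodeOutput T).map M.outputAlphabet.symm)) (t I.n))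

/-! A connected set of m vertices has a spanning tree with m - 1 edges, so the task is to find a
small connected vertex set that contains S. Let W be the vertex set of an arbitrary Steiner tree.

Suppose that S is neither empty nor everything. By averaging, some nonterminal is adjacent to a 1/ψ
fraction of the terminals that are not yet dominated. Hence a greedy choice yields a set D of at
most ψ log |S| + 1 nonterminals that dominates S, each adjacent to a terminal (`exists_dominating`).
The set W ∪ D is still connected and has |D \ W| extra vertices. Let a be the denominator of δ, so
that 1/a ≤ δ. If |S| exceeds the polylogarithmic threshold `guesses`, then a |D \ W| ≤ |W| - 1,
which is the number of edges of the tree. Otherwise D = S works and costs nothing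
(`SteinerInstance.IsDense.exists_dominating`).

Once D is guessed, the stars formed by its vertices and their terminal neighbours cover S. It
remains to find a connected set that meets all these stars and has few vertices outside S ∪ D; its
union with the stars is connected (`CutConnected.union_stars`). A recursion of Dreyfus–Wagner type
over subsets of the stars would find such a set. Since all sequences are guessed, all orders of D
occur, and intervals of the sequence can replace subsets: a connected set with a root splits into
two disjoint connected sets with adjacent roots (`CutConnected.build`), and in a suitable order the
stars assigned to the two pieces form consecutive intervals (`Build.achieves`). So n rounds of
improvements of a table indexed by i, j and the root suffice for the right sequence
(`SteinerProg.rounds_spec`, `SteinerProg.search_card_le`). Independently of the guess, every row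
stays connected and meets its stars, so the best solution is always feasible; finally a spanning
tree of it is grown (`SteinerProg.span_spec`).

There are n ^ k sequences with k polylogarithmic, and the rest is polynomial in n ^ k. To obtain a
Turing machine, the algorithm is written in a language with bounded loops. Every command of it
compiles to a stack program whose running time is polynomial in the values of the variables
(`StackProg.exists_runsCmd`), and stack programs compile to machines step by step
(`StackProg.Exec.runs`). All numbers, even n ^ k, are kept in unary. The function ψ is never
computed; it enters through two constants that bound ψ(n) log n + 1 by a multiple of a power of
⌈log₂ n⌉ (`IsPolylog.exists_greedyBound`). -/

/-! ### Structured programs over finitely many stacks of bits -/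

/-- Structured programs over stacks of bits, indexed by `K`. The tests of `ite` and `while` depend
on the top of one stack. -/
inductive StackProg (K : Type) : Type
  | skip : StackProg K
  | push (k : K) (b : Bool) : StackProg K
  | pop (k : K) : StackProg K
  | seq (c₁ c₂ : StackProg K) : StackProg K
  | ite (k : K) (p : Option Bool → Bool) (c₁ c₂ : StackProg K) : StackProg K
  | while (k : K) (p : Option Bool → Bool) (c : StackProg K) : StackProg K

namespace StackProg

variable {K : Type} [DecidableEq K]

/-- `Exec c s s' t`: started on the stacks `s`, the program `c` stops after `t` elementary steps
with the stacks `s'`. -/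
inductive Exec : StackProg K → (K → List Bool) → (K → List Bool) → ℕ → Prop
  | skip (s) : Exec skip s s 1
  | push (k b s) : Exec (push k b) s (Function.update s k (b :: s k)) 1
  | pop (k s) : Exec (pop k) s (Function.update s k (s k).tail) 1
  | seq {c₁ c₂ s s' s'' t₁ t₂} : Exec c₁ s s' t₁ → Exec c₂ s' s'' t₂ →
      Exec (seq c₁ c₂) s s'' (t₁ + t₂)
  | ite_true {k p c₁ c₂ s s' t} : p (s k).head? = true → Exec c₁ s s' t →
      Exec (ite k p c₁ c₂) s s' (1 + t)
  | ite_false {k p c₁ c₂ s s' t} : p (s k).head? = false → Exec c₂ s s' t →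
      Exec (ite k p c₁ c₂) s s' (1 + t)
  | while_false {k p c s} : p (s k).head? = false → Exec (.while k p c) s s 1
  | while_true {k p c s s' s'' t₁ t₂} : p (s k).head? = true → Exec c s s' t₁ →
      Exec (.while k p c) s' s'' t₂ → Exec (.while k p c) s s'' (1 + t₁ + t₂)

/-- A step pushes at most one symbol. This bounds the cost of emptying the work stacks at the end of
a program. -/
theorem Exec.length_le {c : StackProg K} {s s' : K → List Bool} {t : ℕ} (h : Exec c s s' t)
    (k : K) : (s' k).length ≤ (s k).length + t := by
  induction h with
  | skip s => omega
  | push k' b s =>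
    by_cases hk : k = k'
    · subst hk; simp
    · simp [Function.update_of_ne hk]
  | pop k' s =>
    by_cases hk : k = k'
    · subst hk; simp; omega
    · simp [Function.update_of_ne hk]
  | seq _ _ ih₁ ih₂ => omega
  | ite_true _ _ ih => omega
  | ite_false _ _ ih => omega
  | while_false _ => omega
  | while_true _ _ _ ih₁ ih₂ => omega

/-! #### Compilation to a multi-stack Turing machine -/

/-- The program points of a structured program. -/
def Label : StackProg K → Type
  | skip => Unit
  | push _ _ => Unit
  | pop _ => Unit
  | seq c₁ c₂ => Label c₁ ⊕ Label c₂
  | ite _ _ c₁ c₂ => Option (Label c₁ ⊕ Label c₂)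
  | .while _ _ c => Option (Label c)

/-- There are finitely many program points. -/
instance fintypeLabel : (c : StackProg K) → Fintype (Label c)
  | skip => inferInstanceAs (Fintype Unit)
  | push _ _ => inferInstanceAs (Fintype Unit)
  | pop _ => inferInstanceAs (Fintype Unit)
  | seq c₁ c₂ =>
    letI := fintypeLabel c₁
    letI := fintypeLabel c₂
    inferInstanceAs (Fintype (Label c₁ ⊕ Label c₂))
  | ite _ _ c₁ c₂ =>
    letI := fintypeLabel c₁
    letI := fintypeLabel c₂
    inferInstanceAs (Fintype (Option (Label c₁ ⊕ Label c₂)))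
  | .while _ _ c =>
    letI := fintypeLabel c
    inferInstanceAs (Fintype (Option (Label c)))

/-- The program point at which a program starts. -/
def entry : (c : StackProg K) → Label c
  | skip => ()
  | push _ _ => ()
  | pop _ => ()
  | seq c₁ _ => Sum.inl (entry c₁)
  | ite _ _ _ _ => (none : Option _)
  | .while _ _ _ => (none : Option _)

/-- The statement that peeks at stack `k` and continues at `l₁` or `l₂`. -/
def test {L : Type} (k : K) (p : Option Bool → Bool) (l₁ l₂ : L) :
    Turing.TM2.Stmt (fun _ : K => Bool) L (Option Bool) :=
  -- The loads reset the register, so that it is `none` at every program point, as `Runs` demands of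
  -- both ends of a run.
  .peek k (fun _ o => o) <| .branch p (.load (fun _ => none) (.goto fun _ => l₁))
    (.load (fun _ => none) (.goto fun _ => l₂))

/-- The Turing machine statement at a program point; labels are embedded by `emb`, and `exit` is
the label at which the machine continues after the program. -/
def code {L : Type} : (c : StackProg K) → (emb : Label c → L) → (exit : L) → Label c →
    Turing.TM2.Stmt (fun _ : K => Bool) L (Option Bool)
  | skip, _, exit, _ => .goto fun _ => exit
  | push k b, _, exit, _ => .push k (fun _ => b) (.goto fun _ => exit)
  | pop k, _, exit, _ => .pop k (fun v _ => v) (.goto fun _ => exit)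
  | seq c₁ c₂, emb, exit, l =>
    match l with
    | Sum.inl l => code c₁ (fun l => emb (Sum.inl l)) (emb (Sum.inr (entry c₂))) l
    | Sum.inr l => code c₂ (fun l => emb (Sum.inr l)) exit l
  | ite k p c₁ c₂, emb, exit, l =>
    match (l : Option (Label c₁ ⊕ Label c₂)) with
    | none => test k p (emb (some (Sum.inl (entry c₁)) : Option (Label c₁ ⊕ Label c₂)))
        (emb (some (Sum.inr (entry c₂)) : Option (Label c₁ ⊕ Label c₂)))
    | some (Sum.inl l) =>
      code c₁ (fun l => emb (some (Sum.inl l) : Option (Label c₁ ⊕ Label c₂))) exit l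
    | some (Sum.inr l) =>
      code c₂ (fun l => emb (some (Sum.inr l) : Option (Label c₁ ⊕ Label c₂))) exit l
  | .while k p c, emb, exit, l =>
    match (l : Option (Label c)) with
    | none => test k p (emb (some (entry c) : Option (Label c))) exit
    | some l => code c (fun l => emb (some l : Option (Label c)))
        (emb (none : Option (Label c))) l

/-- `t` steps of the machine with the statements `m`, from label `l` to label `l'`. -/
def Runs {L : Type} (m : L → Turing.TM2.Stmt (fun _ : K => Bool) L (Option Bool)) (l : L)
    (s : K → List Bool) (l' : L) (s' : K → List Bool) (t : ℕ) : Prop :=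
  (flip bind (Turing.TM2.step m))^[t] (some ⟨some l, none, s⟩) = some ⟨some l', none, s'⟩

theorem Runs.trans {L : Type} {m : L → Turing.TM2.Stmt (fun _ : K => Bool) L (Option Bool)}
    {l l' l'' : L} {s s' s'' : K → List Bool} {t t' : ℕ} (h : Runs m l s l' s' t)
    (h' : Runs m l' s' l'' s'' t') : Runs m l s l'' s'' (t + t') := by
  unfold Runs at *
  rw [Nat.add_comm, Function.iterate_add_apply, h, h']

theorem runs_one {L : Type} {m : L → Turing.TM2.Stmt (fun _ : K => Bool) L (Option Bool)}
    {l l' : L} {s s' : K → List Bool}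
    (h : Turing.TM2.stepAux (m l) none s = ⟨some l', none, s'⟩) : Runs m l s l' s' 1 := by
  simp only [Runs, Function.iterate_one, flip, ← h]
  rfl

theorem stepAux_test {L : Type} (k : K) (p : Option Bool → Bool) (l₁ l₂ : L)
    (s : K → List Bool) : Turing.TM2.stepAux (test k p l₁ l₂) none s =
      ⟨some (if p (s k).head? then l₁ else l₂), none, s⟩ := by
  simp only [test, Turing.TM2.stepAux]
  cases p (s k).head? <;> rfl

/-- Every elementary step of a program is exactly one machine step. The embedding and the exit label
are arbitrary because subprograms sit inside the labels of the whole program; for the body of a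
loop, the exit is the test of the loop. -/
theorem Exec.runs {L : Type} (m : L → Turing.TM2.Stmt (fun _ : K => Bool) L (Option Bool))
    {c : StackProg K} {s s' : K → List Bool} {t : ℕ} (h : Exec c s s' t) :
    ∀ (emb : Label c → L) (exit : L), (∀ l, m (emb l) = code c emb exit l) →
      Runs m (emb (entry c)) s exit s' t := by
  induction h with
  | skip s => exact fun emb exit hm => runs_one (by rw [hm]; rfl)
  | push k b s => exact fun emb exit hm => runs_one (by rw [hm]; rfl)
  | pop k s => exact fun emb exit hm => runs_one (by rw [hm]; rfl)
  | seq _ _ ih₁ ih₂ =>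
    exact fun emb exit hm => (ih₁ (fun l => emb (Sum.inl l)) _ fun l => hm (Sum.inl l)).trans
      (ih₂ (fun l => emb (Sum.inr l)) _ fun l => hm (Sum.inr l))
  | @ite_true k p c₁ c₂ s s' t hp _ ih =>
    intro emb exit hm
    refine Runs.trans (runs_one ?_) (ih (fun l => emb (some (Sum.inl l) : Option _)) _
      fun l => hm (some (Sum.inl l) : Option _))
    refine (congrArg (fun q => Turing.TM2.stepAux q none s) (hm (none : Option _))).trans ?_
    refine (stepAux_test k p _ _ s).trans ?_
    rw [hp]; rfl
  | @ite_false k p c₁ c₂ s s' t hp _ ih =>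
    intro emb exit hm
    refine Runs.trans (runs_one ?_) (ih (fun l => emb (some (Sum.inr l) : Option _)) _
      fun l => hm (some (Sum.inr l) : Option _))
    refine (congrArg (fun q => Turing.TM2.stepAux q none s) (hm (none : Option _))).trans ?_
    refine (stepAux_test k p _ _ s).trans ?_
    rw [hp]; rfl
  | @while_false k p c s hp =>
    intro emb exit hm
    refine runs_one ?_
    refine (congrArg (fun q => Turing.TM2.stepAux q none s) (hm (none : Option _))).trans ?_
    refine (stepAux_test k p _ _ s).trans ?_
    rw [hp]; rfl
  | @while_true k p c s s' s'' t₁ t₂ hp _ _ ih₁ ih₂ =>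
    intro emb exit hm
    refine Runs.trans (Runs.trans (runs_one ?_) (ih₁ (fun l => emb (some l : Option _)) _
      fun l => hm (some l : Option _))) (ih₂ emb exit hm)
    refine (congrArg (fun q => Turing.TM2.stepAux q none s) (hm (none : Option _))).trans ?_
    refine (stepAux_test k p _ _ s).trans ?_
    rw [hp]; rfl

/-- The Turing machine of a structured program with input stack `k₀` and output stack `k₁`. -/
def machine [Fintype K] (c : StackProg K) (k₀ k₁ : K) : Turing.TM2ComputableAux Bool Bool where
  tm :=
    { K := K
      k₀ := k₀
      k₁ := k₁
      Γ := fun _ => Bool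
      Λ := Option (Label c)
      main := some (entry c)
      σ := Option Bool
      initialState := none
      m := fun l => match l with
        | none => .halt
        | some l => code c some none l }
  inputAlphabet := Equiv.refl _
  outputAlphabet := Equiv.refl _

/-- The final configuration of the machine has all stacks but the output empty, hence the hypothesis
on the final stacks. The additional step is the halting statement. -/
theorem machine_outputs [Fintype K] {c : StackProg K} {k₀ k₁ : K} {x y : List Bool} {t t' : ℕ}
    (h : Exec c (Function.update (fun _ => []) k₀ x) (Function.update (fun _ => []) k₁ y) t)
    (ht : t + 1 ≤ t') :
    Nonempty (Turing.TM2OutputsInTime (machine c k₀ k₁).tm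
      (x.map (machine c k₀ k₁).inputAlphabet.symm)
      (some (y.map (machine c k₀ k₁).outputAlphabet.symm)) t') := by
  have hr := h.runs (machine c k₀ k₁).tm.m some none fun l => rfl
  refine ⟨⟨⟨t + 1, ?_⟩, ht⟩⟩
  have hx : Turing.initList (machine c k₀ k₁).tm (x.map (machine c k₀ k₁).inputAlphabet.symm) =
      (⟨some (some (entry c)), none, Function.update (fun _ => []) k₀ x⟩ :
        Turing.TM2.Cfg (fun _ : K => Bool) (Option (Label c)) (Option Bool)) := by
    have : (fun k => @dite (List Bool) (k = k₀) _ (fun h => x.map (Equiv.refl Bool).symm)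
        fun _ => []) = Function.update (fun _ => []) k₀ x := by
      funext k
      by_cases hk : k = k₀
      · subst hk; simp
      · simp [hk]
    exact congrArg (fun S => (⟨some (some (entry c)), none, S⟩ :
        Turing.TM2.Cfg (fun _ : K => Bool) (Option (Label c)) (Option Bool))) this
  have hy : Turing.haltList (machine c k₀ k₁).tm
      (y.map (machine c k₀ k₁).outputAlphabet.symm) =
      (⟨none, none, Function.update (fun _ => []) k₁ y⟩ :
        Turing.TM2.Cfg (fun _ : K => Bool) (Option (Label c)) (Option Bool)) := by
    have : (fun k => @dite (List Bool) (k = k₁) _ (fun h => y.map (Equiv.refl Bool).symm)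
        fun _ => []) = Function.update (fun _ => []) k₁ y := by
      funext k
      by_cases hk : k = k₁
      · subst hk; simp
      · simp [hk]
    exact congrArg (fun S => (⟨none, none, S⟩ :
        Turing.TM2.Cfg (fun _ : K => Bool) (Option (Label c)) (Option Bool))) this
  have hr' : (flip bind (machine c k₀ k₁).tm.step)^[t]
      (some (Turing.initList (machine c k₀ k₁).tm
        (x.map (machine c k₀ k₁).inputAlphabet.symm))) =
      some (⟨some none, none, Function.update (fun _ => []) k₁ y⟩ :
        Turing.TM2.Cfg (fun _ : K => Bool) (Option (Label c)) (Option Bool)) := by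
    rw [hx]
    exact hr
  rw [Function.iterate_succ_apply']
  refine (congrArg (flip bind (machine c k₀ k₁).tm.step) hr').trans ?_
  rw [Option.map_some, hy]
  rfl

end StackProg

/-! ### A bounded-loop language with bit arrays -/

/-- The stacks used by compiled programs: one per numerical variable (in unary) and per bit array,
a stack for values of expressions, one for accumulated sums, two for temporary data, and the
output. -/
inductive Stk (V A : Type) : Type
  | env (v : V)
  | arr (a : A)
  | eval
  | acc
  | tmp
  | tmp₂
  | out
  deriving DecidableEq, Fintype

/-- The unary representation of a natural number. -/
abbrev ones (n : ℕ) : List Bool := List.replicate n true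

namespace StackProg

section Triples

variable {K : Type} [DecidableEq K]

/-- Started on stacks satisfying `P`, the program `c` stops after at most `B` steps on stacks
satisfying `Q`. -/
def Triple (P : (K → List Bool) → Prop) (c : StackProg K) (B : ℕ) (Q : (K → List Bool) → Prop) :
    Prop :=
  ∀ s, P s → ∃ s' t, Exec c s s' t ∧ t ≤ B ∧ Q s'

variable {P Q R : (K → List Bool) → Prop} {c c₁ c₂ : StackProg K} {B B' B₁ B₂ : ℕ}

theorem Triple.seq (h₁ : Triple P c₁ B₁ Q) (h₂ : Triple Q c₂ B₂ R) :
    Triple P (.seq c₁ c₂) (B₁ + B₂) R := by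
  intro s hs
  obtain ⟨s', t, he, ht, hq⟩ := h₁ s hs
  obtain ⟨s'', t', he', ht', hr⟩ := h₂ s' hq
  exact ⟨s'', t + t', he.seq he', by omega, hr⟩

theorem Triple.mono (h : Triple P c B Q) (hB : B ≤ B') : Triple P c B' Q := by
  intro s hs
  obtain ⟨s', t, he, ht, hq⟩ := h s hs
  exact ⟨s', t, he, ht.trans hB, hq⟩

theorem triple_skip : Triple P skip 1 P := fun s hs => ⟨s, 1, .skip s, le_rfl, hs⟩

theorem triple_push {k : K} {b : Bool}
    (h : ∀ s, P s → Q (Function.update s k (b :: s k))) : Triple P (push k b) 1 Q :=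
  fun s hs => ⟨_, 1, .push k b s, le_rfl, h s hs⟩

theorem triple_pop {k : K}
    (h : ∀ s, P s → Q (Function.update s k (s k).tail)) : Triple P (pop k) 1 Q :=
  fun s hs => ⟨_, 1, .pop k s, le_rfl, h s hs⟩

theorem triple_ite_true {k : K} {p : Option Bool → Bool} (hp : ∀ s, P s → p (s k).head? = true)
    (h : Triple P c₁ B Q) : Triple P (ite k p c₁ c₂) (1 + B) Q := by
  intro s hs
  obtain ⟨s', t, he, ht, hq⟩ := h s hs
  exact ⟨s', 1 + t, .ite_true (hp s hs) he, by omega, hq⟩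

theorem triple_ite_false {k : K} {p : Option Bool → Bool}
    (hp : ∀ s, P s → p (s k).head? = false)
    (h : Triple P c₂ B Q) : Triple P (ite k p c₁ c₂) (1 + B) Q := by
  intro s hs
  obtain ⟨s', t, he, ht, hq⟩ := h s hs
  exact ⟨s', 1 + t, .ite_false (hp s hs) he, by omega, hq⟩

/-- The number of iterations is known in advance, so the invariant may be indexed by the iteration.
Each iteration costs one test more than its body, and the last test costs one step. -/
theorem triple_while {k : K} {p : Option Bool → Bool} (I : ℕ → (K → List Bool) → Prop) (n : ℕ)
    (ht : ∀ i < n, ∀ s, I i s → p (s k).head? = true)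
    (hf : ∀ s, I n s → p (s k).head? = false)
    (hc : ∀ i < n, Triple (I i) c B (I (i + 1))) :
    Triple (I 0) (.while k p c) (n * (B + 1) + 1) (I n) := by
  have key : ∀ m i, i + m = n → Triple (I i) (.while k p c) (m * (B + 1) + 1) (I n) := by
    intro m
    induction m with
    | zero =>
      intro i hi s hs
      have : i = n := by omega
      subst this
      exact ⟨s, 1, .while_false (hf s hs), by omega, hs⟩
    | succ m ih =>
      intro i hi s hs
      obtain ⟨s', t, he, ht', hq⟩ := hc i (by omega) s hs
      obtain ⟨s'', t', he', ht'', hq'⟩ := ih (i + 1) (by omega) s' hq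
      exact ⟨s'', 1 + t + t', .while_true (ht i (by omega) s hs) he he', by
        rw [Nat.succ_mul]; omega, hq'⟩
  exact key n 0 (by omega)

end Triples

/-! #### Assertions about the stacks of compiled programs -/

variable {V A : Type} [DecidableEq V] [DecidableEq A]

/-- The stacks `s` hold the numbers `ρ` and the bit arrays `σ` (up to trailing zeros), and have the
given contents otherwise. -/
structure Holds (ρ : V → ℕ) (σ : A → ℕ → Bool) (E C T U O : List Bool)
    (s : Stk V A → List Bool) : Prop where
  env : ∀ v, s (.env v) = ones (ρ v)
  arr : ∀ a i, (s (.arr a)).getD i false = σ a i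
  eval : s .eval = E
  acc : s .acc = C
  tmp : s .tmp = T
  tmp₂ : s .tmp₂ = U
  out : s .out = O

variable {ρ : V → ℕ} {σ : A → ℕ → Bool} {E C T U O : List Bool}

theorem triple_push_eval (b : Bool) :
    Triple (Holds ρ σ E C T U O) (push .eval b) 1 (Holds ρ σ (b :: E) C T U O) :=
  triple_push fun s h => by constructor <;> simp [h.env, h.eval, h.acc, h.tmp, h.tmp₂, h.out, ← h.arr]

theorem triple_pop_eval (b : Bool) :
    Triple (Holds ρ σ (b :: E) C T U O) (pop .eval) 1 (Holds ρ σ E C T U O) :=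
  triple_pop fun s h => by constructor <;> simp [h.env, h.eval, h.acc, h.tmp, h.tmp₂, h.out, ← h.arr]

theorem triple_push_acc (b : Bool) :
    Triple (Holds ρ σ E C T U O) (push .acc b) 1 (Holds ρ σ E (b :: C) T U O) :=
  triple_push fun s h => by constructor <;> simp [h.env, h.eval, h.acc, h.tmp, h.tmp₂, h.out, ← h.arr]

theorem triple_pop_acc (b : Bool) :
    Triple (Holds ρ σ E (b :: C) T U O) (pop .acc) 1 (Holds ρ σ E C T U O) :=
  triple_pop fun s h => by constructor <;> simp [h.env, h.eval, h.acc, h.tmp, h.tmp₂, h.out, ← h.arr]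

theorem triple_push_tmp (b : Bool) :
    Triple (Holds ρ σ E C T U O) (push .tmp b) 1 (Holds ρ σ E C (b :: T) U O) :=
  triple_push fun s h => by constructor <;> simp [h.env, h.eval, h.acc, h.tmp, h.tmp₂, h.out, ← h.arr]

theorem triple_pop_tmp (b : Bool) :
    Triple (Holds ρ σ E C (b :: T) U O) (pop .tmp) 1 (Holds ρ σ E C T U O) :=
  triple_pop fun s h => by constructor <;> simp [h.env, h.eval, h.acc, h.tmp, h.tmp₂, h.out, ← h.arr]

theorem triple_push_tmp₂ (b : Bool) :
    Triple (Holds ρ σ E C T U O) (push .tmp₂ b) 1 (Holds ρ σ E C T (b :: U) O) :=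
  triple_push fun s h => by constructor <;> simp [h.env, h.eval, h.acc, h.tmp, h.tmp₂, h.out, ← h.arr]

theorem triple_pop_tmp₂ (b : Bool) :
    Triple (Holds ρ σ E C T (b :: U) O) (pop .tmp₂) 1 (Holds ρ σ E C T U O) :=
  triple_pop fun s h => by constructor <;> simp [h.env, h.eval, h.acc, h.tmp, h.tmp₂, h.out, ← h.arr]

theorem triple_push_out (b : Bool) :
    Triple (Holds ρ σ E C T U O) (push .out b) 1 (Holds ρ σ E C T U (b :: O)) :=
  triple_push fun s h => by constructor <;> simp [h.env, h.eval, h.acc, h.tmp, h.tmp₂, h.out, ← h.arr]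

theorem triple_push_env (v : V) {n : ℕ} :
    Triple (Holds (Function.update ρ v n) σ E C T U O) (push (.env v) true) 1
      (Holds (Function.update ρ v (n + 1)) σ E C T U O) :=
  triple_push fun s h => by
    constructor <;> try simp [h.env, h.eval, h.acc, h.tmp, h.tmp₂, h.out, ← h.arr]
    intro w
    by_cases hw : w = v
    · subst hw; simp [List.replicate_succ]
    · simp [hw, h.env]

theorem triple_pop_env (v : V) {n : ℕ} :
    Triple (Holds (Function.update ρ v (n + 1)) σ E C T U O) (pop (.env v)) 1
      (Holds (Function.update ρ v n) σ E C T U O) :=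
  triple_pop fun s h => by
    constructor <;> try simp [h.env, h.eval, h.acc, h.tmp, h.tmp₂, h.out, ← h.arr]
    intro w
    by_cases hw : w = v
    · subst hw; simp
    · simp [hw, h.env]

theorem triple_push_arr (a : A) (b : Bool) {f : ℕ → Bool} :
    Triple (Holds ρ (Function.update σ a f) E C T U O) (push (.arr a) b) 1
      (Holds ρ (Function.update σ a (Nat.rec b fun i _ => f i)) E C T U O) :=
  triple_push fun s h => by
    constructor <;> try simp [h.env, h.eval, h.acc, h.tmp, h.tmp₂, h.out]
    intro a' i
    by_cases ha : a' = a
    · subst ha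
      have := h.arr a'
      cases i <;> simp_all
    · have := h.arr a' i
      simp_all

/-- This holds beyond the end of the array too: popping the empty stack does nothing, and a shift of
the zero sequence is zero. -/
theorem triple_pop_arr (a : A) {f : ℕ → Bool} :
    Triple (Holds ρ (Function.update σ a f) E C T U O) (pop (.arr a)) 1
      (Holds ρ (Function.update σ a fun i => f (i + 1)) E C T U O) :=
  triple_pop fun s h => by
    constructor <;> try simp [h.env, h.eval, h.acc, h.tmp, h.tmp₂, h.out]
    intro a' i
    by_cases ha : a' = a
    · subst ha
      have := h.arr a' (i + 1)
      simp_all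
    · have := h.arr a' i
      simp_all

/-- The test whether the top of a stack is a one. -/
def isOne (o : Option Bool) : Bool := o == some true

/-- The loop that runs `c` once for each one on top of stack `k`, removing these ones. -/
def forOnes (k : Stk V A) (c : StackProg (Stk V A)) : StackProg (Stk V A) :=
  .while k isOne (.seq (pop k) c)

theorem isOne_head_ones {n i : ℕ} (hi : i < n) (l : List Bool) :
    isOne (ones (n - i) ++ l).head? = true := by
  obtain ⟨m, hm⟩ : ∃ m, n - i = m + 1 := ⟨n - i - 1, by omega⟩
  simp [hm, isOne, List.replicate_succ]

theorem ones_sub {n i : ℕ} (hi : i < n) : ones (n - i) = true :: ones (n - (i + 1)) := by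
  rw [ones, ← List.replicate_succ, show n - (i + 1) + 1 = n - i by omega]

/-- On the evaluation stack, a `false` below the ones ends each number; it stops the loop and is
left in place. The other contents are sequences indexed by the iteration, so the body may change all
of them. -/
theorem triple_forOnes_eval {c : StackProg (Stk V A)} {B n : ℕ} (l : List Bool)
    (ρ : ℕ → V → ℕ) (σ : ℕ → A → ℕ → Bool) (C T U O : ℕ → List Bool)
    (hc : ∀ i < n, Triple (Holds (ρ i) (σ i) (ones (n - (i + 1)) ++ false :: l) (C i) (T i) (U i)
      (O i)) c B (Holds (ρ (i + 1)) (σ (i + 1)) (ones (n - (i + 1)) ++ false :: l) (C (i + 1))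
        (T (i + 1)) (U (i + 1)) (O (i + 1)))) :
    Triple (Holds (ρ 0) (σ 0) (ones n ++ false :: l) (C 0) (T 0) (U 0) (O 0)) (forOnes .eval c)
      (n * (B + 2) + 1) (Holds (ρ n) (σ n) (false :: l) (C n) (T n) (U n) (O n)) := by
  have := triple_while (c := .seq (pop .eval) c) (B := 1 + B) (k := .eval) (p := isOne)
    (fun i => Holds (ρ i) (σ i) (ones (n - i) ++ false :: l) (C i) (T i) (U i) (O i)) n
    (fun i hi s h => by rw [h.eval]; exact isOne_head_ones hi _)
    (fun s h => by rw [h.eval]; simp [isOne])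
    (fun i hi => by
      rw [ones_sub hi]
      exact (triple_pop_eval true).seq (hc i hi))
  simp only [Nat.sub_self, Nat.sub_zero, List.replicate_zero, List.nil_append] at this
  exact this.mono (by rw [show 1 + B + 1 = B + 2 by omega])

/-- The temporary stack holds at most one number, so the bottom of the stack replaces the end
marker. -/
theorem triple_forOnes_tmp {c : StackProg (Stk V A)} {B n : ℕ}
    (ρ : ℕ → V → ℕ) (σ : ℕ → A → ℕ → Bool) (E C U O : ℕ → List Bool)
    (hc : ∀ i < n, Triple (Holds (ρ i) (σ i) (E i) (C i) (ones (n - (i + 1))) (U i)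
      (O i)) c B (Holds (ρ (i + 1)) (σ (i + 1)) (E (i + 1)) (C (i + 1))
        (ones (n - (i + 1))) (U (i + 1)) (O (i + 1)))) :
    Triple (Holds (ρ 0) (σ 0) (E 0) (C 0) (ones n) (U 0) (O 0)) (forOnes .tmp c)
      (n * (B + 2) + 1) (Holds (ρ n) (σ n) (E n) (C n) [] (U n) (O n)) := by
  have := triple_while (c := .seq (pop .tmp) c) (B := 1 + B) (k := .tmp) (p := isOne)
    (fun i => Holds (ρ i) (σ i) (E i) (C i) (ones (n - i)) (U i) (O i)) n
    (fun i hi s h => by rw [h.tmp, ← List.append_nil (ones _)]; exact isOne_head_ones hi _)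
    (fun s h => by rw [h.tmp]; simp [isOne])
    (fun i hi => by
      rw [ones_sub hi]
      exact (triple_pop_tmp true).seq (hc i hi))
  simp only [Nat.sub_self, Nat.sub_zero, List.replicate_zero] at this
  exact this.mono (by rw [show 1 + B + 1 = B + 2 by omega])

theorem triple_forOnes_tmp₂ {c : StackProg (Stk V A)} {B n : ℕ} (T : ℕ → List Bool)
    (hc : ∀ i < n, Triple (Holds ρ σ E C (T i) (ones (n - (i + 1))) O) c B
      (Holds ρ σ E C (T (i + 1)) (ones (n - (i + 1))) O)) :
    Triple (Holds ρ σ E C (T 0) (ones n) O) (forOnes .tmp₂ c)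
      (n * (B + 2) + 1) (Holds ρ σ E C (T n) [] O) := by
  have := triple_while (c := .seq (pop .tmp₂) c) (B := 1 + B) (k := .tmp₂) (p := isOne)
    (fun i => Holds ρ σ E C (T i) (ones (n - i)) O) n
    (fun i hi s h => by rw [h.tmp₂, ← List.append_nil (ones _)]; exact isOne_head_ones hi _)
    (fun s h => by rw [h.tmp₂]; simp [isOne])
    (fun i hi => by
      rw [ones_sub hi]
      exact (triple_pop_tmp₂ true).seq (hc i hi))
  simp only [Nat.sub_self, Nat.sub_zero, List.replicate_zero] at this
  exact this.mono (by rw [show 1 + B + 1 = B + 2 by omega])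

theorem triple_forOnes_acc {c : StackProg (Stk V A)} {B n : ℕ} (l : List Bool)
    (E : ℕ → List Bool)
    (hc : ∀ i < n, Triple (Holds ρ σ (E i) (ones (n - (i + 1)) ++ false :: l) T U O) c B
      (Holds ρ σ (E (i + 1)) (ones (n - (i + 1)) ++ false :: l) T U O)) :
    Triple (Holds ρ σ (E 0) (ones n ++ false :: l) T U O) (forOnes .acc c)
      (n * (B + 2) + 1) (Holds ρ σ (E n) (false :: l) T U O) := by
  have := triple_while (c := .seq (pop .acc) c) (B := 1 + B) (k := .acc) (p := isOne)
    (fun i => Holds ρ σ (E i) (ones (n - i) ++ false :: l) T U O) n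
    (fun i hi s h => by rw [h.acc]; exact isOne_head_ones hi _)
    (fun s h => by rw [h.acc]; simp [isOne])
    (fun i hi => by
      rw [ones_sub hi]
      exact (triple_pop_acc true).seq (hc i hi))
  simp only [Nat.sub_self, Nat.sub_zero, List.replicate_zero, List.nil_append] at this
  exact this.mono (by rw [show 1 + B + 1 = B + 2 by omega])

theorem triple_forOnes_env {c : StackProg (Stk V A)} {B n : ℕ} (v : V) (T : ℕ → List Bool)
    (hc : ∀ i < n, Triple (Holds (Function.update ρ v (n - (i + 1))) σ E C (T i) U O) c B
      (Holds (Function.update ρ v (n - (i + 1))) σ E C (T (i + 1)) U O)) :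
    Triple (Holds (Function.update ρ v n) σ E C (T 0) U O) (forOnes (.env v) c)
      (n * (B + 2) + 1) (Holds (Function.update ρ v 0) σ E C (T n) U O) := by
  have := triple_while (c := .seq (pop (.env v)) c) (B := 1 + B) (k := .env v) (p := isOne)
    (fun i => Holds (Function.update ρ v (n - i)) σ E C (T i) U O) n
    (fun i hi s h => by
      rw [h.env, Function.update_self, ← List.append_nil (ones _)]; exact isOne_head_ones hi _)
    (fun s h => by rw [h.env]; simp [isOne])
    (fun i hi => by
      rw [show n - i = n - (i + 1) + 1 by omega]
      exact (triple_pop_env v).seq (hc i hi))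
  simp only [Nat.sub_self, Nat.sub_zero] at this
  exact this.mono (by rw [show 1 + B + 1 = B + 2 by omega])

/-! #### Moving unary numbers -/

theorem triple_eval_tmp (n : ℕ) :
    Triple (Holds ρ σ (ones n ++ false :: E) C [] U O) (forOnes .eval (push .tmp true))
      (n * 3 + 1) (Holds ρ σ (false :: E) C (ones n) U O) :=
  triple_forOnes_eval (n := n) (B := 1) E (fun _ => ρ) (fun _ => σ) (fun _ => C)
    (fun i => ones i) (fun _ => U) (fun _ => O) fun _ _ => triple_push_tmp true

theorem triple_eval_acc (n : ℕ) :
    Triple (Holds ρ σ (ones n ++ false :: E) C T U O) (forOnes .eval (push .acc true))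
      (n * 3 + 1) (Holds ρ σ (false :: E) (ones n ++ C) T U O) :=
  triple_forOnes_eval (n := n) (B := 1) E (fun _ => ρ) (fun _ => σ)
    (fun i => ones i ++ C) (fun _ => T) (fun _ => U) (fun _ => O) fun _ _ => triple_push_acc true

theorem triple_eval_env (v : V) (n : ℕ) :
    Triple (Holds (Function.update ρ v 0) σ (ones n ++ false :: E) C T U O)
      (forOnes .eval (push (.env v) true))
      (n * 3 + 1) (Holds (Function.update ρ v n) σ (false :: E) C T U O) :=
  triple_forOnes_eval (n := n) (B := 1) E (fun i => Function.update ρ v i) (fun _ => σ)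
    (fun _ => C) (fun _ => T) (fun _ => U) (fun _ => O) fun _ _ => triple_push_env v

theorem triple_clear_eval (n : ℕ) :
    Triple (Holds ρ σ (ones n ++ false :: E) C T U O) (forOnes .eval skip)
      (n * 3 + 1) (Holds ρ σ (false :: E) C T U O) :=
  triple_forOnes_eval (n := n) (B := 1) E (fun _ => ρ) (fun _ => σ) (fun _ => C)
    (fun _ => T) (fun _ => U) (fun _ => O) fun _ _ => triple_skip

theorem triple_tmp_eval (n : ℕ) :
    Triple (Holds ρ σ E C (ones n) U O) (forOnes .tmp (push .eval true))
      (n * 3 + 1) (Holds ρ σ (ones n ++ E) C [] U O) :=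
  triple_forOnes_tmp (n := n) (B := 1) (fun _ => ρ) (fun _ => σ) (fun i => ones i ++ E)
    (fun _ => C) (fun _ => U) (fun _ => O) fun _ _ => triple_push_eval true

theorem triple_clear_tmp (n : ℕ) :
    Triple (Holds ρ σ E C (ones n) U O) (forOnes .tmp skip)
      (n * 3 + 1) (Holds ρ σ E C [] U O) :=
  triple_forOnes_tmp (n := n) (B := 1) (fun _ => ρ) (fun _ => σ) (fun _ => E)
    (fun _ => C) (fun _ => U) (fun _ => O) fun _ _ => triple_skip

/-- Unary numbers can only be read destructively. Writing each one to two stacks restores the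
variable and yields a copy. -/
theorem triple_tmp_env_eval (v : V) (n : ℕ) :
    Triple (Holds (Function.update ρ v 0) σ E C (ones n) U O)
      (forOnes .tmp (seq (push (.env v) true) (push .eval true)))
      (n * 4 + 1) (Holds (Function.update ρ v n) σ (ones n ++ E) C [] U O) :=
  triple_forOnes_tmp (n := n) (B := 2) (fun i => Function.update ρ v i) (fun _ => σ)
    (fun i => ones i ++ E) (fun _ => C) (fun _ => U) (fun _ => O)
    fun _ _ => (triple_push_env v).seq (triple_push_eval true)

theorem triple_tmp_acc_tmp₂ (n : ℕ) :
    Triple (Holds ρ σ E C (ones n) [] O) (forOnes .tmp (seq (push .acc true) (push .tmp₂ true)))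
      (n * 4 + 1) (Holds ρ σ E (ones n ++ C) [] (ones n) O) :=
  triple_forOnes_tmp (n := n) (B := 2) (fun _ => ρ) (fun _ => σ) (fun _ => E)
    (fun i => ones i ++ C) (fun i => ones i) (fun _ => O)
    fun _ _ => (triple_push_acc true).seq (triple_push_tmp₂ true)

theorem triple_tmp₂_tmp (n : ℕ) :
    Triple (Holds ρ σ E C [] (ones n) O) (forOnes .tmp₂ (push .tmp true))
      (n * 3 + 1) (Holds ρ σ E C (ones n) [] O) :=
  triple_forOnes_tmp₂ (n := n) (B := 1) (fun i => ones i) fun _ _ => triple_push_tmp true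

theorem triple_acc_eval (n : ℕ) :
    Triple (Holds ρ σ E (ones n ++ false :: C) T U O) (forOnes .acc (push .eval true))
      (n * 3 + 1) (Holds ρ σ (ones n ++ E) (false :: C) T U O) :=
  triple_forOnes_acc (n := n) (B := 1) C (fun i => ones i ++ E) fun _ _ => triple_push_eval true

theorem triple_env_tmp (v : V) :
    Triple (Holds ρ σ E C [] U O) (forOnes (.env v) (push .tmp true))
      (ρ v * 3 + 1) (Holds (Function.update ρ v 0) σ E C (ones (ρ v)) U O) := by
  have := triple_forOnes_env (ρ := ρ) (σ := σ) (E := E) (C := C) (U := U) (O := O) (n := ρ v)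
    (B := 1) v (fun i => ones i) fun _ _ => triple_push_tmp true
  rwa [Function.update_eq_self] at this

theorem triple_clear_env (v : V) :
    Triple (Holds ρ σ E C T U O) (forOnes (.env v) skip)
      (ρ v * 3 + 1) (Holds (Function.update ρ v 0) σ E C T U O) := by
  have := triple_forOnes_env (ρ := ρ) (σ := σ) (E := E) (C := C) (U := U) (O := O) (n := ρ v)
    (B := 1) v (fun _ => T) fun _ _ => triple_skip
  rwa [Function.update_eq_self] at this

/-! #### Moving along an array -/

/-- Move the top of an array to the temporary stack; beyond the end of the array, a zero. -/
def shiftArr (a : A) : StackProg (Stk V A) :=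
  ite (.arr a) isOne (seq (pop (.arr a)) (push .tmp true)) (seq (pop (.arr a)) (push .tmp false))

omit [DecidableEq V] [DecidableEq A] in
theorem Holds.isOne_arr {s : Stk V A → List Bool} (h : Holds ρ σ E C T U O s) (a : A) :
    isOne (s (.arr a)).head? = σ a 0 := by
  rw [← h.arr]
  cases s (.arr a) with
  | nil => rfl
  | cons b l => cases b <;> rfl

/-- Both branches pop and push the bit that was found; an exhausted array counts as a zero. -/
theorem triple_shiftArr (a : A) {f : ℕ → Bool} :
    Triple (Holds ρ (Function.update σ a f) E C T U O) (shiftArr a) 3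
      (Holds ρ (Function.update σ a fun i => f (i + 1)) E C (f 0 :: T) U O) := by
  have h := fun b => (triple_pop_arr (ρ := ρ) (σ := σ) (E := E) (C := C) (T := T) (U := U)
    (O := O) (f := f) a).seq (triple_push_tmp b)
  cases hb : f 0
  · exact triple_ite_false (fun s hs => by rw [hs.isOne_arr]; simpa using hb) (h false)
  · exact triple_ite_true (fun s hs => by rw [hs.isOne_arr]; simpa using hb) (h true)

/-- The first `i` entries of an array, in reversed order. -/
def revTake (f : ℕ → Bool) : ℕ → List Bool
  | 0 => []
  | i + 1 => f i :: revTake f i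

/-- Move the entries before the index on top of the evaluation stack to the temporary stack. -/
theorem triple_seekArr (a : A) (n : ℕ) :
    Triple (Holds ρ σ (ones n ++ false :: E) C [] U O) (forOnes .eval (shiftArr a))
      (n * 5 + 1)
      (Holds ρ (Function.update σ a fun i => σ a (i + n)) (false :: E) C (revTake (σ a) n) U O) := by
  have := triple_forOnes_eval (n := n) (B := 3) (c := shiftArr a) E (fun _ => ρ)
    (fun m => Function.update σ a fun i => σ a (i + m)) (fun _ => C)
    (fun i => revTake (σ a) i) (fun _ => U) (fun _ => O) fun m _ => by
      have := triple_shiftArr (ρ := ρ) (σ := σ) (E := ones (n - (m + 1)) ++ false :: E) (C := C)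
        (T := revTake (σ a) m) (U := U) (O := O) a (f := fun i => σ a (i + m))
      simpa [revTake, Nat.add_right_comm, Nat.add_assoc] using this
  simpa [revTake] using this

/-- The loop that moves the temporary stack back to an array. -/
def unshiftArr (a : A) : StackProg (Stk V A) :=
  .while .tmp Option.isSome (ite .tmp isOne (seq (pop .tmp) (push (.arr a) true))
    (seq (pop .tmp) (push (.arr a) false)))

/-- The temporary stack has the entries in reversed order, so pushing them back one by one restores
the array. The loop tests for emptiness since both bits occur. -/
theorem triple_unshiftArr (a : A) (n : ℕ) (f : ℕ → Bool) (g : ℕ → Bool)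
    (hg : ∀ i, g (i + n) = f (i + n)) :
    Triple (Holds ρ (Function.update σ a fun i => g (i + n)) E C (revTake f n) U O)
      (unshiftArr a) (n * 4 + 1)
      (Holds ρ (Function.update σ a fun i => f i) E C [] U O) := by
  have := triple_while (k := .tmp) (p := Option.isSome) (B := 3)
    (c := ite .tmp isOne (seq (pop .tmp) (push (.arr a) true))
      (seq (pop .tmp) (push (.arr a) false)))
    -- After m iterations, n - m entries are still on the temporary stack.
    (fun m => Holds ρ (Function.update σ a fun i => f (i + (n - m))) E C (revTake f (n - m)) U O)
    n (fun m hm s h => by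
      obtain ⟨k, hk⟩ : ∃ k, n - m = k + 1 := ⟨n - m - 1, by omega⟩
      rw [h.tmp, hk]; rfl)
    (fun s h => by rw [h.tmp, Nat.sub_self]; rfl)
    (fun m hm => by
      obtain ⟨k, hk⟩ : ∃ k, n - m = k + 1 := ⟨n - m - 1, by omega⟩
      have hk' : n - (m + 1) = k := by omega
      rw [hk, hk']
      have h : ∀ b, b = f k → Triple
          (Holds ρ (Function.update σ a fun i => f (i + (k + 1))) E C (f k :: revTake f k) U O)
          (seq (pop .tmp) (push (.arr a) b)) 2
          (Holds ρ (Function.update σ a fun i => f (i + k)) E C (revTake f k) U O) := by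
        intro b hb
        have := (triple_pop_tmp (ρ := ρ) (σ := Function.update σ a fun i => f (i + (k + 1)))
          (E := E) (C := C) (T := revTake f k) (U := U) (O := O) (f k)).seq (triple_push_arr a b)
        have hf : (Nat.rec b fun i _ => f (i + (k + 1)) : ℕ → Bool) = fun i => f (i + k) := by
          funext i
          cases i with
          | zero => simp [hb]
          | succ i => simp only; congr 1; omega
        rwa [hf] at this
      cases hb : f k
      · have h' := h false hb.symm
        rw [hb] at h'
        rw [revTake, hb]
        exact triple_ite_false (fun s hs => by rw [hs.tmp]; rfl) h'
      · have h' := h true hb.symm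
        rw [hb] at h'
        rw [revTake, hb]
        exact triple_ite_true (fun s hs => by rw [hs.tmp]; rfl) h')
  simp only [Nat.sub_zero, Nat.sub_self, Nat.add_zero, revTake] at this
  simpa only [hg, unshiftArr] using this

end StackProg

/-! ### Syntax and semantics of the loop language -/

/-- Numerical expressions over the variables `V` and the bit arrays `A`. In `sum v e₁ e₂`, the
variable `v` is bound: the value is the sum of `e₂` over all values `v < e₁`. -/
inductive Expr (V A : Type) : Type
  | const (n : ℕ)
  | var (v : V)
  | add (e₁ e₂ : Expr V A)
  | sub (e₁ e₂ : Expr V A)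
  | mul (e₁ e₂ : Expr V A)
  | read (a : A) (e : Expr V A)
  | sum (v : V) (e₁ e₂ : Expr V A)

/-- Commands: write a bit into an array, emit an output bit, sequential composition, case
distinction, and bounded loops, which bind their variable. -/
inductive Cmd (V A : Type) : Type
  | write (a : A) (e₁ e₂ : Expr V A)
  | emit (e : Expr V A)
  | seq (c₁ c₂ : Cmd V A)
  | ifThen (e : Expr V A) (c : Cmd V A)
  | loop (v : V) (e : Expr V A) (c : Cmd V A)

/-- `f (n - 1) (⋯ (f 0 x))`. -/
def iterFor {α : Type*} (f : ℕ → α → α) (x : α) : ℕ → α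
  | 0 => x
  | n + 1 => f n (iterFor f x n)

section Semantics

variable {V A : Type} [DecidableEq V] [DecidableEq A]

/-- The value of an expression. -/
def Expr.val : Expr V A → (V → ℕ) → (A → ℕ → Bool) → ℕ
  | const n, _, _ => n
  | var v, ρ, _ => ρ v
  | add e₁ e₂, ρ, σ => e₁.val ρ σ + e₂.val ρ σ
  | sub e₁ e₂, ρ, σ => e₁.val ρ σ - e₂.val ρ σ
  | mul e₁ e₂, ρ, σ => e₁.val ρ σ * e₂.val ρ σ
  | read a e, ρ, σ => (σ a (e.val ρ σ)).toNat
  | sum v e₁ e₂, ρ, σ => ∑ i ∈ Finset.range (e₁.val ρ σ), e₂.val (Function.update ρ v i) σ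

/-- The effect of a command on the arrays and the list of output bits. -/
def Cmd.run : Cmd V A → (V → ℕ) → (A → ℕ → Bool) × List Bool → (A → ℕ → Bool) × List Bool
  | write a e₁ e₂, ρ, x =>
    (Function.update x.1 a (Function.update (x.1 a) (e₁.val ρ x.1) (decide (e₂.val ρ x.1 ≠ 0))), x.2)
  | emit e, ρ, x => (x.1, decide (e.val ρ x.1 ≠ 0) :: x.2)
  | seq c₁ c₂, ρ, x => c₂.run ρ (c₁.run ρ x)
  | ifThen e c, ρ, x => if e.val ρ x.1 ≠ 0 then c.run ρ x else x
  | loop v e c, ρ, x => iterFor (fun i => c.run (Function.update ρ v i)) x (e.val ρ x.1)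

end Semantics

/-! ### Compilation of expressions -/

namespace StackProg

variable {V A : Type} [DecidableEq V] [DecidableEq A]

/-- There is a program that computes the expression in polynomial time (in the values of the
variables) and pushes its value. -/
def ComputesExpr (e : Expr V A) (c : StackProg (Stk V A)) (p : Polynomial ℕ) : Prop :=
  ∀ (M : ℕ) (ρ : V → ℕ) (σ : A → ℕ → Bool) (E C O : List Bool), (∀ v, ρ v ≤ M) →
    e.val ρ σ ≤ p.eval M ∧ Triple (Holds ρ σ E C [] [] O) c (p.eval M)
      (Holds ρ σ (ones (e.val ρ σ) ++ false :: E) C [] [] O)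

theorem computesExpr_const (n : ℕ) :
    ∃ c p, ComputesExpr (Expr.const n : Expr V A) c p := by
  induction n with
  | zero =>
    exact ⟨push .eval false, 1, fun M ρ σ E C O _ => ⟨by simp [Expr.val], by
      simpa [Expr.val] using triple_push_eval false⟩⟩
  | succ n ih =>
    obtain ⟨c, p, h⟩ := ih
    refine ⟨seq c (push .eval true), p + 1, fun M ρ σ E C O hρ => ?_⟩
    obtain ⟨h₁, h₂⟩ := h M ρ σ E C O hρ
    refine ⟨by simpa [Expr.val] using h₁, ?_⟩
    rw [Polynomial.eval_add, Polynomial.eval_one]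
    exact h₂.seq (triple_push_eval true)

/-- The program that pushes the value of a variable. -/
def pushVar (v : V) : StackProg (Stk V A) :=
  seq (push .eval false) (seq (forOnes (.env v) (push .tmp true))
    (forOnes .tmp (seq (push (.env v) true) (push .eval true))))

theorem triple_pushVar (v : V) {ρ : V → ℕ} {σ : A → ℕ → Bool} {E C O : List Bool} :
    Triple (Holds ρ σ E C [] [] O) (pushVar v) (ρ v * 7 + 3)
      (Holds ρ σ (ones (ρ v) ++ false :: E) C [] [] O) := by
  have h := triple_tmp_env_eval (ρ := ρ) (σ := σ) (E := false :: E) (C := C) (U := []) (O := O)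
    v (ρ v)
  rw [Function.update_eq_self] at h
  exact ((triple_push_eval false).seq ((triple_env_tmp v).seq h)).mono (by omega)

theorem computesExpr_var (v : V) : ∃ c p, ComputesExpr (Expr.var v : Expr V A) c p := by
  refine ⟨pushVar v, Polynomial.X * 7 + 3, fun M ρ σ E C O hρ => ⟨?_, ?_⟩⟩
  · have := hρ v
    simp [Expr.val]
    omega
  · refine (triple_pushVar v).mono ?_
    have := hρ v
    simp
    omega

/-- The second number takes a detour over the temporary stack, so that its end marker can be
removed; its ones then lie directly on those of the first. -/
theorem computesExpr_add {e₁ e₂ : Expr V A} (h₁ : ∃ c p, ComputesExpr e₁ c p)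
    (h₂ : ∃ c p, ComputesExpr e₂ c p) : ∃ c p, ComputesExpr (Expr.add e₁ e₂) c p := by
  obtain ⟨c₁, p₁, h₁⟩ := h₁
  obtain ⟨c₂, p₂, h₂⟩ := h₂
  refine ⟨seq c₁ (seq c₂ (seq (forOnes .eval (push .tmp true)) (seq (pop .eval)
    (forOnes .tmp (push .eval true))))), p₁ + p₂ + p₂ * 6 + 3, fun M ρ σ E C O hρ => ?_⟩
  obtain ⟨hv₁, ht₁⟩ := h₁ M ρ σ E C O hρ
  obtain ⟨hv₂, ht₂⟩ := h₂ M ρ σ (ones (e₁.val ρ σ) ++ false :: E) C O hρ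
  refine ⟨by simp [Expr.val]; omega, ?_⟩
  have h := (triple_eval_tmp (ρ := ρ) (σ := σ) (E := ones (e₁.val ρ σ) ++ false :: E) (C := C)
    (U := []) (O := O) (e₂.val ρ σ)).seq ((triple_pop_eval false).seq
      (triple_tmp_eval (e₂.val ρ σ)))
  have h' := ht₁.seq (ht₂.seq h)
  rw [← List.append_assoc, ← List.replicate_add, Nat.add_comm (e₂.val ρ σ) (e₁.val ρ σ)] at h'
  refine h'.mono ?_
  simp
  omega

/-- Each one of the subtrahend removes a one of the minuend, if there is any left. The end marker of
the minuend is never removed, which makes the subtraction truncated. -/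
theorem computesExpr_sub {e₁ e₂ : Expr V A} (h₁ : ∃ c p, ComputesExpr e₁ c p)
    (h₂ : ∃ c p, ComputesExpr e₂ c p) : ∃ c p, ComputesExpr (Expr.sub e₁ e₂) c p := by
  obtain ⟨c₁, p₁, h₁⟩ := h₁
  obtain ⟨c₂, p₂, h₂⟩ := h₂
  refine ⟨seq c₁ (seq c₂ (seq (forOnes .eval (push .tmp true)) (seq (pop .eval)
    (forOnes .tmp (ite .eval isOne (pop .eval) skip))))), p₁ + p₂ + p₂ * 7 + 3,
    fun M ρ σ E C O hρ => ?_⟩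
  obtain ⟨hv₁, ht₁⟩ := h₁ M ρ σ E C O hρ
  obtain ⟨hv₂, ht₂⟩ := h₂ M ρ σ (ones (e₁.val ρ σ) ++ false :: E) C O hρ
  refine ⟨by simp [Expr.val]; omega, ?_⟩
  have h₃ := triple_forOnes_tmp (n := e₂.val ρ σ) (B := 2) (c := ite .eval isOne (pop .eval) skip)
    (fun _ => ρ) (fun _ => σ) (fun i => ones (e₁.val ρ σ - i) ++ false :: E)
    (fun _ => C) (fun _ => []) (fun _ => O) fun i _ => by
      rcases Nat.lt_or_ge i (e₁.val ρ σ) with hi | hi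
      · refine triple_ite_true (B := 1)
          (fun s hs => by rw [hs.eval]; exact isOne_head_ones hi _) ?_
        rw [ones_sub hi]
        exact triple_pop_eval true
      · have h0 : e₁.val ρ σ - i = 0 := by omega
        have h1 : e₁.val ρ σ - (i + 1) = 0 := by omega
        rw [h0, h1]
        exact triple_ite_false (fun s hs => by rw [hs.eval]; rfl) triple_skip
  have h := (triple_eval_tmp (ρ := ρ) (σ := σ) (E := ones (e₁.val ρ σ) ++ false :: E) (C := C)
    (U := []) (O := O) (e₂.val ρ σ)).seq ((triple_pop_eval false).seq
      h₃)
  refine (ht₁.seq (ht₂.seq h)).mono ?_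
  simp
  omega

/-- For each one of the first factor, the second factor is copied from the temporary stack to the
accumulator, with `tmp₂` keeping the copy that is moved back. The end marker of the first factor
becomes that of the product. -/
theorem computesExpr_mul {e₁ e₂ : Expr V A} (h₁ : ∃ c p, ComputesExpr e₁ c p)
    (h₂ : ∃ c p, ComputesExpr e₂ c p) : ∃ c p, ComputesExpr (Expr.mul e₁ e₂) c p := by
  obtain ⟨c₁, p₁, h₁⟩ := h₁
  obtain ⟨c₂, p₂, h₂⟩ := h₂
  refine ⟨seq c₁ (seq c₂ (seq (forOnes .eval (push .tmp true)) (seq (pop .eval)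
    (seq (push .acc false) (seq (forOnes .eval (seq
      (forOnes .tmp (seq (push .acc true) (push .tmp₂ true))) (forOnes .tmp₂ (push .tmp true))))
    (seq (forOnes .tmp skip) (seq (forOnes .acc (push .eval true)) (pop .acc)))))))),
    p₁ + (p₂ + ((p₂ * 3 + 1) + 1 + 1 + (p₁ * (p₂ * 7 + 4) + 1) + (p₂ * 3 + 1)
      + (p₁ * p₂ * 3 + 1) + 1)),
    fun M ρ σ E C O hρ => ?_⟩
  obtain ⟨hv₁, ht₁⟩ := h₁ M ρ σ E C O hρ
  obtain ⟨hv₂, ht₂⟩ := h₂ M ρ σ (ones (e₁.val ρ σ) ++ false :: E) C O hρ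
  have hmul := Nat.mul_le_mul hv₁ hv₂
  refine ⟨by simp [Expr.val]; omega, ?_⟩
  rw [show (Expr.mul e₁ e₂).val ρ σ = e₁.val ρ σ * e₂.val ρ σ from rfl]
  generalize e₁.val ρ σ = a at *
  have h₃ := triple_forOnes_eval (n := a) (B := e₂.val ρ σ * 7 + 2)
    (c := seq
      (forOnes .tmp (seq (push .acc true) (push .tmp₂ true))) (forOnes .tmp₂ (push .tmp true)))
    E (fun _ => ρ) (fun _ => σ) (fun i => ones (i * e₂.val ρ σ) ++ false :: C)
    (fun _ => ones (e₂.val ρ σ)) (fun _ => []) (fun _ => O) fun i _ => by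
      have h := (triple_tmp_acc_tmp₂ (ρ := ρ) (σ := σ) (E := ones (a - (i + 1)) ++ false :: E)
        (C := ones (i * e₂.val ρ σ) ++ false :: C) (O := O) (e₂.val ρ σ)).seq
        (triple_tmp₂_tmp (e₂.val ρ σ))
      rw [← List.append_assoc, ← List.replicate_add] at h
      rw [Nat.succ_mul, Nat.add_comm (i * _)]
      exact h.mono (by omega)
  simp only [Nat.zero_mul, List.replicate_zero, List.nil_append] at h₃
  have h := (triple_eval_tmp (ρ := ρ) (σ := σ) (E := ones a ++ false :: E) (C := C)
    (U := []) (O := O) (e₂.val ρ σ)).seq ((triple_pop_eval false).seq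
      ((triple_push_acc false).seq (h₃.seq
      ((triple_clear_tmp _).seq ((triple_acc_eval _).seq (triple_pop_acc false))))))
  refine (ht₁.seq (ht₂.seq h)).mono ?_
  have := Nat.mul_le_mul hv₁ (show e₂.val ρ σ * 7 + 4 ≤ p₂.eval M * 7 + 4 by omega)
  rw [show e₂.val ρ σ * 7 + 2 + 2 = e₂.val ρ σ * 7 + 4 by omega]
  simp
  omega

/-- The entries before the index are moved to the temporary stack, the top of the array is
inspected, and the entries are moved back. -/
theorem computesExpr_read (a : A) {e : Expr V A} (h : ∃ c p, ComputesExpr e c p) :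
    ∃ c p, ComputesExpr (Expr.read a e) c p := by
  obtain ⟨c, p, h⟩ := h
  refine ⟨seq c (seq (forOnes .eval (shiftArr a)) (seq (ite (.arr a) isOne (push .eval true) skip)
    (unshiftArr a))), p + ((p * 5 + 1) + 2 + (p * 4 + 1)), fun M ρ σ E C O hρ => ?_⟩
  obtain ⟨hv, ht⟩ := h M ρ σ E C O hρ
  refine ⟨?_, ?_⟩
  · have := Bool.toNat_le (σ a (e.val ρ σ))
    simp [Expr.val]
    omega
  have h₁ : Triple
      (Holds ρ (Function.update σ a fun i => σ a (i + e.val ρ σ)) (false :: E) C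
        (revTake (σ a) (e.val ρ σ)) [] O)
      (ite (.arr a) isOne (push .eval true) skip) 2
      (Holds ρ (Function.update σ a fun i => σ a (i + e.val ρ σ))
        (ones (σ a (e.val ρ σ)).toNat ++ false :: E) C (revTake (σ a) (e.val ρ σ)) [] O) := by
    cases hb : σ a (e.val ρ σ)
    · exact triple_ite_false (fun s hs => by rw [hs.isOne_arr]; simpa using hb) triple_skip
    · exact triple_ite_true (fun s hs => by rw [hs.isOne_arr]; simpa using hb)
        (triple_push_eval true)
  have h₂ := triple_unshiftArr (ρ := ρ) (σ := σ)
    (E := ones (σ a (e.val ρ σ)).toNat ++ false :: E) (C := C) (U := []) (O := O)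
    a (e.val ρ σ) (σ a) (σ a) fun _ => rfl
  have h₃ : (Function.update σ a fun i => σ a i) = σ := Function.update_eq_self a σ
  rw [h₃] at h₂
  refine (ht.seq ((triple_seekArr a _).seq (h₁.seq h₂))).mono ?_
  simp
  omega

theorem update_le {ρ : V → ℕ} {M i : ℕ} (hρ : ∀ v, ρ v ≤ M) (hi : i ≤ M) (v w : V) :
    Function.update ρ v i w ≤ M := by
  by_cases hw : w = v
  · subst hw; simpa
  · simpa [hw] using hρ w

/-- The bound variable is a genuine stack, so its old value is saved on the evaluation stack and
restored afterwards; the end marker of the saved value becomes that of the result. The accumulator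
gets its own end marker because sums may be nested. -/
theorem computesExpr_sum (v : V) {e₁ e₂ : Expr V A} (h₁ : ∃ c p, ComputesExpr e₁ c p)
    (h₂ : ∃ c p, ComputesExpr e₂ c p) : ∃ c p, ComputesExpr (Expr.sum v e₁ e₂) c p := by
  obtain ⟨c₁, p₁, h₁⟩ := h₁
  obtain ⟨c₂, p₂, h₂⟩ := h₂
  -- In the summands, the bound variable is at most the value of the first expression, so all
  -- variables are at most M + p₁(M).
  let q : Polynomial ℕ := p₂.comp (Polynomial.X + p₁)
  refine ⟨seq (pushVar v) (seq c₁ (seq (push .acc false) (seq (forOnes (.env v) skip)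
    (seq (forOnes .eval (seq c₂ (seq (forOnes .eval (push .acc true)) (seq (pop .eval)
      (push (.env v) true)))))
    (seq (pop .eval) (seq (forOnes (.env v) skip) (seq (forOnes .eval (push (.env v) true))
    (seq (forOnes .acc (push .eval true)) (pop .acc))))))))),
    (Polynomial.X * 7 + 3) + (p₁ + (1 + ((Polynomial.X * 3 + 1) + ((p₁ * (q * 4 + 5) + 1) + (1 +
      ((p₁ * 3 + 1) + ((Polynomial.X * 3 + 1) + ((p₁ * q * 3 + 1) + 1)))))))),
    fun M ρ σ E C O hρ => ?_⟩
  obtain ⟨hv₁, ht₁⟩ := h₁ M ρ σ (ones (ρ v) ++ false :: E) C O hρ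
  have hq : q.eval M = p₂.eval (M + p₁.eval M) := by simp [q]
  have h₂' : ∀ i ≤ e₁.val ρ σ, ∀ E C, _ := fun i hi E C =>
    h₂ (M + p₁.eval M) (Function.update ρ v i) σ E C O
    (update_le (fun w => (hρ w).trans (by omega)) (by omega) v)
  rw [← hq] at h₂'
  have hsum : ∀ n ≤ e₁.val ρ σ,
      ∑ i ∈ Finset.range n, e₂.val (Function.update ρ v i) σ ≤ n * q.eval M := by
    intro n hn
    calc _ ≤ ∑ i ∈ Finset.range n, q.eval M := Finset.sum_le_sum fun i hi =>
          (h₂' i (by have := Finset.mem_range.1 hi; omega) [] []).1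
      _ = _ := by simp
  have hmul := Nat.mul_le_mul_right (q.eval M) hv₁
  have hval := (hsum _ le_rfl).trans hmul
  refine ⟨by simp [Expr.val]; omega, ?_⟩
  have hr : (Expr.sum v e₁ e₂).val ρ σ =
    ∑ i ∈ Finset.range (e₁.val ρ σ), e₂.val (Function.update ρ v i) σ := rfl
  generalize (Expr.sum v e₁ e₂).val ρ σ = r at *
  generalize hn : e₁.val ρ σ = n at *
  have h₃ := triple_forOnes_eval (n := n) (B := q.eval M * 4 + 3)
    (c := seq c₂ (seq (forOnes .eval (push .acc true)) (seq (pop .eval)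
      (push (.env v) true))))
    (ones (ρ v) ++ false :: E) (fun i => Function.update ρ v i) (fun _ => σ)
    (fun m => ones (∑ i ∈ Finset.range m, e₂.val (Function.update ρ v i) σ) ++ false :: C)
    (fun _ => []) (fun _ => []) (fun _ => O) fun i hi => by
      obtain ⟨hv₂, ht₂⟩ := h₂' i hi.le (ones (n - (i + 1)) ++ false :: (ones (ρ v) ++ false :: E))
        (ones (∑ i ∈ Finset.range i, e₂.val (Function.update ρ v i) σ) ++ false :: C)
      have h := ht₂.seq ((triple_eval_acc _).seq ((triple_pop_eval false).seq (triple_push_env v)))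
      rw [← List.append_assoc (ones _), ← List.replicate_add, Nat.add_comm (e₂.val _ _),
        ← Finset.sum_range_succ] at h
      exact h.mono (by omega)
  simp only [Finset.range_zero, Finset.sum_empty, List.replicate_zero, List.nil_append] at h₃
  have h₄ := triple_clear_env (ρ := Function.update ρ v n) (σ := σ)
    (E := ones (ρ v) ++ false :: E) (C := ones r ++ false :: C) (T := []) (U := []) (O := O) v
  rw [Function.update_idem, Function.update_self] at h₄
  have h₅ := triple_eval_env (ρ := ρ) (σ := σ) (E := E) (C := ones r ++ false :: C) (T := [])
    (U := []) (O := O) v (ρ v)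
  rw [Function.update_eq_self] at h₅
  rw [← hr] at h₃
  have h := (triple_pushVar v).seq (ht₁.seq ((triple_push_acc false).seq
    ((triple_clear_env v).seq (h₃.seq ((triple_pop_eval false).seq (h₄.seq (h₅.seq
      ((triple_acc_eval r).seq (triple_pop_acc false)))))))))
  refine h.mono ?_
  have h6 := hρ v
  have h7 := Nat.mul_le_mul_right (q.eval M * 4 + 5) hv₁
  rw [show q.eval M * 4 + 3 + 2 = q.eval M * 4 + 5 by omega]
  simp only [Polynomial.eval_add, Polynomial.eval_mul, Polynomial.eval_X, Polynomial.eval_ofNat,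
    Polynomial.eval_one] at *
  omega

theorem exists_computesExpr (e : Expr V A) : ∃ c p, ComputesExpr e c p := by
  induction e with
  | const n => exact computesExpr_const n
  | var v => exact computesExpr_var v
  | add _ _ h₁ h₂ => exact computesExpr_add h₁ h₂
  | sub _ _ h₁ h₂ => exact computesExpr_sub h₁ h₂
  | mul _ _ h₁ h₂ => exact computesExpr_mul h₁ h₂
  | read a _ h => exact computesExpr_read a h
  | sum v _ _ h₁ h₂ => exact computesExpr_sum v h₁ h₂

/-! ### Compilation of commands -/

/-- There is a program that runs the command in polynomial time (in the values of the
variables). -/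
def RunsCmd (d : Cmd V A) (c : StackProg (Stk V A)) (p : Polynomial ℕ) : Prop :=
  ∀ (M : ℕ) (ρ : V → ℕ) (σ : A → ℕ → Bool) (E C O : List Bool), (∀ v, ρ v ≤ M) →
    Triple (Holds ρ σ E C [] [] O) c (p.eval M)
      (Holds ρ (d.run ρ (σ, O)).1 E C [] [] (d.run ρ (σ, O)).2)

/-- The case distinction whether the value on the evaluation stack is nonzero. -/
theorem triple_ite_eval {c₁ c₂ : StackProg (Stk V A)} {n B : ℕ} {ρ : V → ℕ} {σ : A → ℕ → Bool}
    {E C T U O : List Bool} {Q : (Stk V A → List Bool) → Prop}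
    (h₁ : n ≠ 0 → Triple (Holds ρ σ (ones n ++ false :: E) C T U O) c₁ B Q)
    (h₂ : n = 0 → Triple (Holds ρ σ (ones n ++ false :: E) C T U O) c₂ B Q) :
    Triple (Holds ρ σ (ones n ++ false :: E) C T U O) (ite .eval isOne c₁ c₂) (1 + B) Q := by
  cases n with
  | zero => exact triple_ite_false (fun s hs => by rw [hs.eval]; rfl) (h₂ rfl)
  | succ n => exact triple_ite_true (fun s hs => by rw [hs.eval]; rfl) (h₁ n.succ_ne_zero)

/-- The value is computed before the position, so that the position lies on top and is used up by
the search in the array; the value is then available for the choice of the bit. -/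
theorem runsCmd_write (a : A) (e₁ e₂ : Expr V A) : ∃ c p, RunsCmd (Cmd.write a e₁ e₂) c p := by
  obtain ⟨c₁, p₁, h₁⟩ := exists_computesExpr e₁
  obtain ⟨c₂, p₂, h₂⟩ := exists_computesExpr e₂
  refine ⟨seq c₂ (seq c₁ (seq (forOnes .eval (shiftArr a)) (seq (pop .eval) (seq (pop (.arr a))
    (seq (ite .eval isOne (push (.arr a) true) (push (.arr a) false)) (seq (forOnes .eval skip)
    (seq (pop .eval) (unshiftArr a)))))))),
    p₂ + (p₁ + ((p₁ * 5 + 1) + (1 + (1 + (2 + ((p₂ * 3 + 1) + (1 + (p₁ * 4 + 1)))))))),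
    fun M ρ σ E C O hρ => ?_⟩
  obtain ⟨hv₂, ht₂⟩ := h₂ M ρ σ E C O hρ
  obtain ⟨hv₁, ht₁⟩ := h₁ M ρ σ (ones (e₂.val ρ σ) ++ false :: E) C O hρ
  have hb : ∀ b, b = decide (e₂.val ρ σ ≠ 0) → Triple
      (Holds ρ (Function.update σ a fun i => σ a (i + 1 + e₁.val ρ σ))
        (ones (e₂.val ρ σ) ++ false :: E) C (revTake (σ a) (e₁.val ρ σ)) [] O)
      (push (.arr a) b) 1
      (Holds ρ (Function.update σ a fun i =>
        Function.update (σ a) (e₁.val ρ σ) (decide (e₂.val ρ σ ≠ 0)) (i + e₁.val ρ σ))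
        (ones (e₂.val ρ σ) ++ false :: E) C (revTake (σ a) (e₁.val ρ σ)) [] O) := by
    intro b hb
    have h := triple_push_arr (ρ := ρ) (σ := σ)
      (E := ones (e₂.val ρ σ) ++ false :: E) (C := C) (T := revTake (σ a) (e₁.val ρ σ)) (U := [])
      (O := O) a b (f := fun i => σ a (i + 1 + e₁.val ρ σ))
    convert h using 3
    funext i
    cases i with
    | zero => simp [hb]
    | succ i => rw [Function.update_of_ne (by omega)]
  -- The write does not touch the entries that are parked on the temporary stack.
  have hrev : ∀ n b, revTake (σ a) n = revTake (Function.update (σ a) n b) n := by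
    intro n b
    have : ∀ k ≤ n, revTake (σ a) k = revTake (Function.update (σ a) n b) k := by
      intro k
      induction k with
      | zero => exact fun _ => rfl
      | succ k ih =>
        intro hk
        rw [revTake, revTake, ih (by omega), Function.update_of_ne (by omega)]
    exact this n le_rfl
  have h₃ := triple_unshiftArr (ρ := ρ) (σ := σ) (E := E) (C := C) (U := []) (O := O) a
    (e₁.val ρ σ) (Function.update (σ a) (e₁.val ρ σ) (decide (e₂.val ρ σ ≠ 0)))
    (Function.update (σ a) (e₁.val ρ σ) (decide (e₂.val ρ σ ≠ 0))) fun _ => rfl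
  rw [← hrev] at h₃
  have h₄ := triple_pop_arr (ρ := ρ) (σ := σ) (E := ones (e₂.val ρ σ) ++ false :: E) (C := C)
    (T := revTake (σ a) (e₁.val ρ σ)) (U := []) (O := O) a (f := fun i => σ a (i + e₁.val ρ σ))
  have h := ht₂.seq (ht₁.seq ((triple_seekArr a _).seq ((triple_pop_eval false).seq (h₄.seq
    ((triple_ite_eval (fun h0 => hb true (by simp [h0])) (fun h0 => hb false (by simp [h0]))).seq
      ((triple_clear_eval _).seq ((triple_pop_eval false).seq h₃)))))))
  refine h.mono ?_
  simp
  omega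

theorem runsCmd_emit (e : Expr V A) : ∃ c p, RunsCmd (Cmd.emit e) c p := by
  obtain ⟨c, p, h⟩ := exists_computesExpr e
  refine ⟨seq c (seq (ite .eval isOne (push .out true) (push .out false))
    (seq (forOnes .eval skip) (pop .eval))), p + (2 + ((p * 3 + 1) + 1)),
    fun M ρ σ E C O hρ => ?_⟩
  obtain ⟨hv, ht⟩ := h M ρ σ E C O hρ
  have hb : ∀ b, b = decide (e.val ρ σ ≠ 0) → Triple
      (Holds ρ σ (ones (e.val ρ σ) ++ false :: E) C [] [] O) (push .out b) 1
      (Holds ρ σ (ones (e.val ρ σ) ++ false :: E) C [] [] (decide (e.val ρ σ ≠ 0) :: O)) :=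
    fun b hb => hb ▸ triple_push_out b
  refine (ht.seq ((triple_ite_eval (fun h0 => hb true (by simp [h0]))
    (fun h0 => hb false (by simp [h0]))).seq ((triple_clear_eval _).seq
      (triple_pop_eval false)))).mono ?_
  simp
  omega

theorem runsCmd_ifThen (e : Expr V A) {d : Cmd V A} (hd : ∃ c p, RunsCmd d c p) :
    ∃ c p, RunsCmd (Cmd.ifThen e d) c p := by
  obtain ⟨c, p, h⟩ := exists_computesExpr e
  obtain ⟨c', p', h'⟩ := hd
  refine ⟨seq c (ite .eval isOne (seq (forOnes .eval skip) (seq (pop .eval) c')) (pop .eval)),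
    p + (1 + ((p * 3 + 1) + (1 + p'))), fun M ρ σ E C O hρ => ?_⟩
  obtain ⟨hv, ht⟩ := h M ρ σ E C O hρ
  simp only [Polynomial.eval_add, Polynomial.eval_mul, Polynomial.eval_ofNat, Polynomial.eval_one]
  refine ht.seq (triple_ite_eval (fun h0 => ?_) (fun h0 => ?_))
  · rw [Cmd.run, if_pos h0]
    exact ((triple_clear_eval _).seq ((triple_pop_eval false).seq (h' M ρ σ E C O hρ))).mono
      (by omega)
  · rw [Cmd.run, if_neg (by simpa using h0), h0]
    exact (triple_pop_eval false).mono (by omega)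

/-- As for sums, the old value of the loop variable is saved and restored. The number of iterations
is evaluated once, before the loop. -/
theorem runsCmd_loop (v : V) (e : Expr V A) {d : Cmd V A} (hd : ∃ c p, RunsCmd d c p) :
    ∃ c p, RunsCmd (Cmd.loop v e d) c p := by
  obtain ⟨c₁, p₁, h₁⟩ := exists_computesExpr e
  obtain ⟨c₂, p₂, h₂⟩ := hd
  let q : Polynomial ℕ := p₂.comp (Polynomial.X + p₁)
  refine ⟨seq (pushVar v) (seq c₁ (seq (forOnes (.env v) skip)
    (seq (forOnes .eval (seq c₂ (push (.env v) true)))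
    (seq (pop .eval) (seq (forOnes (.env v) skip) (seq (forOnes .eval (push (.env v) true))
      (pop .eval))))))),
    (Polynomial.X * 7 + 3) + (p₁ + ((Polynomial.X * 3 + 1) + ((p₁ * (q + 3) + 1) + (1 +
      ((p₁ * 3 + 1) + ((Polynomial.X * 3 + 1) + 1)))))),
    fun M ρ σ E C O hρ => ?_⟩
  obtain ⟨hv₁, ht₁⟩ := h₁ M ρ σ (ones (ρ v) ++ false :: E) C O hρ
  have hq : q.eval M = p₂.eval (M + p₁.eval M) := by simp [q]
  -- The arrays and the output change between iterations; the time bound does not depend on them, so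
  -- one bound serves all iterations.
  have h₂' : ∀ i ≤ e.val ρ σ, ∀ σ E O, _ := fun i hi σ E O =>
    h₂ (M + p₁.eval M) (Function.update ρ v i) σ E C O
    (update_le (fun w => (hρ w).trans (by omega)) (by omega) v)
  rw [← hq] at h₂'
  have hr : (Cmd.loop v e d).run ρ (σ, O) =
    iterFor (fun i => d.run (Function.update ρ v i)) (σ, O) (e.val ρ σ) := rfl
  rw [hr]
  generalize hn : e.val ρ σ = n at *
  generalize hf : iterFor (fun i => d.run (Function.update ρ v i)) (σ, O) = f
  have hf0 : f 0 = (σ, O) := by rw [← hf]; rfl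
  have hf1 : ∀ i, f (i + 1) = d.run (Function.update ρ v i) (f i) := by
    intro i; rw [← hf]; rfl
  have h₃ := triple_forOnes_eval (n := n) (B := q.eval M + 1)
    (c := seq c₂ (push (.env v) true))
    (ones (ρ v) ++ false :: E) (fun i => Function.update ρ v i) (fun i => (f i).1)
    (fun _ => C) (fun _ => []) (fun _ => []) (fun i => (f i).2) fun i hi => by
      have h := h₂' i hi.le (f i).1
        (ones (n - (i + 1)) ++ false :: (ones (ρ v) ++ false :: E)) (f i).2
      rw [hf1]
      exact h.seq (triple_push_env v)
  rw [hf0] at h₃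
  have h₄ := triple_clear_env (ρ := Function.update ρ v n) (σ := (f n).1)
    (E := ones (ρ v) ++ false :: E) (C := C) (T := []) (U := []) (O := (f n).2) v
  rw [Function.update_idem, Function.update_self] at h₄
  have h₅ := triple_eval_env (ρ := ρ) (σ := (f n).1) (E := E) (C := C) (T := [])
    (U := []) (O := (f n).2) v (ρ v)
  rw [Function.update_eq_self] at h₅
  have h := (triple_pushVar v).seq (ht₁.seq ((triple_clear_env v).seq (h₃.seq
    ((triple_pop_eval false).seq (h₄.seq (h₅.seq (triple_pop_eval false)))))))
  refine h.mono ?_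
  have h6 := hρ v
  have h7 := Nat.mul_le_mul_right (q.eval M + 3) hv₁
  rw [show q.eval M + 1 + 2 = q.eval M + 3 by omega]
  simp only [Polynomial.eval_add, Polynomial.eval_mul, Polynomial.eval_X, Polynomial.eval_ofNat,
    Polynomial.eval_one] at *
  omega

theorem exists_runsCmd (d : Cmd V A) : ∃ c p, RunsCmd d c p := by
  induction d with
  | write a e₁ e₂ => exact runsCmd_write a e₁ e₂
  | emit e => exact runsCmd_emit e
  | seq _ _ h₁ h₂ =>
    obtain ⟨c₁, p₁, h₁⟩ := h₁
    obtain ⟨c₂, p₂, h₂⟩ := h₂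
    refine ⟨.seq c₁ c₂, p₁ + p₂, fun M ρ σ E C O hρ => ?_⟩
    rw [Polynomial.eval_add]
    exact (h₁ M ρ σ E C O hρ).seq (h₂ M ρ _ E C _ hρ)
  | ifThen e _ h => exact runsCmd_ifThen e h
  | loop v e _ h => exact runsCmd_loop v e h

end StackProg

namespace StackProg

/-! ### Whole programs -/

section Clear

variable {K : Type} [DecidableEq K]

/-- Empty the stacks in a list. -/
def clearAll : List K → StackProg K
  | [] => skip
  | k :: ks => seq (.while k Option.isSome (pop k)) (clearAll ks)

theorem triple_clear (k : K) (s : K → List Bool) :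
    Triple (fun s' => s' = s) (.while k Option.isSome (pop k)) ((s k).length * 2 + 1)
      (fun s' => s' = Function.update s k []) := by
  have := triple_while (k := k) (p := Option.isSome) (c := pop k) (B := 1)
    (fun i s' => s' = Function.update s k ((s k).drop i)) (s k).length
    (fun i hi s' hs' => by simp [hs', hi])
    (fun s' hs' => by simp [hs'])
    (fun i _ => triple_pop fun s' hs' => by simp [hs'])
  simpa using this

theorem triple_clearAll (ks : List K) (L : ℕ) (s : K → List Bool) (hL : ∀ k, (s k).length ≤ L) :
    Triple (fun s' => s' = s) (clearAll ks) (ks.length * (L * 2 + 1) + 1)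
      (fun s' => s' = fun k => if k ∈ ks then [] else s k) := by
  induction ks generalizing s with
  | nil => simpa [clearAll] using triple_skip
  | cons k ks ih =>
    have h := (triple_clear k s).seq (ih (Function.update s k []) fun k' => by
      by_cases hk : k' = k
      · subst hk; simp
      · simpa [hk] using hL k')
    have hs : (fun k' => if k' ∈ ks then [] else Function.update s k [] k') =
        fun k' => if k' ∈ k :: ks then [] else s k' := by
      funext k'
      by_cases hk : k' = k
      · subst hk; simp
      · simp [hk]
    rw [hs] at h
    refine h.mono ?_
    have := hL k
    rw [List.length_cons, Nat.succ_mul]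
    omega

end Clear

variable {V A : Type} [DecidableEq V] [DecidableEq A]

/-- Assign the value of an expression, computed by `c`, to a variable. -/
def assign (v : V) (c : StackProg (Stk V A)) : StackProg (Stk V A) :=
  seq c (seq (forOnes (.env v) skip) (seq (forOnes .eval (push (.env v) true)) (pop .eval)))

theorem triple_assign {e : Expr V A} {c : StackProg (Stk V A)} {p : Polynomial ℕ}
    (h : ComputesExpr e c p) (v : V) {M : ℕ} {ρ : V → ℕ} {σ : A → ℕ → Bool} {E C O : List Bool}
    (hρ : ∀ v, ρ v ≤ M) :
    Triple (Holds ρ σ E C [] [] O) (assign v c) (p.eval M * 4 + M * 3 + 3)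
      (Holds (Function.update ρ v (e.val ρ σ)) σ E C [] [] O) := by
  obtain ⟨hv, ht⟩ := h M ρ σ E C O hρ
  refine (ht.seq ((triple_clear_env v).seq ((triple_eval_env v _).seq
    (triple_pop_eval false)))).mono ?_
  have := hρ v
  omega

/-- Assign a power of a variable, with a variable exponent, to a variable; `c` computes the product
of the variables `w` and `b`. -/
def assignPow (w k : V) (c : StackProg (Stk V A)) : StackProg (Stk V A) :=
  seq (push (.env w) true) (seq (pushVar k) (seq (forOnes .eval (assign w c)) (pop .eval)))

/-- The variable starts at zero, and one push makes it the zeroth power; then it is multiplied k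
times. The bound on all intermediate powers is needed because the cost of a multiplication depends
on its operands. -/
theorem triple_assignPow {w b k : V} {c : StackProg (Stk V A)} {p : Polynomial ℕ}
    (h : ComputesExpr (.mul (.var w) (.var b)) c p) (hb : b ≠ w) (hk : k ≠ w)
    {M : ℕ} {ρ : V → ℕ} {σ : A → ℕ → Bool} {E C O : List Bool} (hw : ρ w = 0)
    (hρ : ∀ v, ρ v ≤ M) (hM : ∀ i ≤ ρ k, ρ b ^ i ≤ M) :
    Triple (Holds ρ σ E C [] [] O) (assignPow w k c)
      (M * 7 + 6 + M * (p.eval M * 4 + M * 3 + 5))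
      (Holds (Function.update ρ w (ρ b ^ ρ k)) σ E C [] [] O) := by
  have h₁ := triple_push_env (ρ := ρ) (σ := σ) (E := E) (C := C) (T := []) (U := []) (O := O)
    w (n := 0)
  rw [← hw, Function.update_eq_self, hw] at h₁
  have h₂ := triple_pushVar (ρ := Function.update ρ w (0 + 1)) (σ := σ) (E := E) (C := C) (O := O) k
  rw [Function.update_of_ne hk] at h₂
  have h₃ := triple_forOnes_eval (n := ρ k) (B := p.eval M * 4 + M * 3 + 3) (c := assign w c) E
    (fun i => Function.update ρ w (ρ b ^ i)) (fun _ => σ) (fun _ => C) (fun _ => [])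
    (fun _ => []) (fun _ => O) fun i hi => by
      have := triple_assign h w (M := M) (ρ := Function.update ρ w (ρ b ^ i)) (σ := σ)
        (E := ones (ρ k - (i + 1)) ++ false :: E) (C := C) (O := O)
        (update_le hρ (hM i hi.le) w)
      rw [Function.update_idem] at this
      simpa [Expr.val, hb, pow_succ] using this
  refine (h₁.seq (h₂.seq (h₃.seq (triple_pop_eval false)))).mono ?_
  have h4 := hρ k
  have h5 := Nat.mul_le_mul_right (p.eval M * 4 + M * 3 + 5) h4
  rw [show p.eval M * 4 + M * 3 + 3 + 2 = p.eval M * 4 + M * 3 + 5 by omega]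
  omega

/-! #### Reading unary numbers from the input -/

/-- Skip a unary number on stack `k`. -/
def skipUnary (k : Stk V A) : StackProg (Stk V A) := seq (forOnes k skip) (pop k)

/-- Read a unary number from stack `k` into a variable. -/
def readUnary (k : Stk V A) (v : V) : StackProg (Stk V A) :=
  seq (forOnes k (push (.env v) true)) (pop k)

theorem triple_skipUnary (k : Stk V A) (m : ℕ) (l : List Bool) (s : Stk V A → List Bool) :
    Triple (fun s' => s' = Function.update s k (unaryBits m ++ l)) (skipUnary k) (m * 3 + 2)
      (fun s' => s' = Function.update s k l) := by
  have h := triple_while (k := k) (p := isOne) (c := seq (pop k) skip) (B := 2)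
    (fun i s' => s' = Function.update s k (unaryBits (m - i) ++ l)) m
    (fun i hi s' hs' => by
      rw [hs', Function.update_self, unaryBits, List.append_assoc]
      exact isOne_head_ones hi _)
    (fun s' hs' => by simp [hs', unaryBits, isOne])
    (fun i hi => Triple.seq (B₁ := 1) (B₂ := 1) (triple_pop fun s' hs' => by
      have : unaryBits (m - i) = true :: unaryBits (m - (i + 1)) := by
        rw [unaryBits, ← ones, ones_sub hi]; rfl
      rw [hs', this]; simp) triple_skip)
  refine Triple.mono (h.seq (B₂ := 1) (triple_pop fun s' hs' => ?_)) (by omega)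
  rw [hs']
  simp [unaryBits]

theorem triple_readUnary (k : Stk V A) (v : V) (hk : k ≠ .env v) (m : ℕ) (l : List Bool)
    (s : Stk V A → List Bool) (hs : s (.env v) = []) :
    Triple (fun s' => s' = Function.update s k (unaryBits m ++ l)) (readUnary k v) (m * 3 + 2)
      (fun s' => s' = Function.update (Function.update s (.env v) (ones m)) k l) := by
  have h := triple_while (k := k) (p := isOne) (c := seq (pop k) (push (.env v) true)) (B := 2)
    (fun i s' => s' = Function.update (Function.update s (.env v) (ones i)) k
      (unaryBits (m - i) ++ l)) m
    (fun i hi s' hs' => by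
      rw [hs', Function.update_self, unaryBits, List.append_assoc]
      exact isOne_head_ones hi _)
    (fun s' hs' => by simp [hs', unaryBits, isOne])
    (fun i hi => Triple.seq (B₁ := 1) (B₂ := 1)
      (Q := fun s' => s' = Function.update (Function.update s (.env v) (ones i)) k
        (unaryBits (m - (i + 1)) ++ l)) (triple_pop fun s' hs' => by
      have : unaryBits (m - i) = true :: unaryBits (m - (i + 1)) := by
        rw [unaryBits, ← ones, ones_sub hi]; rfl
      rw [hs', this]; simp) (triple_push fun s' hs' => by
      rw [hs', Function.update_of_ne hk.symm, Function.update_self, Function.update_comm hk.symm,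
        Function.update_idem]; exact Function.update_comm hk _ _ _))
  have hs0 : Function.update s (.env v) (ones 0) = s := by
    rw [show ones 0 = s (.env v) from hs.symm, Function.update_eq_self]
  simp only [hs0, Nat.sub_zero] at h
  refine Triple.mono (h.seq (B₂ := 1) (triple_pop fun s' hs' => ?_)) (by omega)
  rw [hs']
  simp [unaryBits]

/-- For an expression `e` and a command `d`, there is a machine that reads three unary numbers
`m`, `a`, `n` and a bit string `x`, computes the value `k` of `e` and `n ^ k`, and runs `d`. Its
running time is polynomial in all these numbers. -/
theorem exists_machine [Fintype V] [Fintype A] (e : Expr V A) (d : Cmd V A) (va vn vk vw : V)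
    (inp : A) (hd : [va, vn, vk, vw].Nodup) :
    ∃ (M : Turing.TM2ComputableAux Bool Bool) (p : Polynomial ℕ), ∀ (m a n : ℕ) (x : List Bool)
      (ρ : V → ℕ) (σ : A → ℕ → Bool) (k t : ℕ),
      ρ = Function.update (Function.update (fun _ => 0) va a) vn n →
      σ = Function.update (fun _ _ => false) inp (fun i => x.getD i false) →
      k = e.val ρ σ →
      p.eval (m + a + n + k + n ^ k + 1 + x.length) ≤ t →
      Nonempty (Turing.TM2OutputsInTime M.tm
        ((unaryBits m ++ unaryBits a ++ unaryBits n ++ x).map M.inputAlphabet.symm)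
        (some ((d.run (Function.update (Function.update ρ vk k) vw (n ^ k))
          (σ, [])).2.map M.outputAlphabet.symm)) t) := by
  obtain ⟨ce, pe, he⟩ := exists_computesExpr e
  obtain ⟨cm, pm, hm⟩ := exists_computesExpr (V := V) (A := A) (.mul (.var vw) (.var vn))
  obtain ⟨cd, pd, hdr⟩ := exists_runsCmd d
  simp only [List.nodup_cons, List.mem_cons, List.not_mem_nil, or_false, not_or, not_false_eq_true,
    List.nodup_nil, and_true] at hd
  obtain ⟨⟨h12, h13, h14⟩, ⟨h23, h24⟩, h34⟩ := hd
  let main : StackProg (Stk V A) :=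
    seq (seq (skipUnary (.arr inp)) (seq (readUnary (.arr inp) va) (readUnary (.arr inp) vn)))
      (seq (assign vk ce) (seq (assignPow vw vk cm) cd))
  let q : Polynomial ℕ := (Polynomial.X * 9 + 6) + ((pe * 4 + Polynomial.X * 3 + 3) +
    ((Polynomial.X * 7 + 6 + Polynomial.X * (pm * 4 + Polynomial.X * 3 + 5)) + pd))
  -- All stacks but the output must be empty at the end.
  let ks : List (Stk V A) := Finset.univ.toList.filter fun k => k ≠ .out
  -- The time of the main program, then for each stack the time to empty it: its length is at most
  -- that of the input plus the number of steps made. The last summand is for halting.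
  let p : Polynomial ℕ :=
    q + (Polynomial.C ks.length * ((Polynomial.X * 3 + 3 + q) * 2 + 1) + 1) + 1
  refine ⟨machine (seq main (clearAll ks)) (.arr inp) .out, p, ?_⟩
  intro m a n x ρ σ k t hρ hσ hk ht
  generalize hM : m + a + n + k + n ^ k + 1 + x.length = M at ht
  have hρ0 : ∀ v, ρ v ≤ M := by
    intro v
    rw [hρ]
    exact update_le (update_le (fun _ => Nat.zero_le _) (by omega) _) (by omega) _ _
  have hM1 : 1 ≤ M := hM ▸ Nat.le_add_right_of_le (Nat.le_add_left 1 _)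
  have hpow : ∀ i ≤ k, n ^ i ≤ M := by
    intro i hi
    -- Powers of zero are not monotone in the exponent; the summand 1 in M takes care of the zeroth
    -- power.
    rcases Nat.eq_zero_or_pos n with h0 | h0
    · subst h0
      rcases Nat.eq_zero_or_pos i with h1 | h1
      · subst h1; simpa using hM1
      · rw [zero_pow (by omega)]; exact Nat.zero_le _
    · have := Nat.pow_le_pow_right h0 hi
      omega
  let s₀ : Stk V A → List Bool :=
    Function.update (fun _ => []) (.arr inp) (unaryBits m ++ unaryBits a ++ unaryBits n ++ x)
  let s₁ : Stk V A → List Bool := Function.update (Function.update (Function.update (fun _ => [])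
    (.env va) (ones a)) (.env vn) (ones n)) (.arr inp) x
  have hparse : Triple (fun s => s = s₀)
      (seq (skipUnary (.arr inp)) (seq (readUnary (.arr inp) va) (readUnary (.arr inp) vn)))
      ((m * 3 + 2) + ((a * 3 + 2) + (n * 3 + 2))) (fun s => s = s₁) := by
    refine Triple.seq (Q := fun s => s = Function.update (fun _ => []) (.arr inp)
      (unaryBits a ++ (unaryBits n ++ x))) ?_ (Triple.seq (Q := fun s => s =
        Function.update (Function.update (fun _ => []) (.env va) (ones a)) (.arr inp)
          (unaryBits n ++ x)) ?_ ?_)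
    · have := triple_skipUnary (.arr inp) m (unaryBits a ++ (unaryBits n ++ x))
        (fun _ : Stk V A => [])
      simpa only [s₀, List.append_assoc] using this
    · exact triple_readUnary (.arr inp) va (by simp) a _ _ rfl
    · refine triple_readUnary (.arr inp) vn (by simp) n _ _ ?_
      rw [Function.update_of_ne (by simpa using Ne.symm h12)]
  have hs₁ : Holds ρ σ [] [] [] [] [] s₁ := by
    constructor <;> try simp [s₁]
    · intro v
      by_cases hv : v = vn
      · subst hv; simp [hρ]
      · by_cases hv' : v = va
        · subst hv'; simp [hρ, hv]
        · simp [hρ, hv, hv']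
    · intro a' i
      by_cases ha : a' = inp
      · subst ha; simp [hσ]
      · simp [hσ, ha]
  have hparse' : Triple (fun s => s = s₀)
      (seq (skipUnary (.arr inp)) (seq (readUnary (.arr inp) va) (readUnary (.arr inp) vn)))
      ((m * 3 + 2) + ((a * 3 + 2) + (n * 3 + 2))) (Holds ρ σ [] [] [] [] []) := by
    intro s hs
    obtain ⟨s', t, h1, h2, h3⟩ := hparse s hs
    exact ⟨s', t, h1, h2, h3 ▸ hs₁⟩
  have hassign := triple_assign (E := []) (C := []) (O := []) (σ := σ) he vk hρ0
  rw [← hk] at hassign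
  have hρ1 : ∀ v, Function.update ρ vk k v ≤ M := update_le hρ0 (by omega) vk
  have hρk : Function.update ρ vk k vk = k := Function.update_self ..
  have hρn : Function.update ρ vk k vn = n := by
    rw [Function.update_of_ne h23, hρ, Function.update_self]
  have hρw : Function.update ρ vk k vw = 0 := by
    rw [Function.update_of_ne (Ne.symm h34), hρ, Function.update_of_ne (Ne.symm h24),
      Function.update_of_ne (Ne.symm h14)]
  have hassignPow := triple_assignPow (E := []) (C := []) (O := []) (σ := σ) hm h24 h34 hρw hρ1
    (by rw [hρk, hρn]; exact hpow)
  rw [hρk, hρn] at hassignPow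
  have hrun := hdr M (Function.update (Function.update ρ vk k) vw (n ^ k)) σ [] [] []
    (update_le hρ1 (hpow k le_rfl) vw)
  obtain ⟨s₂, t₂, hex, ht₂, hs₂⟩ :=
    (hparse'.seq (hassign.seq (hassignPow.seq hrun))) s₀ rfl
  have hq : t₂ ≤ q.eval M := by
    refine ht₂.trans ?_
    simp only [q, Polynomial.eval_add, Polynomial.eval_mul, Polynomial.eval_X,
      Polynomial.eval_ofNat]
    omega
  have hlen : ∀ k, (s₂ k).length ≤ M * 3 + 3 + q.eval M := by
    intro k'
    have h1 := hex.length_le k'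
    have h2 : (s₀ k').length ≤ M * 3 + 3 := by
      by_cases hk' : k' = .arr inp
      · subst hk'
        simp [s₀, unaryBits]
        omega
      · simp [s₀, hk']
    omega
  obtain ⟨s₃, t₃, hex', ht₃, hs₃⟩ := triple_clearAll ks _ s₂ hlen s₂ rfl
  refine machine_outputs (t := t₂ + t₃) ?_ ?_
  · have : s₃ = Function.update (fun _ => []) Stk.out
        (d.run (Function.update (Function.update ρ vk k) vw (n ^ k)) (σ, [])).2 := by
      rw [hs₃]
      funext k'
      by_cases hk' : k' = .out
      · subst hk'
        simp [ks, hs₂.out]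
      · simp [ks, hk']
    rw [← this]
    exact hex.seq hex'
  · refine le_trans ?_ ht
    simp only [p, Polynomial.eval_add, Polynomial.eval_mul, Polynomial.eval_X,
      Polynomial.eval_ofNat, Polynomial.eval_one, Polynomial.eval_C]
    omega

end StackProg

/-! ### Connected vertex sets -/

section Cut

variable {α : Type*} [DecidableEq α] {H : SimpleGraph α}

/-- A nonempty finite set of vertices such that an edge leaves every proper nonempty subset: the
induced subgraph is connected. -/
def CutConnected (H : SimpleGraph α) (W : Finset α) : Prop :=
  W.Nonempty ∧ ∀ R ⊆ W, R.Nonempty → R ≠ W → ∃ u ∈ R, ∃ v ∈ W, v ∉ R ∧ H.Adj u v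

/-- The closed neighbourhood of `d` within `S`, which is a star with centre `d`. -/
def InStar (H : SimpleGraph α) (S : Finset α) (d x : α) : Prop :=
  x = d ∨ (x ∈ S ∧ H.Adj d x)

/-- If R cuts A or B properly, an edge within that set leaves R. Otherwise R contains all or nothing
of each of A and B, hence exactly one of a and b, and the edge between a and b leaves R; the case a
= b cannot occur then. -/
theorem CutConnected.union {A B : Finset α} (hA : CutConnected H A) (hB : CutConnected H B)
    {a b : α} (ha : a ∈ A) (hb : b ∈ B) (hab : a = b ∨ H.Adj a b) : CutConnected H (A ∪ B) := by
  refine ⟨⟨a, Finset.mem_union_left _ ha⟩, fun R hR hne hR' => ?_⟩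
  by_cases h1 : (R ∩ A).Nonempty ∧ R ∩ A ≠ A
  · obtain ⟨u, hu, v, hv, hvR, huv⟩ := hA.2 _ Finset.inter_subset_right h1.1 h1.2
    simp only [Finset.mem_inter] at hu hvR
    exact ⟨u, hu.1, v, Finset.mem_union_left _ hv, fun h => hvR ⟨h, hv⟩, huv⟩
  by_cases h2 : (R ∩ B).Nonempty ∧ R ∩ B ≠ B
  · obtain ⟨u, hu, v, hv, hvR, huv⟩ := hB.2 _ Finset.inter_subset_right h2.1 h2.2
    simp only [Finset.mem_inter] at hu hvR
    exact ⟨u, hu.1, v, Finset.mem_union_right _ hv, fun h => hvR ⟨h, hv⟩, huv⟩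
  have key : ∀ C : Finset α, ¬((R ∩ C).Nonempty ∧ R ∩ C ≠ C) → ∀ x ∈ C, ∀ y ∈ C, x ∈ R → y ∈ R := by
    intro C hC x hx y hy hxR
    by_contra hyR
    refine hC ⟨⟨x, Finset.mem_inter.2 ⟨hxR, hx⟩⟩, fun h => hyR ?_⟩
    rw [← h] at hy
    exact (Finset.mem_inter.1 hy).1
  have hnot : ¬(a ∈ R ∧ b ∈ R) := by
    rintro ⟨haR, hbR⟩
    refine hR' (Finset.Subset.antisymm hR fun x hx => ?_)
    rcases Finset.mem_union.1 hx with hx | hx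
    · exact key A h1 a ha x hx haR
    · exact key B h2 b hb x hx hbR
  have hor : a ∈ R ∨ b ∈ R := by
    obtain ⟨x, hx⟩ := hne
    rcases Finset.mem_union.1 (hR hx) with h | h
    · exact Or.inl (key A h1 x h a ha hx)
    · exact Or.inr (key B h2 x h b hb hx)
  have hadj : H.Adj a b := by
    rcases hab with h | h
    · subst h; exact absurd (by tauto) hnot
    · exact h
  rcases hor with h | h
  · exact ⟨a, h, b, Finset.mem_union_right _ hb, fun hb' => hnot ⟨h, hb'⟩, hadj⟩
  · exact ⟨b, h, a, Finset.mem_union_left _ ha, fun ha' => hnot ⟨ha', h⟩, hadj.symm⟩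

omit [DecidableEq α] in
theorem cutConnected_singleton (v : α) : CutConnected H {v} := by
  refine ⟨⟨v, Finset.mem_singleton_self v⟩, fun R hR hne hR' => absurd ?_ hR'⟩
  exact (Finset.subset_singleton_iff.1 hR).resolve_left hne.ne_empty

/-- A connected set that meets all stars with centres in `D` stays connected when these are
added. -/
theorem CutConnected.union_stars {A S D : Finset α} (hA : CutConnected H A)
    (hD : ∀ d ∈ D, ∃ y ∈ A, InStar H S d y) (hS : ∀ x ∈ S, ∃ d ∈ D, InStar H S d x) :
    CutConnected H (S ∪ D ∪ A) := by
  classical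
  -- The star of d is connected through its centre. The stars are added one at a time, each sharing
  -- a vertex with A.
  let C : α → Finset α := fun d => insert d (S.filter fun x => H.Adj d x)
  have hC : ∀ d, CutConnected H (C d) := by
    refine fun d => ⟨⟨d, Finset.mem_insert_self _ _⟩, fun R hR hne hR' => ?_⟩
    by_cases hd : d ∈ R
    · obtain ⟨x, hx, hxR⟩ := Finset.exists_of_ssubset (hR.ssubset_of_ne hR')
      refine ⟨d, hd, x, hx, hxR, ?_⟩
      rcases Finset.mem_insert.1 hx with rfl | h
      · exact absurd hd hxR
      · exact (Finset.mem_filter.1 h).2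
    · obtain ⟨x, hx⟩ := hne
      refine ⟨x, hx, d, Finset.mem_insert_self _ _, hd, ?_⟩
      rcases Finset.mem_insert.1 (hR hx) with rfl | h
      · exact absurd hx hd
      · exact (Finset.mem_filter.1 h).2.symm
  have hmem : ∀ d x, x ∈ C d ↔ InStar H S d x := by
    intro d x
    simp [C, InStar]
  have h : ∀ D' ⊆ D, CutConnected H (A ∪ D'.biUnion C) := by
    intro D'
    induction D' using Finset.induction_on with
    | empty => intro _; simpa using hA
    | insert d D' _ ih =>
      intro hD'
      rw [Finset.biUnion_insert, Finset.union_comm (C d), ← Finset.union_assoc]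
      obtain ⟨y, hy, hy'⟩ := hD d (hD' (Finset.mem_insert_self _ _))
      exact (ih fun x hx => hD' (Finset.mem_insert_of_mem hx)).union (hC d)
        (Finset.mem_union_left _ hy) ((hmem d y).2 hy') (Or.inl rfl)
  convert h D subset_rfl using 1
  ext x
  simp only [Finset.mem_union, Finset.mem_biUnion, hmem]
  constructor
  · rintro ((hx | hx) | hx)
    · exact Or.inr (hS x hx)
    · exact Or.inr ⟨x, hx, Or.inl rfl⟩
    · exact Or.inl hx
  · rintro (hx | ⟨d, hd, rfl | hx⟩)
    · exact Or.inr hx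
    · exact Or.inl (Or.inr hd)
    · exact Or.inl (Or.inl hx.1)

/-! #### Decomposition of connected sets -/

/-- The vertex sets with root `v` that are built from single vertices by joining two disjoint
sets with adjacent roots. -/
inductive Build (H : SimpleGraph α) : Finset α → α → Prop
  | single (v) : Build H {v} v
  | join {A B v u} : Build H A v → Build H B u → H.Adj v u → Disjoint A B → Build H (A ∪ B) v

theorem Build.mem {A : Finset α} {v : α} (h : Build H A v) : v ∈ A := by
  induction h with
  | single v => exact Finset.mem_singleton_self v
  | join _ _ _ _ ih _ => exact Finset.mem_union_left _ ih

/-- The new vertex is joined as a leaf to y where y entered the construction as a single vertex; the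
roots above are unchanged. -/
theorem Build.insert {A : Finset α} {v : α} (h : Build H A v) {x y : α} (hx : x ∉ A) (hy : y ∈ A)
    (hxy : H.Adj y x) : Build H (insert x A) v := by
  induction h with
  | single v =>
    obtain rfl := Finset.mem_singleton.1 hy
    have := Build.join (Build.single y) (Build.single x) hxy (by simpa using hxy.ne)
    rwa [Finset.union_comm, ← Finset.insert_eq] at this
  | @join A B v u hA hB hvu hd ihA ihB =>
    rw [Finset.mem_union, not_or] at hx
    rcases Finset.mem_union.1 hy with hy | hy
    · rw [← Finset.insert_union]
      exact .join (ihA hx.1 hy) hB hvu (Finset.disjoint_insert_left.2 ⟨hx.2, hd⟩)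
    · rw [← Finset.union_insert]
      exact .join hA (ihB hx.2 hy) hvu (Finset.disjoint_insert_right.2 ⟨hx.1, hd⟩)

/-- Starting from v, the cut property always supplies an adjacent new vertex, so built sets of every
size up to |A| exist within A. -/
theorem CutConnected.build {A : Finset α} (hA : CutConnected H A) {v : α} (hv : v ∈ A) :
    Build H A v := by
  have h : ∀ k < A.card, ∃ R ⊆ A, Build H R v ∧ R.card = k + 1 := by
    intro k
    induction k with
    | zero => exact fun _ => ⟨{v}, by simpa, .single v, rfl⟩
    | succ k ih =>
      intro hk
      obtain ⟨R, hR, hb, hc⟩ := ih (by omega)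
      obtain ⟨u, hu, x, hx, hxR, hux⟩ := hA.2 R hR ⟨v, hb.mem⟩ (by rintro rfl; omega)
      exact ⟨insert x R, Finset.insert_subset hx hR, hb.insert hxR hu hux, by
        rw [Finset.card_insert_of_notMem hxR, hc]⟩
  have hpos := Finset.card_pos.2 hA.1
  obtain ⟨R, hR, hb, hc⟩ := h (A.card - 1) (by omega)
  rwa [← Finset.eq_of_subset_of_card_le hR (by omega)]

/-! #### Optimality of the interval recursion -/

/-- `Achieves H T w r i j v b`: the interval recursion with base cases `T` and weights `w` reaches,
after `r` rounds, a weight of at most `b` for the interval `[i, j)` at the root `v`. -/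
def Achieves (H : SimpleGraph α) (T : ℕ → α → Prop) (w : α → ℕ) :
    ℕ → ℕ → ℕ → α → ℕ → Prop
  | 0, _, _, _, _ => False
  | r + 1, i, j, v, b => Achieves H T w r i j v b ∨
      ((∀ m, i ≤ m → m < j → T m v) ∧ w v ≤ b) ∨
      ∃ l u b₁ b₂, i ≤ l ∧ l ≤ j ∧ H.Adj v u ∧ Achieves H T w r i l v b₁ ∧
        Achieves H T w r l j u b₂ ∧ b₁ + b₂ ≤ b

omit [DecidableEq α] in
theorem Achieves.mono {T : ℕ → α → Prop} {w : α → ℕ} {r r' i j b : ℕ} {v : α}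
    (h : Achieves H T w r i j v b) (hr : r ≤ r') : Achieves H T w r' i j v b := by
  induction hr with
  | refl => exact h
  | step _ ih => exact Or.inl ih

/-- In a set built with root `v`, the stars that it meets can be ordered such that the interval
recursion reaches the weight of the set. -/
theorem Build.achieves {A : Finset α} {v : α} (h : Build H A v) (S : Finset α) (w : α → ℕ) :
    ∀ X : List α, (∀ x ∈ X, ∃ y ∈ A, InStar H S x y) → ∃ l : List α, l.Perm X ∧
      ∀ (d : ℕ → α) (i : ℕ), (∀ m (hm : m < l.length), d (i + m) = l[m]) →
        Achieves H (fun m => InStar H S (d m)) w A.card i (i + l.length) v (∑ x ∈ A, w x) := by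
  induction h with
  | single v =>
    -- A single vertex that meets all stars lies in all of them: the base case of the recursion, in
    -- any order of the stars.
    refine fun X hX => ⟨X, .refl X, fun d i hd => Or.inr (Or.inl ⟨fun m hm hm' => ?_, by simp⟩)⟩
    obtain ⟨y, hy, hy'⟩ := hX _ (List.getElem_mem (show m - i < X.length by omega))
    rw [← hd, Finset.mem_singleton.1 hy, Nat.add_sub_cancel' hm] at hy'
    exact hy'
  | @join A B v u hA hB hvu hd ihA ihB =>
    intro X hX
    classical
    -- Stars that meet A come first, the remaining ones meet B and come last. This choice of the
    -- order turns the two sets of stars into adjacent intervals.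
    obtain ⟨l₁, hl₁, h₁⟩ := ihA (X.filter fun x => ∃ y ∈ A, InStar H S x y) fun x hx => by
      simpa using (List.mem_filter.1 hx).2
    obtain ⟨l₂, hl₂, h₂⟩ := ihB (X.filter fun x => !decide (∃ y ∈ A, InStar H S x y)) fun x hx => by
      obtain ⟨hx, hx'⟩ := List.mem_filter.1 hx
      obtain ⟨y, hy, hy'⟩ := hX x hx
      rcases Finset.mem_union.1 hy with hy | hy
      · simp only [Bool.not_eq_true', decide_eq_false_iff_not] at hx'
        exact absurd ⟨y, hy, hy'⟩ hx'
      · exact ⟨y, hy, hy'⟩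
    refine ⟨l₁ ++ l₂, (hl₁.append hl₂).trans (List.filter_append_perm _ X), fun d i hdl => ?_⟩
    have hA0 := Finset.card_pos.2 ⟨v, hA.mem⟩
    have hB0 := Finset.card_pos.2 ⟨u, hB.mem⟩
    have h₁' := h₁ d i fun m hm => by
      rw [hdl m (by rw [List.length_append]; omega), List.getElem_append_left hm]
    have h₂' := h₂ d (i + l₁.length) fun m hm => by
      rw [Nat.add_assoc, hdl (l₁.length + m) (by rw [List.length_append]; omega),
        List.getElem_append_right (by omega)]
      simp
    -- Both parts are nonempty, so each has at most |A| + |B| - 1 vertices, and one round remains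
    -- for the join.
    have : Achieves H (fun m => InStar H S (d m)) w (A.card + B.card - 1 + 1) i
        (i + (l₁ ++ l₂).length) v (∑ x ∈ A ∪ B, w x) := by
      refine Or.inr (Or.inr ⟨i + l₁.length, u, _, _, by omega, by rw [List.length_append]; omega,
        hvu, h₁'.mono (by omega), ?_, (Finset.sum_union hd).ge⟩)
      rw [List.length_append, ← Nat.add_assoc]
      exact h₂'.mono (by omega)
    rw [Finset.card_union_of_disjoint hd]
    rwa [Nat.sub_add_cancel (by omega)] at this

end Cut

/-! #### Greedy domination -/

section Greedy

variable {α : Type*} [DecidableEq α] {H : SimpleGraph α} {S U : Finset α} {ψ : ℝ}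

omit [DecidableEq α] in
open scoped Classical in
/-- Some vertex of `U` is adjacent to a `1 / ψ` fraction of `X`. -/
theorem exists_adj_fraction (hU : U.Nonempty) (X : Finset α)
    (hX : ∀ t ∈ X, (U.card : ℝ) / ψ ≤ ((U.filter fun u => H.Adj t u).card : ℝ)) :
    ∃ d ∈ U, (X.card : ℝ) / ψ ≤ ((X.filter fun t => H.Adj d t).card : ℝ) := by
  have hU0 : (0 : ℝ) < U.card := by exact_mod_cast Finset.card_pos.2 hU
  refine Finset.exists_le_of_sum_le hU ?_
  -- Double counting of the edges between U and X: the average over U of the number of neighbours in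
  -- X is at least |X| / ψ.
  have hcount : (∑ d ∈ U, ((X.filter fun t => H.Adj d t).card : ℝ)) =
      ∑ t ∈ X, ((U.filter fun u => H.Adj t u).card : ℝ) := by
    have := Finset.sum_card_bipartiteAbove_eq_sum_card_bipartiteBelow (s := U) (t := X)
      (fun d t => H.Adj d t)
    simp only [Finset.bipartiteAbove, Finset.bipartiteBelow] at this
    simp only [H.adj_comm] at this ⊢
    exact_mod_cast this
  rw [hcount]
  calc ∑ _d ∈ U, (X.card : ℝ) / ψ = ∑ _t ∈ X, (U.card : ℝ) / ψ := by
        simp only [Finset.sum_const, nsmul_eq_mul]; ring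
    _ ≤ _ := Finset.sum_le_sum hX

/-- If all vertices of `S` are adjacent to a `1 / ψ` fraction of `U`, then `ψ log |S| + 1` vertices
of `U` dominate `S`. -/
theorem exists_dominating (hψ : 1 ≤ ψ) (hU : U.Nonempty) (hS : S.Nonempty)
    (h : ∀ t ∈ S, (U.card : ℝ) / ψ ≤ ({u | u ∈ U ∧ H.Adj t u} : Set α).ncard) :
    ∃ D ⊆ U, (D.card : ℝ) ≤ ψ * Real.log S.card + 1 ∧ (∀ d ∈ D, ∃ t ∈ S, H.Adj d t) ∧
      ∀ t ∈ S, ∃ d ∈ D, H.Adj d t := by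
  classical
  have hψ0 : 0 < ψ := by linarith
  have hq : 0 ≤ 1 - 1 / ψ := by
    rw [sub_nonneg, div_le_one hψ0]; exact hψ
  have h' : ∀ t ∈ S, (U.card : ℝ) / ψ ≤ ((U.filter fun u => H.Adj t u).card : ℝ) := by
    intro t ht
    refine (h t ht).trans_eq ?_
    rw [← Set.ncard_coe_finset]
    simp
  -- After j greedy choices, at most |S| (1 - 1/ψ)^j terminals are not dominated.
  have hj : ∀ j : ℕ, ∃ D ⊆ U, D.card ≤ j ∧ (∀ d ∈ D, ∃ t ∈ S, H.Adj d t) ∧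
      ((S.filter fun t => ∀ d ∈ D, ¬H.Adj d t).card : ℝ) ≤ S.card * (1 - 1 / ψ) ^ j := by
    intro j
    induction j with
    | zero => exact ⟨∅, by simp⟩
    | succ j ih =>
      obtain ⟨D, hDU, hDj, hDS, hD⟩ := ih
      generalize hX : S.filter (fun t => ∀ d ∈ D, ¬H.Adj d t) = X at hD
      have hXS : ∀ t ∈ X, t ∈ S := fun t ht => by
        rw [← hX] at ht; exact (Finset.mem_filter.1 ht).1
      rcases X.eq_empty_or_nonempty with hX0 | hX0
      · refine ⟨D, hDU, by omega, hDS, ?_⟩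
        rw [hX, hX0]
        simp only [Finset.card_empty, Nat.cast_zero]
        positivity
      obtain ⟨d, hd, hdX⟩ := exists_adj_fraction hU X fun t ht => h' t (hXS t ht)
      have hX1 : (0 : ℝ) < X.card := by exact_mod_cast Finset.card_pos.2 hX0
      -- The chosen vertex has a neighbour in X, hence in S. So every vertex of D is adjacent to a
      -- terminal, and its star will meet any Steiner tree.
      have hpos : 0 < (X.filter fun t => H.Adj d t).card := by
        have : (0 : ℝ) < ((X.filter fun t => H.Adj d t).card : ℝ) := (by positivity : (0:ℝ) <
          (X.card : ℝ) / ψ).trans_le hdX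
        exact_mod_cast this
      obtain ⟨t, ht⟩ := Finset.card_pos.1 hpos
      refine ⟨insert d D, Finset.insert_subset hd hDU, (Finset.card_insert_le _ _).trans (by omega),
        ?_, ?_⟩
      · intro d' hd'
        rcases Finset.mem_insert.1 hd' with rfl | hd'
        · exact ⟨t, hXS t (Finset.mem_filter.1 ht).1, (Finset.mem_filter.1 ht).2⟩
        · exact hDS d' hd'
      · have hfilter : S.filter (fun t => ∀ d' ∈ insert d D, ¬H.Adj d' t) =
            X.filter fun t => ¬H.Adj d t := by
          rw [← hX, Finset.filter_filter]
          refine Finset.filter_congr fun t _ => ?_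
          simp only [Finset.forall_mem_insert]
          tauto
        have hsplit : (((X.filter fun t => H.Adj d t).card : ℝ)) +
            ((X.filter fun t => ¬H.Adj d t).card : ℝ) = X.card := by
          exact_mod_cast Finset.card_filter_add_card_filter_not (s := X) (fun t => H.Adj d t)
        rw [hfilter, pow_succ]
        calc ((X.filter fun t => ¬H.Adj d t).card : ℝ) ≤ X.card * (1 - 1 / ψ) := by
              rw [mul_sub, mul_one, mul_one_div]; linarith
          _ ≤ S.card * (1 - 1 / ψ) ^ j * (1 - 1 / ψ) := mul_le_mul_of_nonneg_right hD hq
          _ = _ := by ring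
  have hs1 : (1 : ℝ) ≤ S.card := by exact_mod_cast Finset.card_pos.2 hS
  have hlog : 0 ≤ ψ * Real.log S.card := mul_nonneg hψ0.le (Real.log_nonneg hs1)
  obtain ⟨D, hDU, hDj, hDS, hD⟩ := hj (⌊ψ * Real.log S.card⌋₊ + 1)
  refine ⟨D, hDU, ?_, hDS, ?_⟩
  · calc (D.card : ℝ) ≤ ((⌊ψ * Real.log S.card⌋₊ + 1 : ℕ) : ℝ) := by exact_mod_cast hDj
      _ ≤ _ := by push_cast; linarith [Nat.floor_le hlog]
  · have hlt : (S.card : ℝ) * (1 - 1 / ψ) ^ (⌊ψ * Real.log S.card⌋₊ + 1) < 1 := by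
      have h1 : 1 - 1 / ψ ≤ Real.exp (-(1 / ψ)) := by
        linarith [Real.add_one_le_exp (-(1 / ψ))]
      have h2 : (1 - 1 / ψ) ^ (⌊ψ * Real.log S.card⌋₊ + 1) ≤
          Real.exp (-(1 / ψ) * (⌊ψ * Real.log S.card⌋₊ + 1 : ℕ)) := by
        rw [mul_comm (-(1 / ψ)), Real.exp_nat_mul]
        exact pow_le_pow_left₀ hq h1 _
      have h3 : -(1 / ψ) * ((⌊ψ * Real.log S.card⌋₊ + 1 : ℕ) : ℝ) < -Real.log S.card := by
        have := Nat.lt_floor_add_one (ψ * Real.log S.card)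
        have h4 : Real.log S.card < (1 / ψ) * ((⌊ψ * Real.log S.card⌋₊ + 1 : ℕ) : ℝ) := by
          rw [one_div, ← div_eq_inv_mul, lt_div_iff₀ hψ0, mul_comm]
          push_cast
          exact this
        linarith
      calc (S.card : ℝ) * (1 - 1 / ψ) ^ (⌊ψ * Real.log S.card⌋₊ + 1)
          ≤ S.card * Real.exp (-(1 / ψ) * (⌊ψ * Real.log S.card⌋₊ + 1 : ℕ)) := by gcongr
        _ < S.card * Real.exp (-Real.log S.card) := by gcongr
        _ = 1 := by
          rw [Real.exp_neg, Real.exp_log (by linarith), mul_inv_cancel₀ (by linarith)]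
    have hcard : (S.filter fun t => ∀ d ∈ D, ¬H.Adj d t).card = 0 := by
      have := hD.trans_lt hlt
      have : (S.filter fun t => ∀ d ∈ D, ¬H.Adj d t).card < 1 := by exact_mod_cast this
      omega
    intro t ht
    by_contra hcon
    push Not at hcon
    have : t ∈ S.filter fun t => ∀ d ∈ D, ¬H.Adj d t := Finset.mem_filter.2 ⟨ht, hcon⟩
    rw [Finset.card_eq_zero.1 hcard] at this
    exact Finset.notMem_empty t this

end Greedy

/-! ### Derived expressions and loops -/

section Loops

variable {α : Type*} {f : ℕ → α → α} {n : ℕ}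

theorem iterFor_induct (P : ℕ → α → Prop) {x : α} (h0 : P 0 x)
    (h : ∀ i < n, ∀ y, P i y → P (i + 1) (f i y)) : P n (iterFor f x n) := by
  have : ∀ m ≤ n, P m (iterFor f x m) := by
    intro m
    induction m with
    | zero => exact fun _ => h0
    | succ m ih => exact fun hm => h m (by omega) _ (ih (by omega))
  exact this n le_rfl

/-- A loop all of whose steps are in a preorder `R`. -/
theorem iterFor_rel {R : α → α → Prop} (hrefl : ∀ x, R x x)
    (htrans : ∀ x y z, R x y → R y z → R x z) {P : α → Prop} (hP : ∀ x y, R x y → P x → P y)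
    (hR : ∀ i < n, ∀ y, P y → R y (f i y)) {x : α} (hx : P x) : R x (iterFor f x n) :=
  iterFor_induct (fun _ y => R x y) (hrefl x) fun i hi y hy =>
    htrans _ _ _ hy (hR i hi y (hP _ _ hy hx))

/-- A loop whose `i`-th step establishes `Q i`, which no step destroys. -/
theorem iterFor_establish {R : α → α → Prop} {P : α → Prop} (hP : ∀ x y, R x y → P x → P y)
    (hR : ∀ i < n, ∀ y, P y → R y (f i y)) {x : α} (hx : P x) {Q : ℕ → α → Prop}
    (hQ : ∀ i < n, ∀ y, P y → Q i (f i y)) (hQR : ∀ i y z, R y z → Q i y → Q i z) :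
    ∀ i < n, Q i (iterFor f x n) := by
  refine (iterFor_induct (n := n) (fun m y => P y ∧ ∀ i < m, Q i y)
    ⟨hx, fun i hi => absurd hi (Nat.not_lt_zero i)⟩
    fun m hm y hy => ⟨hP _ _ (hR m hm y hy.1) hy.1, fun i hi => ?_⟩).2
  rcases Nat.lt_succ_iff_lt_or_eq.1 hi with h | rfl
  · exact hQR _ _ _ (hR m hm y hy.1) (hy.2 i h)
  · exact hQ i hm y hy.1

end Loops

namespace Expr

variable {V A : Type} [DecidableEq V] {ρ : V → ℕ} {σ : A → ℕ → Bool}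

/-- A truth value is true if it is nonzero. -/
def Holds (e : Expr V A) (ρ : V → ℕ) (σ : A → ℕ → Bool) : Prop := e.val ρ σ ≠ 0

/-- Negation. -/
def not (e : Expr V A) : Expr V A := .sub (.const 1) e

/-- Conjunction. -/
def and (e₁ e₂ : Expr V A) : Expr V A := .mul e₁ e₂

/-- Disjunction. -/
def or (e₁ e₂ : Expr V A) : Expr V A := .add e₁ e₂

/-- The comparison `<`. -/
def lt (e₁ e₂ : Expr V A) : Expr V A := .sub e₂ e₁

/-- The comparison `≤`. -/
def le (e₁ e₂ : Expr V A) : Expr V A := .sub (.add e₂ (.const 1)) e₁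

/-- Equality. -/
def eq (e₁ e₂ : Expr V A) : Expr V A := not (.add (.sub e₁ e₂) (.sub e₂ e₁))

/-- Bounded existential quantification. -/
def ex (v : V) (e₁ e₂ : Expr V A) : Expr V A := .sum v e₁ e₂

/-- Bounded universal quantification. -/
def all (v : V) (e₁ e₂ : Expr V A) : Expr V A := not (ex v e₁ (not e₂))

/-- The number of values of `v` below a bound that satisfy a condition. -/
def count (v : V) (e₁ e₂ : Expr V A) : Expr V A := .sum v e₁ (not (not e₂))

variable {a : A} {v : V} {e e₁ e₂ : Expr V A}

@[simp] theorem val_const {n : ℕ} : (const n : Expr V A).val ρ σ = n := rfl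
@[simp] theorem val_var : (var v : Expr V A).val ρ σ = ρ v := rfl
@[simp] theorem val_add : (add e₁ e₂).val ρ σ = e₁.val ρ σ + e₂.val ρ σ := rfl
@[simp] theorem val_sub : (sub e₁ e₂).val ρ σ = e₁.val ρ σ - e₂.val ρ σ := rfl
@[simp] theorem val_mul : (mul e₁ e₂).val ρ σ = e₁.val ρ σ * e₂.val ρ σ := rfl

@[simp] theorem holds_const_one : (const 1 : Expr V A).Holds ρ σ := one_ne_zero

@[simp] theorem holds_read : (read a e).Holds ρ σ ↔ σ a (e.val ρ σ) = true := by
  simp [Holds, val]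

@[simp] theorem holds_not : (not e).Holds ρ σ ↔ ¬e.Holds ρ σ := by
  simp only [Holds, not, val]; omega

@[simp] theorem holds_and : (and e₁ e₂).Holds ρ σ ↔ e₁.Holds ρ σ ∧ e₂.Holds ρ σ := by
  simp [Holds, and]

@[simp] theorem holds_or : (or e₁ e₂).Holds ρ σ ↔ e₁.Holds ρ σ ∨ e₂.Holds ρ σ := by
  simp only [Holds, or, val]; omega

@[simp] theorem holds_lt : (lt e₁ e₂).Holds ρ σ ↔ e₁.val ρ σ < e₂.val ρ σ := by
  simp only [Holds, lt, val]; omega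

@[simp] theorem holds_le : (le e₁ e₂).Holds ρ σ ↔ e₁.val ρ σ ≤ e₂.val ρ σ := by
  simp only [Holds, le, val]; omega

@[simp] theorem holds_eq : (eq e₁ e₂).Holds ρ σ ↔ e₁.val ρ σ = e₂.val ρ σ := by
  simp only [Holds, eq, not, val]; omega

@[simp] theorem holds_ex :
    (ex v e₁ e₂).Holds ρ σ ↔ ∃ i < e₁.val ρ σ, e₂.Holds (Function.update ρ v i) σ := by
  simp [Holds, ex, val]

@[simp] theorem holds_all :
    (all v e₁ e₂).Holds ρ σ ↔ ∀ i < e₁.val ρ σ, e₂.Holds (Function.update ρ v i) σ := by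
  simp [all]

/-- The double negation in `count` reduces each truth value, which may be any nonzero number, to 0
or 1 before the summation. -/
theorem val_count {s : Finset ℕ}
    (hs : ∀ i, i ∈ s ↔ i < e₁.val ρ σ ∧ e₂.Holds (Function.update ρ v i) σ) :
    (count v e₁ e₂).val ρ σ = s.card := by
  classical
  have hs' : s = (Finset.range (e₁.val ρ σ)).filter
      fun i => e₂.Holds (Function.update ρ v i) σ := by
    ext i; simp [hs]
  rw [hs', Finset.card_filter]
  refine Finset.sum_congr rfl fun i _ => ?_
  by_cases h : e₂.val (Function.update ρ v i) σ = 0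
  · simp [not, Holds, h]
  · simp only [not, Holds, val_sub, val_const, ne_eq, h, not_false_eq_true, if_true]
    omega

end Expr

/-! ### Frame properties of commands and loops that fill an array -/

namespace Cmd

variable {V A : Type} [DecidableEq V] [DecidableEq A] {ρ : V → ℕ}

/-- The command contains an assignment to the array `a`. -/
def Writes (a : A) : Cmd V A → Prop
  | write a' _ _ => a' = a
  | emit _ => False
  | seq c₁ c₂ => c₁.Writes a ∨ c₂.Writes a
  | ifThen _ c => c.Writes a
  | loop _ _ c => c.Writes a

/-- The command contains an output instruction. -/
def Emits : Cmd V A → Prop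
  | write _ _ _ => False
  | emit _ => True
  | seq c₁ c₂ => c₁.Emits ∨ c₂.Emits
  | ifThen _ c => c.Emits
  | loop _ _ c => c.Emits

theorem run_of_not_writes {a : A} {c : Cmd V A} (h : ¬c.Writes a) (ρ : V → ℕ)
    (x : (A → ℕ → Bool) × List Bool) : (c.run ρ x).1 a = x.1 a := by
  induction c generalizing ρ x with
  | write a' e₁ e₂ => exact Function.update_of_ne (Ne.symm h) ..
  | emit e => rfl
  | seq c₁ c₂ ih₁ ih₂ =>
    rw [Writes, not_or] at h
    rw [run, ih₂ h.2, ih₁ h.1]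
  | ifThen e c ih =>
    rw [run]
    split_ifs
    · exact ih h ρ x
    · rfl
  | loop v e c ih =>
    exact iterFor_induct (fun _ y => y.1 a = x.1 a) rfl fun i _ y hy => (ih h _ y).trans hy

theorem run_of_not_emits {c : Cmd V A} (h : ¬c.Emits) (ρ : V → ℕ)
    (x : (A → ℕ → Bool) × List Bool) : (c.run ρ x).2 = x.2 := by
  induction c generalizing ρ x with
  | write a' e₁ e₂ => rfl
  | emit e => exact absurd trivial h
  | seq c₁ c₂ ih₁ ih₂ =>
    rw [Emits, not_or] at h
    rw [run, ih₂ h.2, ih₁ h.1]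
  | ifThen e c ih =>
    rw [run]
    split_ifs
    · exact ih h ρ x
    · rfl
  | loop v e c ih =>
    exact iterFor_induct (fun _ y => y.2 = x.2) rfl fun i _ y hy => (ih h _ y).trans hy

open scoped Classical in
theorem run_ifThen {e : Expr V A} {c : Cmd V A} {x : (A → ℕ → Bool) × List Bool} :
    (ifThen e c).run ρ x = if e.Holds ρ x.1 then c.run ρ x else x := by
  simp only [run, Expr.Holds]
  congr

theorem run_loop {v : V} {e : Expr V A} {c : Cmd V A} {x : (A → ℕ → Bool) × List Bool} :
    (loop v e c).run ρ x = iterFor (fun i => c.run (Function.update ρ v i)) x (e.val ρ x.1) := rfl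

theorem run_seq {c₁ c₂ : Cmd V A} {x : (A → ℕ → Bool) × List Bool} :
    (seq c₁ c₂).run ρ x = c₂.run ρ (c₁.run ρ x) := rfl

/-- The array after an assignment. -/
theorem run_write_self {a : A} {e₁ e₂ : Expr V A} {x : (A → ℕ → Bool) × List Bool} (m : ℕ) :
    ((write a e₁ e₂).run ρ x).1 a m = true ↔
      if m = e₁.val ρ x.1 then e₂.Holds ρ x.1 else x.1 a m = true := by
  simp only [run, Function.update_self, Expr.Holds]
  by_cases h : m = e₁.val ρ x.1
  · subst h; simp
  · simp [h]

/-- A loop that assigns to the entries `g i` of the array `a` the values of a condition that does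
not depend on the entries assigned before. -/
theorem run_loop_write {v : V} {b : Expr V A} {a : A} {e₁ e₂ : Expr V A}
    {x : (A → ℕ → Bool) × List Bool} {N : ℕ} (g : ℕ → ℕ) (P : ℕ → Prop) (hb : b.val ρ x.1 = N)
    (hg : ∀ i < N, ∀ j < N, g i = g j → i = j)
    (h₁ : ∀ i < N, ∀ σ, e₁.val (Function.update ρ v i) σ = g i)
    (h₂ : ∀ i < N, ∀ f : ℕ → Bool, (∀ m, (∀ j < i, m ≠ g j) → f m = x.1 a m) →
      (e₂.Holds (Function.update ρ v i) (Function.update x.1 a f) ↔ P i)) :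
    (∀ i < N, ((loop v b (write a e₁ e₂)).run ρ x).1 a (g i) = true ↔ P i) ∧
      ∀ m, (∀ i < N, m ≠ g i) → ((loop v b (write a e₁ e₂)).run ρ x).1 a m = x.1 a m := by
  rw [run_loop, hb]
  -- Invariant: only the array a has changed, the entries assigned so far are right, and all its
  -- other entries are the original ones.
  have key := iterFor_induct (n := N) (x := x)
    (f := fun i => (write a e₁ e₂).run (Function.update ρ v i))
    (fun k y => (∃ f, y.1 = Function.update x.1 a f) ∧ (∀ i < k, y.1 a (g i) = true ↔ P i) ∧
      ∀ m, (∀ i < k, m ≠ g i) → y.1 a m = x.1 a m)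
    ⟨⟨x.1 a, (Function.update_eq_self a x.1).symm⟩, by simp, fun _ _ => rfl⟩ ?_
  · exact ⟨key.2.1, key.2.2⟩
  rintro k hk y ⟨⟨f, hf⟩, hy₁, hy₂⟩
  have hfa : y.1 a = f := by rw [hf, Function.update_self]
  refine ⟨⟨_, by rw [run, hf, Function.update_idem]⟩, fun i hi => ?_, fun m hm => ?_⟩
  · simp only [run_write_self, h₁ k hk]
    split_ifs with hgi
    · obtain rfl := hg i (by omega) k hk hgi
      rw [hf]
      exact h₂ i hk f fun m hm => by rw [← hfa]; exact hy₂ m hm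
    · refine hy₁ i ?_
      rcases Nat.lt_succ_iff_lt_or_eq.1 hi with h | rfl
      · exact h
      · exact absurd rfl hgi
  · have hmk : m ≠ g k := hm k (by omega)
    rw [Bool.eq_iff_iff]
    simp only [run_write_self, h₁ k hk, if_neg hmk]
    rw [hy₂ m fun i hi => hm i (by omega)]

end Cmd

/-- Uniqueness of quotient and remainder; it separates the cells of matrices stored row by row. -/
theorem Nat.mul_add_inj {n a b x y : ℕ} (hx : x < n) (hy : y < n) (h : a * n + x = b * n + y) :
    a = b ∧ x = y := by
  rcases Nat.lt_trichotomy a b with hab | rfl | hab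
  · have := Nat.mul_le_mul_right n hab
    rw [Nat.succ_mul] at this
    omega
  · exact ⟨rfl, by omega⟩
  · have := Nat.mul_le_mul_right n hab
    rw [Nat.succ_mul] at this
    omega

/-! ### The approximation algorithm -/

namespace SteinerProg

set_option linter.constructorNameAsVariable false

/-- The variables of the program. -/
inductive Var : Type
  | n | den | k | w | c | i | j | l | m | p | r | u | v | x | y | z
  deriving DecidableEq

instance : Fintype Var :=
  .ofList [.n, .den, .k, .w, .c, .i, .j, .l, .m, .p, .r, .u, .v, .x, .y, .z]
    fun t => by cases t <;> simp

/-- The bit arrays of the program: the input, quotients and digits of the current number, the table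
of the recursion, the best solution, and a spanning tree with its vertices. -/
inductive Arr : Type
  | inp | quo | dig | tab | best | mark | tree
  deriving DecidableEq

instance : Fintype Arr :=
  .ofList [.inp, .quo, .dig, .tab, .best, .mark, .tree] fun t => by cases t <;> simp

open Expr Cmd

/-- Membership of a vertex in the set of terminals. -/
def inS (t : Var) : Expr Var Arr := read .inp (var t)

/-- Adjacency of two vertices. -/
def adj (a b : Var) : Expr Var Arr :=
  read .inp (add (var .n) (add (mul (var a) (var .n)) (var b)))

/-- The `i`-th chosen vertex is `v`. -/
def digit (i v : Var) : Expr Var Arr := read .dig (add (mul (var i) (var .n)) (var v))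

/-- The vertex `t` is in the star of the `i`-th chosen vertex. -/
def touches (i t : Var) : Expr Var Arr :=
  ex .z (var .n) (and (digit i .z) (or (eq (var t) (var .z)) (and (inS t) (adj .z t))))

/-- The vertex `t` is a terminal or chosen. -/
def inSD (t : Var) : Expr Var Arr := or (inS t) (ex .p (var .k) (digit .p t))

/-- The position of a table entry. -/
def cell (i j : Expr Var Arr) (v x : Var) : Expr Var Arr :=
  add (mul (add (mul (add (mul i (add (var .k) (const 1))) j) (var .n)) (var v)) (var .n)) (var x)

/-- The table entry for the interval `[i, j)`, the root `v` and the vertex `x`. -/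
def tab (i j : Expr Var Arr) (v x : Var) : Expr Var Arr := read .tab (cell i j v x)

/-- Replace the table row for `i`, `j`, `v` by the set `cand` if `cond` holds and if this reduces
the weight. -/
def improve (cond cand : Expr Var Arr) : Cmd Var Arr :=
  .ifThen (and cond (lt (count .x (var .n) (and cand (not (inSD .x))))
    (count .x (var .n) (and (tab (var .i) (var .j) .v .x) (not (inSD .x))))))
    (.loop .x (var .n) (.write .tab (cell (var .i) (var .j) .v .x) cand))

/-- The base case of the recursion. -/
def base : Cmd Var Arr :=
  improve (all .m (var .k) (or (not (and (le (var .i) (var .m)) (lt (var .m) (var .j))))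
    (touches .m .v))) (eq (var .x) (var .v))

/-- The join of two rows of the table with adjacent roots. -/
def join : Cmd Var Arr :=
  improve (and (le (var .i) (var .l)) (and (le (var .l) (var .j)) (adj .v .u)))
    (or (tab (var .i) (var .l) .v .x) (tab (var .l) (var .j) .u .x))

/-- One round of improvements of all rows of the table. -/
def round : Cmd Var Arr :=
  .loop .i (add (var .k) (const 1)) (.loop .j (add (var .k) (const 1)) (.loop .v (var .n)
    (.seq base (.loop .l (add (var .k) (const 1)) (.loop .u (var .n) join)))))

/-- The contents of the memory: the arrays and the output. -/
abbrev Mem : Type := (Arr → ℕ → Bool) × List Bool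

/-! ### Meaning of the memory and of the tests -/

variable {H : SimpleGraph ℕ} {n k : ℕ} {S : Finset ℕ} {d : ℕ → ℕ} {ρ : Var → ℕ}

/-- The arrays hold the graph `H` on the vertices below `n` and the terminals `S`. -/
structure InputHolds (H : SimpleGraph ℕ) (n : ℕ) (S : Finset ℕ) (σ : Arr → ℕ → Bool) : Prop where
  mem : ∀ v < n, σ .inp v = true ↔ v ∈ S
  adj : ∀ u < n, ∀ v < n, σ .inp (n + (u * n + v)) = true ↔ H.Adj u v
  lt : ∀ u v, H.Adj u v → u < n
  lt_of_mem : ∀ v ∈ S, v < n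

/-- Moreover, the array of digits holds the sequence `d` of length `k`. -/
structure Setting (H : SimpleGraph ℕ) (n : ℕ) (S : Finset ℕ) (k : ℕ) (d : ℕ → ℕ)
    (σ : Arr → ℕ → Bool) : Prop extends InputHolds H n S σ where
  digit : ∀ i < k, ∀ v < n, σ .dig (i * n + v) = true ↔ d i = v
  digit_lt : ∀ i < k, d i < n

/-- The terminals and the chosen vertices. -/
def centres (S : Finset ℕ) (k : ℕ) (d : ℕ → ℕ) : Finset ℕ := S ∪ (Finset.range k).image d

theorem InputHolds.holds_inS {σ : Arr → ℕ → Bool} (h : InputHolds H n S σ) {t : Var}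
    (ht : ρ t < n) : (inS t).Holds ρ σ ↔ ρ t ∈ S := by
  simp [inS, h.mem _ ht]

theorem InputHolds.holds_adj {σ : Arr → ℕ → Bool} (h : InputHolds H n S σ) {a b : Var}
    (hn : ρ .n = n) (ha : ρ a < n) (hb : ρ b < n) :
    (SteinerProg.adj a b).Holds ρ σ ↔ H.Adj (ρ a) (ρ b) := by
  simp [SteinerProg.adj, hn, h.adj _ ha _ hb]

theorem Setting.holds_digit {σ : Arr → ℕ → Bool} (h : Setting H n S k d σ) {i v : Var}
    (hn : ρ .n = n) (hi : ρ i < k) (hv : ρ v < n) :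
    (SteinerProg.digit i v).Holds ρ σ ↔ d (ρ i) = ρ v := by
  simp [SteinerProg.digit, hn, h.digit _ hi _ hv]

/-- The conditions on i and t prevent capture: the expression quantifies over the variable `z`. Only
z = d (ρ i) has the right digit, so the quantifier picks out the centre of the star. -/
theorem Setting.holds_touches {σ : Arr → ℕ → Bool} (h : Setting H n S k d σ) {i t : Var}
    (hn : ρ .n = n) (hi : ρ i < k) (ht : ρ t < n) (hiz : i ≠ .z) (htz : t ≠ .z) :
    (touches i t).Holds ρ σ ↔ InStar H S (d (ρ i)) (ρ t) := by
  have key : ∀ z < n, (and (SteinerProg.digit i .z) (or (eq (var t) (var .z))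
      (and (inS t) (SteinerProg.adj .z t)))).Holds (Function.update ρ .z z) σ ↔
      d (ρ i) = z ∧ (ρ t = z ∨ (ρ t ∈ S ∧ H.Adj z (ρ t))) := by
    intro z hz
    rw [holds_and, holds_or, holds_and, holds_eq, h.holds_digit (by simpa) (by simpa [hiz])
      (by simpa), h.holds_inS (by simpa [htz]), h.holds_adj (by simpa) (by simpa) (by simpa [htz])]
    simp [hiz, htz]
  rw [touches, holds_ex, val_var, hn]
  constructor
  · rintro ⟨z, hz, hz'⟩
    obtain ⟨rfl, h'⟩ := (key z hz).1 hz'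
    exact h'
  · intro h'
    exact ⟨_, h.digit_lt _ hi, (key _ (h.digit_lt _ hi)).2 ⟨rfl, h'⟩⟩

theorem Setting.holds_inSD {σ : Arr → ℕ → Bool} (h : Setting H n S k d σ) {t : Var}
    (hn : ρ .n = n) (hk : ρ .k = k) (ht : ρ t < n) (htp : t ≠ .p) :
    (inSD t).Holds ρ σ ↔ ρ t ∈ centres S k d := by
  have key : ∀ p < k, (SteinerProg.digit .p t).Holds (Function.update ρ .p p) σ ↔
      d p = ρ t := by
    intro p hp
    rw [h.holds_digit (by simpa) (by simpa) (by simpa [htp])]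
    simp [htp]
  simp only [inSD, holds_or, h.holds_inS ht, holds_ex, val_var, hk, centres, Finset.mem_union,
    Finset.mem_image, Finset.mem_range]
  refine or_congr_right (exists_congr fun p => and_congr_right fun hp => key p hp)

/-! ### The table of the interval recursion -/

/-- The position of a table entry. -/
def pos (n k i j v x : ℕ) : ℕ := ((i * (k + 1) + j) * n + v) * n + x

/-- A position is a number in mixed radix; the leading digit i needs no bound. -/
theorem pos_inj {i j v x i' j' v' x' : ℕ} (hj : j ≤ k) (hj' : j' ≤ k) (hv : v < n) (hv' : v' < n)
    (hx : x < n) (hx' : x' < n) (h : pos n k i j v x = pos n k i' j' v' x') :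
    i = i' ∧ j = j' ∧ v = v' ∧ x = x' := by
  obtain ⟨h1, h2⟩ := Nat.mul_add_inj hx hx' h
  obtain ⟨h3, h4⟩ := Nat.mul_add_inj hv hv' h1
  obtain ⟨h5, h6⟩ := Nat.mul_add_inj (by omega) (by omega) h3
  exact ⟨h5, h6, h4, h2⟩

theorem val_cell {σ : Arr → ℕ → Bool} {i j : Expr Var Arr} {v x : Var} :
    (cell i j v x).val ρ σ = pos (ρ .n) (ρ .k) (i.val ρ σ) (j.val ρ σ) (ρ v) (ρ x) := rfl

/-- A row of the table. -/
def row (n k : ℕ) (f : ℕ → Bool) (i j v : ℕ) : Finset ℕ :=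
  (Finset.range n).filter fun x => f (pos n k i j v x) = true

theorem mem_row {f : ℕ → Bool} {i j v x : ℕ} :
    x ∈ row n k f i j v ↔ x < n ∧ f (pos n k i j v x) = true := by
  simp [row]

/-- The weight of a set: the number of elements that are neither terminals nor chosen. -/
def weight (S : Finset ℕ) (k : ℕ) (d : ℕ → ℕ) (R : Finset ℕ) : ℕ := (R \ centres S k d).card

/-- The row is overwritten while the candidate, which may refer to this very row, is evaluated entry
by entry. This is harmless because the candidate at a depends only on the entries of column a of the
table, which is what `hcand` expresses. -/
theorem improve_spec {cond cand : Expr Var Arr} {x : Mem} (h : Setting H n S k d x.1)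
    (hn : ρ .n = n) (hk : ρ .k = k) (hj : ρ .j ≤ k) (hv : ρ .v < n)
    {C : Finset ℕ} (hC : ∀ a ∈ C, a < n)
    (hcand : ∀ a < n, ∀ f : ℕ → Bool, (∀ i ≤ k, ∀ j ≤ k, ∀ v < n,
      f (pos n k i j v a) = x.1 .tab (pos n k i j v a)) →
      (cand.Holds (Function.update ρ .x a) (Function.update x.1 .tab f) ↔ a ∈ C)) :
    let y := (improve cond cand).run ρ x
    (∀ i ≤ k, ∀ j ≤ k, ∀ v < n, (i, j, v) ≠ (ρ .i, ρ .j, ρ .v) →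
      row n k (y.1 .tab) i j v = row n k (x.1 .tab) i j v) ∧
    ((row n k (y.1 .tab) (ρ .i) (ρ .j) (ρ .v) = C ∧ cond.Holds ρ x.1 ∧
        weight S k d C ≤ weight S k d (row n k (x.1 .tab) (ρ .i) (ρ .j) (ρ .v))) ∨
      (row n k (y.1 .tab) (ρ .i) (ρ .j) (ρ .v) = row n k (x.1 .tab) (ρ .i) (ρ .j) (ρ .v) ∧
        (cond.Holds ρ x.1 →
          weight S k d (row n k (x.1 .tab) (ρ .i) (ρ .j) (ρ .v)) ≤ weight S k d C))) := by
  intro y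
  have hcand' : ∀ a < n, cand.Holds (Function.update ρ .x a) x.1 ↔ a ∈ C := fun a ha => by
    have := hcand a ha (x.1 .tab) fun _ _ _ _ _ _ => rfl
    rwa [Function.update_eq_self] at this
  have hSD : ∀ a < n, (not (inSD .x)).Holds (Function.update ρ .x a) x.1 ↔
      a ∉ centres S k d := fun a ha => by
    rw [holds_not, h.holds_inSD (by simpa) (by simpa) (by simpa) (by simp)]
    simp
  have hw₁ : (count .x (var .n) (and cand (not (inSD .x)))).val ρ x.1 = weight S k d C := by
    refine val_count fun a => ?_
    rw [val_var, hn, Finset.mem_sdiff]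
    constructor
    · exact fun ha => ⟨hC a ha.1, holds_and.2 ⟨(hcand' a (hC a ha.1)).2 ha.1,
        (hSD a (hC a ha.1)).2 ha.2⟩⟩
    · exact fun ha => ⟨(hcand' a ha.1).1 (holds_and.1 ha.2).1, (hSD a ha.1).1 (holds_and.1 ha.2).2⟩
  have hw₂ : (count .x (var .n) (and (tab (var .i) (var .j) .v .x) (not (inSD .x)))).val ρ x.1 =
      weight S k d (row n k (x.1 .tab) (ρ .i) (ρ .j) (ρ .v)) := by
    refine val_count fun a => ?_
    rw [val_var, hn, Finset.mem_sdiff, mem_row, and_assoc]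
    refine and_congr_right fun ha => ?_
    rw [holds_and, hSD a ha, tab, holds_read, val_cell]
    simp [hn, hk]
  by_cases hcond : (and cond (lt (count .x (var .n) (and cand (not (inSD .x))))
      (count .x (var .n) (and (tab (var .i) (var .j) .v .x) (not (inSD .x)))))).Holds ρ x.1
  · have hy : y = (Cmd.loop .x (var .n) (.write .tab (cell (var .i) (var .j) .v .x) cand)).run
        ρ x := by
      simp only [y, improve]
      rw [run_ifThen, if_pos hcond]
    rw [holds_and, holds_lt, hw₁, hw₂] at hcond
    obtain ⟨h₁, h₂⟩ := run_loop_write (x := x) (v := .x) (b := var .n) (a := .tab)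
      (e₁ := cell (var .i) (var .j) .v .x) (e₂ := cand) (ρ := ρ)
      (fun a => pos n k (ρ .i) (ρ .j) (ρ .v) a) (fun a => a ∈ C) (by simpa using hn)
      (fun a ha b hb hab => (pos_inj hj hj hv hv ha hb hab).2.2.2)
      (fun a _ σ => by rw [val_cell]; simp [hn, hk])
      -- Before entry a is written, only entries b < a of the row have changed, so column a is still
      -- the old one.
      (fun a ha f hf => hcand a ha f fun i _ j hj' v hv' => hf _ fun b hb hab => by
        have := (pos_inj hj' hj hv' hv ha (by omega) hab).2.2.2
        omega)
    rw [← hy] at h₁ h₂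
    refine ⟨fun i _ j hj' v hv' hne => ?_, Or.inl ⟨?_, hcond.1, hcond.2.le⟩⟩
    · ext a
      rw [mem_row, mem_row]
      refine and_congr_right fun ha => ?_
      rw [h₂]
      intro b hb hab
      obtain ⟨rfl, rfl, rfl, -⟩ := pos_inj hj' hj hv' hv ha hb hab
      exact hne rfl
    · ext a
      rw [mem_row]
      exact ⟨fun ha => (h₁ a ha.1).1 ha.2, fun ha => ⟨hC a ha, (h₁ a (hC a ha)).2 ha⟩⟩
  · have hy : y = x := by
      simp only [y, improve]
      rw [run_ifThen, if_neg hcond]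
    rw [holds_and, holds_lt, hw₁, hw₂, not_and, not_lt] at hcond
    rw [hy]
    exact ⟨fun _ _ _ _ _ _ _ => rfl, Or.inr ⟨rfl, hcond⟩⟩

/-- A connected set that contains the root `v` and meets the stars in an interval. -/
def GoodRow (H : SimpleGraph ℕ) (S : Finset ℕ) (d : ℕ → ℕ) (i j v : ℕ) (R : Finset ℕ) : Prop :=
  CutConnected H R ∧ v ∈ R ∧ ∀ m, i ≤ m → m < j → ∃ y ∈ R, InStar H S (d m) y

/-- All rows of the table are good. -/
def AllGood (H : SimpleGraph ℕ) (n : ℕ) (S : Finset ℕ) (k : ℕ) (d : ℕ → ℕ) (x : Mem) : Prop :=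
  ∀ i ≤ k, ∀ j ≤ k, ∀ v < n, GoodRow H S d i j v (row n k (x.1 .tab) i j v)

/-- The memory `y` arises from `x` by improvements of the table. -/
structure Improves (H : SimpleGraph ℕ) (n : ℕ) (S : Finset ℕ) (k : ℕ) (d : ℕ → ℕ) (x y : Mem) :
    Prop where
  frame : ∀ a, a ≠ .tab → y.1 a = x.1 a
  good : AllGood H n S k d x → AllGood H n S k d y
  weight_le : ∀ i ≤ k, ∀ j ≤ k, ∀ v < n, weight S k d (row n k (y.1 .tab) i j v) ≤
    weight S k d (row n k (x.1 .tab) i j v)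

theorem Improves.refl (x : Mem) : Improves H n S k d x x :=
  ⟨fun _ _ => rfl, id, fun _ _ _ _ _ _ => le_rfl⟩

theorem Improves.trans (x y z : Mem) (h : Improves H n S k d x y) (h' : Improves H n S k d y z) :
    Improves H n S k d x z :=
  ⟨fun a ha => (h'.frame a ha).trans (h.frame a ha), fun hx => h'.good (h.good hx),
    fun i hi j hj v hv => (h'.weight_le i hi j hj v hv).trans (h.weight_le i hi j hj v hv)⟩

/-- The weights reached after `r` rounds of the recursion are upper bounds for the weights of the
rows. -/
def Bounded (H : SimpleGraph ℕ) (n : ℕ) (S : Finset ℕ) (k : ℕ) (d : ℕ → ℕ) (r : ℕ) (x : Mem) :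
    Prop :=
  ∀ i ≤ k, ∀ j ≤ k, ∀ v < n, ∀ b, Achieves H (fun m => InStar H S (d m))
    (fun a => if a ∈ centres S k d then 0 else 1) r i j v b →
    weight S k d (row n k (x.1 .tab) i j v) ≤ b

/-- The invariant of a round. -/
structure Inv (H : SimpleGraph ℕ) (n : ℕ) (S : Finset ℕ) (k : ℕ) (d : ℕ → ℕ) (r : ℕ) (x : Mem) :
    Prop where
  setting : Setting H n S k d x.1
  good : AllGood H n S k d x
  bounded : Bounded H n S k d r x

theorem InputHolds.congr {σ τ : Arr → ℕ → Bool} (h : InputHolds H n S σ)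
    (h₁ : τ .inp = σ .inp) : InputHolds H n S τ :=
  ⟨by rw [h₁]; exact h.mem, by rw [h₁]; exact h.adj, h.lt, h.lt_of_mem⟩

theorem Setting.congr {σ τ : Arr → ℕ → Bool} (h : Setting H n S k d σ)
    (h₁ : τ .inp = σ .inp) (h₂ : τ .dig = σ .dig) : Setting H n S k d τ :=
  ⟨h.toInputHolds.congr h₁, by rw [h₂]; exact h.digit, h.digit_lt⟩

theorem Inv.improves {r : ℕ} (x y : Mem) (h : Improves H n S k d x y) (hx : Inv H n S k d r x) :
    Inv H n S k d r y :=
  ⟨hx.setting.congr (h.frame _ (by simp)) (h.frame _ (by simp)), h.good hx.good,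
    fun i hi j hj v hv b hb => (h.weight_le i hi j hj v hv).trans
      (hx.bounded i hi j hj v hv b hb)⟩

/-- An improvement by a good candidate. -/
theorem improve_improves {cond cand : Expr Var Arr} {x : Mem} (h : Setting H n S k d x.1)
    (hn : ρ .n = n) (hk : ρ .k = k) (hj : ρ .j ≤ k) (hv : ρ .v < n)
    {C : Finset ℕ} (hC : ∀ a ∈ C, a < n)
    (hcand : ∀ a < n, ∀ f : ℕ → Bool, (∀ i ≤ k, ∀ j ≤ k, ∀ v < n,
      f (pos n k i j v a) = x.1 .tab (pos n k i j v a)) →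
      (cand.Holds (Function.update ρ .x a) (Function.update x.1 .tab f) ↔ a ∈ C))
    (hgood : cond.Holds ρ x.1 → AllGood H n S k d x → GoodRow H S d (ρ .i) (ρ .j) (ρ .v) C) :
    Improves H n S k d x ((improve cond cand).run ρ x) ∧ (cond.Holds ρ x.1 →
      weight S k d (row n k (((improve cond cand).run ρ x).1 .tab) (ρ .i) (ρ .j) (ρ .v)) ≤
        weight S k d C) := by
  obtain ⟨h₁, h₂⟩ := improve_spec (cond := cond) h hn hk hj hv hC hcand
  refine ⟨⟨fun a ha => run_of_not_writes (by simpa [improve, Writes] using ha.symm) ρ x,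
    fun hx i hi j hj v hv => ?_, fun i hi j hj v hv => ?_⟩, fun hc => ?_⟩
  · by_cases hne : (i, j, v) = (ρ .i, ρ .j, ρ .v)
    · simp only [Prod.mk.injEq] at hne
      obtain ⟨rfl, rfl, rfl⟩ := hne
      rcases h₂ with h₂ | h₂
      · rw [h₂.1]; exact hgood h₂.2.1 hx
      · rw [h₂.1]; exact hx _ hi _ hj _ hv
    · rw [h₁ i hi j hj v hv hne]; exact hx i hi j hj v hv
  · by_cases hne : (i, j, v) = (ρ .i, ρ .j, ρ .v)
    · simp only [Prod.mk.injEq] at hne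
      obtain ⟨rfl, rfl, rfl⟩ := hne
      rcases h₂ with h₂ | h₂
      · rw [h₂.1]; exact h₂.2.2
      · rw [h₂.1]
    · rw [h₁ i hi j hj v hv hne]
  · rcases h₂ with h₂ | h₂
    · rw [h₂.1]
    · rw [h₂.1]; exact h₂.2 hc

/-- The candidate {v} is good exactly when v lies in all stars of the interval. Since j ≤ k, the
test over m < k sees the whole interval. -/
theorem base_spec {x : Mem} (h : Setting H n S k d x.1)
    (hn : ρ .n = n) (hk : ρ .k = k) (hj : ρ .j ≤ k) (hv : ρ .v < n) :
    Improves H n S k d x (base.run ρ x) ∧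
      ((∀ m, ρ .i ≤ m → m < ρ .j → InStar H S (d m) (ρ .v)) →
      weight S k d (row n k ((base.run ρ x).1 .tab) (ρ .i) (ρ .j) (ρ .v)) ≤
        if ρ .v ∈ centres S k d then 0 else 1) := by
  have hcond : (all .m (var .k) (or (not (and (le (var .i) (var .m)) (lt (var .m) (var .j))))
      (touches .m .v)) : Expr Var Arr).Holds ρ x.1 ↔
      ∀ m, ρ .i ≤ m → m < ρ .j → InStar H S (d m) (ρ .v) := by
    rw [holds_all, val_var, hk]
    have key : ∀ m < k, (or (not (and (le (var .i) (var .m)) (lt (var .m) (var .j))))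
        (touches .m .v) : Expr Var Arr).Holds (Function.update ρ .m m) x.1 ↔
        (ρ .i ≤ m → m < ρ .j → InStar H S (d m) (ρ .v)) := by
      intro m hm
      rw [holds_or, h.holds_touches (by simpa) (by simpa) (by simpa) (by simp) (by simp)]
      simp only [holds_not, holds_and, holds_le, holds_lt, val_var, ne_eq, reduceCtorEq,
        not_false_eq_true, Function.update_of_ne, Function.update_self]
      rw [or_iff_not_imp_left, not_not, and_imp]
    exact ⟨fun h m h1 h2 => (key m (by omega)).1 (h m (by omega)) h1 h2,
      fun h m hm => (key m hm).2 (h m)⟩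
  have := improve_improves (cond := all .m (var .k) (or (not (and (le (var .i) (var .m))
    (lt (var .m) (var .j)))) (touches .m .v))) (cand := eq (var .x) (var .v)) h hn hk hj hv
    (C := {ρ .v}) (by simpa using hv) (fun a _ f _ => by simp) fun hc _ =>
      ⟨cutConnected_singleton _, by simp, fun m h1 h2 => ⟨_, by simp, hcond.1 hc m h1 h2⟩⟩
  refine ⟨this.1, fun hc => (this.2 (hcond.2 hc)).trans ?_⟩
  rw [weight]
  split_ifs with hmem
  · simp [hmem]
  · exact (Finset.card_le_card Finset.sdiff_subset).trans (by simp)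

/-- The union of two good rows is connected by the edge between the roots, and the two intervals
make up [i, j). The rows may overlap; then the weight of the union is only smaller. -/
theorem join_spec {x : Mem} (h : Setting H n S k d x.1)
    (hn : ρ .n = n) (hk : ρ .k = k) (hi : ρ .i ≤ k) (hj : ρ .j ≤ k) (hv : ρ .v < n)
    (hl : ρ .l ≤ k) (hu : ρ .u < n) :
    Improves H n S k d x (join.run ρ x) ∧
      (ρ .i ≤ ρ .l → ρ .l ≤ ρ .j → H.Adj (ρ .v) (ρ .u) →
      weight S k d (row n k ((join.run ρ x).1 .tab) (ρ .i) (ρ .j) (ρ .v)) ≤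
        weight S k d (row n k (x.1 .tab) (ρ .i) (ρ .l) (ρ .v)) +
        weight S k d (row n k (x.1 .tab) (ρ .l) (ρ .j) (ρ .u))) := by
  have hcond : (and (le (var .i) (var .l)) (and (le (var .l) (var .j))
      (SteinerProg.adj .v .u)) : Expr Var Arr).Holds ρ x.1 ↔
      ρ .i ≤ ρ .l ∧ ρ .l ≤ ρ .j ∧ H.Adj (ρ .v) (ρ .u) := by
    simp only [holds_and, holds_le, val_var, h.holds_adj hn hv hu]
  have := improve_improves (cond := and (le (var .i) (var .l)) (and (le (var .l) (var .j))
    (SteinerProg.adj .v .u)))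
    (cand := or (tab (var .i) (var .l) .v .x) (tab (var .l) (var .j) .u .x)) h hn hk hj hv
    (C := row n k (x.1 .tab) (ρ .i) (ρ .l) (ρ .v) ∪ row n k (x.1 .tab) (ρ .l) (ρ .j) (ρ .u))
    (fun a ha => by
      rcases Finset.mem_union.1 ha with ha | ha <;> exact (mem_row.1 ha).1)
    (fun a ha f hf => by
      rw [Finset.mem_union, mem_row, mem_row, ← hf _ hi _ hl _ hv, ← hf _ hl _ hj _ hu]
      simp [tab, val_cell, hn, hk, ha])
    fun hc hgood => by
      obtain ⟨h1, h2, h3⟩ := hcond.1 hc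
      obtain ⟨c1, v1, m1⟩ := hgood _ hi _ hl _ hv
      obtain ⟨c2, v2, m2⟩ := hgood _ hl _ hj _ hu
      refine ⟨c1.union c2 v1 v2 (Or.inr h3), Finset.mem_union_left _ v1, fun m hm hm' => ?_⟩
      rcases Nat.lt_or_ge m (ρ .l) with hml | hml
      · obtain ⟨y, hy, hy'⟩ := m1 m hm hml
        exact ⟨y, Finset.mem_union_left _ hy, hy'⟩
      · obtain ⟨y, hy, hy'⟩ := m2 m hml hm'
        exact ⟨y, Finset.mem_union_right _ hy, hy'⟩
  refine ⟨this.1, fun h1 h2 h3 => (this.2 (hcond.2 ⟨h1, h2, h3⟩)).trans ?_⟩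
  rw [weight, Finset.union_sdiff_distrib]
  exact Finset.card_union_le _ _

/-- Rows may be improved while the loops run. As weights never increase, both the bounds after r
rounds and the bound obtained from a particular l and u persist. -/
theorem joins_spec {r : ℕ} {x : Mem} (h : Inv H n S k d r x)
    (hn : ρ .n = n) (hk : ρ .k = k) (hi : ρ .i ≤ k) (hj : ρ .j ≤ k) (hv : ρ .v < n) :
    Improves H n S k d x
      ((Cmd.loop .l (add (var .k) (const 1)) (.loop .u (var .n) join)).run ρ x) ∧
    ∀ l u b₁ b₂, ρ .i ≤ l → l ≤ ρ .j → H.Adj (ρ .v) u →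
      Achieves H (fun m => InStar H S (d m)) (fun a => if a ∈ centres S k d then 0 else 1)
        r (ρ .i) l (ρ .v) b₁ →
      Achieves H (fun m => InStar H S (d m)) (fun a => if a ∈ centres S k d then 0 else 1)
        r l (ρ .j) u b₂ →
      weight S k d (row n k (((Cmd.loop .l (add (var .k) (const 1))
        (.loop .u (var .n) join)).run ρ x).1 .tab) (ρ .i) (ρ .j) (ρ .v)) ≤ b₁ + b₂ := by
  have hstep : ∀ l ≤ k, ∀ u < n, ∀ y, Inv H n S k d r y →
      Improves H n S k d y
        (join.run (Function.update (Function.update ρ .l l) .u u) y) ∧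
      ∀ b₁ b₂, ρ .i ≤ l → l ≤ ρ .j → H.Adj (ρ .v) u →
        Achieves H (fun m => InStar H S (d m)) (fun a => if a ∈ centres S k d then 0 else 1)
          r (ρ .i) l (ρ .v) b₁ →
        Achieves H (fun m => InStar H S (d m)) (fun a => if a ∈ centres S k d then 0 else 1)
          r l (ρ .j) u b₂ →
        weight S k d (row n k ((join.run (Function.update (Function.update ρ .l l) .u u) y).1 .tab)
          (ρ .i) (ρ .j) (ρ .v)) ≤ b₁ + b₂ := by
    intro l hl u hu y hy
    have := join_spec (ρ := Function.update (Function.update ρ .l l) .u u) hy.setting (by simpa)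
      (by simpa) (by simpa) (by simpa) (by simpa) (by simpa) (by simpa)
    refine ⟨this.1, fun b₁ b₂ h1 h2 h3 h4 h5 => ?_⟩
    have h6 := this.2 (by simpa) (by simpa) (by simpa)
    have h7 := hy.bounded _ hi _ hl _ hv _ h4
    have h8 := hy.bounded _ hl _ hj _ hu _ h5
    simp at h6
    omega
  have hloop : ∀ l ≤ k, ∀ y, Inv H n S k d r y → Improves H n S k d y
      ((Cmd.loop .u (var .n) join).run (Function.update ρ .l l) y) := by
    intro l hl y hy
    rw [run_loop]
    refine iterFor_rel (R := Improves H n S k d) .refl Improves.trans (P := Inv H n S k d r)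
      Inv.improves (fun u hu y hy => (hstep l hl u ?_ y hy).1) hy
    simpa [hn] using hu
  have hval : (add (var .k) (const 1) : Expr Var Arr).val ρ x.1 = k + 1 := by simp [hk]
  constructor
  · rw [run_loop, hval]
    exact iterFor_rel (R := Improves H n S k d) .refl Improves.trans (P := Inv H n S k d r)
      Inv.improves (fun l hl y hy => hloop l (by omega) y hy) h
  · intro l u b₁ b₂ h1 h2 h3 h4 h5
    rw [run_loop, hval]
    -- The bound is demanded of iteration l only; later iterations preserve it.
    refine iterFor_establish (R := Improves H n S k d) (P := Inv H n S k d r)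
      Inv.improves (fun l hl y hy => hloop l (by omega) y hy) h
      (Q := fun l' y => l' = l → weight S k d (row n k (y.1 .tab) (ρ .i) (ρ .j) (ρ .v)) ≤ b₁ + b₂)
      (fun l' hl' y hy hll => ?_) (fun l' y z hyz hy hll =>
        (hyz.weight_le _ hi _ hj _ hv).trans (hy hll)) l (by omega) rfl
    subst hll
    have hu : u < n := h.setting.lt _ _ h3.symm
    rw [run_loop]
    refine iterFor_establish (R := Improves H n S k d) (P := Inv H n S k d r)
      Inv.improves (fun u hu y hy => (hstep l' (by omega) u (by simpa [hn] using hu) y hy).1) hy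
      (Q := fun u' y => u' = u → weight S k d (row n k (y.1 .tab) (ρ .i) (ρ .j) (ρ .v)) ≤ b₁ + b₂)
      (fun u' hu' y hy huu => ?_) (fun l' y z hyz hy hll =>
        (hyz.weight_le _ hi _ hj _ hv).trans (hy hll)) u (by simpa [hn] using hu) rfl
    subst huu
    exact (hstep l' (by omega) u' hu y hy).2 b₁ b₂ h1 h2 h3 h4 h5

/-- For each i, j and v, the three alternatives of `Achieves` at r + 1 are the previous bound, the
base case and a join. One pass handles all of them, and rows already improved in the same pass do no
harm. -/
theorem round_spec {r : ℕ} {x : Mem} (h : Inv H n S k d r x) (hn : ρ .n = n) (hk : ρ .k = k) :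
    Improves H n S k d x (round.run ρ x) ∧ Bounded H n S k d (r + 1) (round.run ρ x) := by
  let Q : ℕ → ℕ → ℕ → Mem → Prop := fun i j v y => ∀ b,
    Achieves H (fun m => InStar H S (d m)) (fun a => if a ∈ centres S k d then 0 else 1)
      (r + 1) i j v b → weight S k d (row n k (y.1 .tab) i j v) ≤ b
  have hQ : ∀ i ≤ k, ∀ j ≤ k, ∀ v < n, ∀ y z, Improves H n S k d y z → Q i j v y → Q i j v z :=
    fun i hi j hj v hv y z hyz hy b hb => (hyz.weight_le _ hi _ hj _ hv).trans (hy b hb)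
  have h1 : ∀ i ≤ k, ∀ j ≤ k, ∀ v < n, ∀ y, Inv H n S k d r y →
      let z := (Cmd.seq base (.loop .l (add (var .k) (const 1)) (.loop .u (var .n) join))).run
        (Function.update (Function.update (Function.update ρ .i i) .j j) .v v) y
      Improves H n S k d y z ∧ Q i j v z := by
    intro i hi j hj v hv y hy z
    obtain ⟨hb₁, hb₂⟩ := base_spec (ρ := Function.update (Function.update (Function.update ρ
      .i i) .j j) .v v) hy.setting (by simpa) (by simpa) (by simpa) (by simpa)
    have hy' := hy.improves _ _ hb₁
    obtain ⟨hj₁, hj₂⟩ := joins_spec (ρ := Function.update (Function.update (Function.update ρ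
      .i i) .j j) .v v) hy' (by simpa) (by simpa) (by simpa) (by simpa) (by simpa)
    refine ⟨hb₁.trans _ _ _ hj₁, fun b hb => ?_⟩
    have hz := (hj₁.weight_le i hi j hj v hv)
    simp only [ne_eq, reduceCtorEq, not_false_eq_true, Function.update_of_ne,
      Function.update_self] at hb₂ hj₂
    rcases hb with hb | ⟨hb, hb'⟩ | ⟨l, u, b₁, b₂, hl, hl', hvu, ha₁, ha₂, hb⟩
    · exact hz.trans (hy'.bounded i hi j hj v hv b hb)
    · exact hz.trans ((hb₂ hb).trans hb')
    · exact (hj₂ l u b₁ b₂ hl hl' hvu ha₁ ha₂).trans hb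
  have h2 : ∀ i ≤ k, ∀ j ≤ k, ∀ y, Inv H n S k d r y →
      let z := (Cmd.loop .v (var .n) (.seq base (.loop .l (add (var .k) (const 1))
        (.loop .u (var .n) join)))).run (Function.update (Function.update ρ .i i) .j j) y
      Improves H n S k d y z ∧ ∀ v < n, Q i j v z := by
    intro i hi j hj y hy z
    have hval : (var .n : Expr Var Arr).val (Function.update (Function.update ρ .i i) .j j) y.1 =
      n := by simpa
    simp only [z]
    rw [run_loop, hval]
    refine ⟨iterFor_rel (R := Improves H n S k d) .refl Improves.trans (P := Inv H n S k d r)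
      Inv.improves (fun v hv y hy => (h1 i hi j hj v hv y hy).1) hy, fun v hv => ?_⟩
    exact iterFor_establish (R := Improves H n S k d) (P := Inv H n S k d r)
      Inv.improves (fun v hv y hy => (h1 i hi j hj v hv y hy).1) hy
      (Q := fun v' y => v' < n → Q i j v' y) (fun v hv y hy _ => (h1 i hi j hj v hv y hy).2)
      (fun v y z hyz hy hv => hQ i hi j hj v hv y z hyz (hy hv)) v hv hv
  have h3 : ∀ i ≤ k, ∀ y, Inv H n S k d r y →
      let z := (Cmd.loop .j (add (var .k) (const 1)) (.loop .v (var .n) (.seq base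
        (.loop .l (add (var .k) (const 1)) (.loop .u (var .n) join))))).run
          (Function.update ρ .i i) y
      Improves H n S k d y z ∧ ∀ j ≤ k, ∀ v < n, Q i j v z := by
    intro i hi y hy z
    have hval : (add (var .k) (const 1) : Expr Var Arr).val (Function.update ρ .i i) y.1 =
      k + 1 := by simp [hk]
    simp only [z]
    rw [run_loop, hval]
    refine ⟨iterFor_rel (R := Improves H n S k d) .refl Improves.trans (P := Inv H n S k d r)
      Inv.improves (fun j hj y hy => (h2 i hi j (by omega) y hy).1) hy, fun j hj => ?_⟩
    exact iterFor_establish (R := Improves H n S k d) (P := Inv H n S k d r)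
      Inv.improves (fun j hj y hy => (h2 i hi j (by omega) y hy).1) hy
      (Q := fun j' y => j' ≤ k → ∀ v < n, Q i j' v y)
      (fun j hj y hy hj' => (h2 i hi j hj' y hy).2)
      (fun j y z hyz hy hj v hv => hQ i hi j hj v hv y z hyz (hy hj v hv)) j (by omega) hj
  have hval : (add (var .k) (const 1) : Expr Var Arr).val ρ x.1 = k + 1 := by simp [hk]
  rw [round, run_loop, hval]
  refine ⟨iterFor_rel (R := Improves H n S k d) .refl Improves.trans (P := Inv H n S k d r)
    Inv.improves (fun i hi y hy => (h3 i (by omega) y hy).1) h, fun i hi => ?_⟩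
  exact iterFor_establish (R := Improves H n S k d) (P := Inv H n S k d r)
    Inv.improves (fun i hi y hy => (h3 i (by omega) y hy).1) h
    (Q := fun i' y => i' ≤ k → ∀ j ≤ k, ∀ v < n, Q i' j v y)
    (fun i hi y hy hi' => (h3 i hi' y hy).2)
    (fun i y z hyz hy hi j hj v hv => hQ i hi j hj v hv y z hyz (hy hi j hj v hv)) i (by omega) hi

theorem rounds_spec {x : Mem} (h : Setting H n S k d x.1) (hx : AllGood H n S k d x)
    (hn : ρ .n = n) (hk : ρ .k = k) :
    let y := (Cmd.loop .r (var .n) round).run ρ x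
    AllGood H n S k d y ∧ Bounded H n S k d n y := by
  intro y
  have hval : (var .n : Expr Var Arr).val ρ x.1 = n := hn
  have : Inv H n S k d n y := by
    simp only [y]
    rw [run_loop, hval]
    refine iterFor_induct (n := n) (fun r y => Inv H n S k d r y)
      -- Nothing is achieved in zero rounds, so the initial bound is vacuous.
      ⟨h, hx, fun _ _ _ _ _ _ _ hb => hb.elim⟩ fun r hr y hy => ?_
    obtain ⟨h1, h2⟩ := round_spec (ρ := Function.update ρ .r r) hy (by simpa) (by simpa)
    have := hy.improves _ _ h1
    exact ⟨this.setting, this.good, h2⟩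
  exact ⟨this.good, this.bounded⟩

end SteinerProg

namespace SteinerProg

set_option linter.constructorNameAsVariable false

open Expr Cmd

/-! #### Choosing a sequence of vertices -/

/-- Store the current number in row `0` of the array of quotients, in unary. -/
def quoInit : Cmd Var Arr := .loop .x (var .w) (.write .quo (var .x) (lt (var .x) (var .c)))

/-- The quotient in row `i`. -/
def quotient : Expr Var Arr :=
  count .y (var .w) (read .quo (add (mul (var .i) (var .w)) (var .y)))

/-- Compute row `i + 1` of the array of quotients. -/
def quoStep : Cmd Var Arr :=
  .loop .x (var .w) (.write .quo (add (mul (add (var .i) (const 1)) (var .w)) (var .x))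
    (le (mul (add (var .x) (const 1)) (var .n)) quotient))

/-- Compute the `i`-th digit from the quotient in row `i`. -/
def digStep : Cmd Var Arr :=
  .loop .v (var .n) (.write .dig (add (mul (var .i) (var .n)) (var .v))
    (ex .z (var .w) (eq (add (mul (var .z) (var .n)) (var .v)) quotient)))

/-- Compute the digits of the current number. -/
def digits : Cmd Var Arr :=
  .seq quoInit (.seq (.loop .i (var .k) quoStep) (.loop .i (var .k) digStep))

variable {H : SimpleGraph ℕ} {n k w c : ℕ} {S : Finset ℕ} {d : ℕ → ℕ} {ρ : Var → ℕ}

theorem val_quotient {σ : Arr → ℕ → Bool} (hw : ρ .w = w) {q : ℕ} (hq : q ≤ w)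
    (h : ∀ y < w, σ .quo (ρ .i * w + y) = true ↔ y < q) : quotient.val ρ σ = q := by
  rw [quotient, val_count (s := Finset.range q), Finset.card_range]
  intro y
  rw [Finset.mem_range, val_var, hw]
  constructor
  · intro hy
    have := (h y (by omega)).2 hy
    exact ⟨by omega, by simpa [hw]⟩
  · rintro ⟨hy, hy'⟩
    exact (h y hy).1 (by simpa [hw] using hy')

/-- There is no division in the language. Row i of the array of quotients holds c / n ^ i in unary;
each row is obtained from the previous one by comparing multiples of n. Rows of width w suffice
since c < w. -/
theorem digits_spec {x : Mem} (hn : ρ .n = n) (hn0 : 0 < n) (hk : ρ .k = k) (hw : ρ .w = w)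
    (hc : ρ .c = c) (hcw : c < w) :
    ∀ i < k, ∀ v < n, ((digits.run ρ x).1 .dig (i * n + v) = true ↔ c / n ^ i % n = v) := by
  have hle : ∀ i, c / n ^ i ≤ w := fun i => (Nat.div_le_self _ _).trans hcw.le
  let P : ℕ → Mem → Prop := fun i y => ∀ i' ≤ i, ∀ a < w,
    y.1 .quo (i' * w + a) = true ↔ a < c / n ^ i'
  have h0 : P 0 (quoInit.run ρ x) := by
    intro i' hi' a ha
    obtain rfl : i' = 0 := by omega
    have := (run_loop_write (ρ := ρ) (v := .x) (b := var .w) (a := .quo) (e₁ := var .x)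
      (e₂ := lt (var .x) (var .c)) (x := x) (N := w) id (fun a => a < c) hw
      (fun i _ j _ h => h) (fun i _ σ => by simp) (fun i _ f _ => by simp [hc])).1 a ha
    simpa [quoInit] using this
  have h1 : P k ((Cmd.loop .i (var .k) quoStep).run ρ (quoInit.run ρ x)) := by
    rw [run_loop, val_var, hk]
    refine iterFor_induct (n := k) P h0 fun i hi y hy i' hi' a ha => ?_
    -- Row i is not affected while row i + 1 is being written.
    have hq : ∀ b < w, ∀ f : ℕ → Bool, (∀ m, (∀ j < b, m ≠ (i + 1) * w + j) → f m = y.1 .quo m) →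
        quotient.val (Function.update (Function.update ρ .i i) .x b)
          (Function.update y.1 .quo f) = c / n ^ i := by
      intro b hb f hf
      refine val_quotient (w := w) (by simpa) (hle i) fun a ha => ?_
      have := hy i le_rfl a ha
      rw [← hf _ fun j hj h => by
        have := (Nat.mul_add_inj ha (by omega) h).1
        omega] at this
      simpa using this
    obtain ⟨s1, s2⟩ := run_loop_write (ρ := Function.update ρ .i i) (v := .x) (b := var .w)
      (a := .quo) (e₁ := add (mul (add (var .i) (const 1)) (var .w)) (var .x))
      (e₂ := le (mul (add (var .x) (const 1)) (var .n)) quotient) (x := y) (N := w)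
      (fun a => (i + 1) * w + a) (fun a => a < c / n ^ (i + 1)) (by simpa)
      (fun a ha b hb h => (Nat.mul_add_inj ha hb h).2) (fun a _ σ => by simp [hw])
      -- With q the quotient in row i: a < q / n if and only if (a + 1) n ≤ q.
      (fun a ha f hf => by
        rw [holds_le, hq a ha f hf, pow_succ, ← Nat.div_div_eq_div_mul, Nat.lt_iff_add_one_le,
          Nat.le_div_iff_mul_le hn0]
        simp [hn])
    rcases Nat.lt_or_ge i i' with h | h
    · obtain rfl : i' = i + 1 := by omega
      exact s1 a ha
    · have := s2 (i' * w + a) fun b hb h' => by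
        have := (Nat.mul_add_inj ha hb h').1
        omega
      rw [quoStep, this]
      exact hy i' h a ha
  rw [digits, run_seq, run_seq, run_loop (c := digStep), val_var, hk]
  generalize (Cmd.loop .i (var .k) quoStep).run ρ (quoInit.run ρ x) = y at h1
  refine (iterFor_induct (n := k) (fun m (z : Mem) => z.1 .quo = y.1 .quo ∧ ∀ i < m, ∀ v < n,
    (z.1 .dig (i * n + v) = true ↔ c / n ^ i % n = v)) ⟨rfl, by simp⟩
    fun m hm z hz => ⟨?_, fun i hi v hv => ?_⟩).2
  · rw [run_of_not_writes (by simp [digStep, Writes]), hz.1]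
  · have hq : ∀ b < n, ∀ f : ℕ → Bool, ∀ u,
        quotient.val (Function.update (Function.update (Function.update ρ .i m) .v b) .z u)
          (Function.update z.1 .dig f) = c / n ^ m := by
      intro b _ f u
      refine val_quotient (w := w) (by simpa) (hle m) fun a ha => ?_
      have := h1 m hm.le a ha
      rw [← hz.1] at this
      simpa using this
    obtain ⟨s1, s2⟩ := run_loop_write (ρ := Function.update ρ .i m) (v := .v) (b := var .n)
      (a := .dig) (e₁ := add (mul (var .i) (var .n)) (var .v))
      (e₂ := ex .z (var .w) (eq (add (mul (var .z) (var .n)) (var .v)) quotient)) (x := z)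
      (N := n) (fun a => m * n + a) (fun a => c / n ^ m % n = a) (by simpa)
      (fun a ha b hb h => (Nat.mul_add_inj ha hb h).2) (fun a _ σ => by simp [hn])
      (fun a ha f _ => by
        simp only [holds_ex, holds_eq, hq a ha f]
        simp only [val_var, ne_eq, reduceCtorEq, not_false_eq_true, Function.update_of_ne, hw,
          val_add, val_mul, Function.update_self, hn]
        constructor
        · rintro ⟨u, _, h⟩
          rw [← h, Nat.add_comm, Nat.add_mul_mod_self_right, Nat.mod_eq_of_lt ha]
        · intro h
          refine ⟨c / n ^ m / n, ?_, ?_⟩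
          · exact (Nat.div_le_self _ _).trans_lt ((Nat.div_le_self _ _).trans_lt hcw)
          · rw [← h, Nat.mul_comm]
            exact Nat.div_add_mod _ _)
    rcases Nat.lt_succ_iff_lt_or_eq.1 hi with h | rfl
    · rw [digStep, s2 _ fun b hb h' => by
        have := (Nat.mul_add_inj hv hb h').1
        omega]
      exact hz.2 i h v hv
    · exact s1 v hv

/-! #### Processing one sequence -/

/-- Initialize all rows of the table by the set of all vertices. -/
def initTab : Cmd Var Arr :=
  .loop .x (mul (mul (mul (add (var .k) (const 1)) (add (var .k) (const 1))) (var .n)) (var .n))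
    (.write .tab (var .x) (const 1))

theorem Nat.mul_add_lt_mul {a b x y : ℕ} (hx : x < a) (hy : y < b) : x * b + y < a * b := by
  have := Nat.mul_le_mul_right b hx
  rw [Nat.succ_mul] at this
  omega

theorem pos_lt {i j v x : ℕ} (hi : i ≤ k) (hj : j ≤ k) (hv : v < n) (hx : x < n) :
    pos n k i j v x < (k + 1) * (k + 1) * n * n :=
  Nat.mul_add_lt_mul (Nat.mul_add_lt_mul (Nat.mul_add_lt_mul (by omega) (by omega)) hv) hx

/-- The set of all vertices is connected, contains every root and meets every star at its centre. -/
theorem initTab_spec {x : Mem} (h : Setting H n S k d x.1) (hn : ρ .n = n) (hk : ρ .k = k)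
    (hH : CutConnected H (Finset.range n)) : AllGood H n S k d (initTab.run ρ x) := by
  have h1 := (run_loop_write (ρ := ρ) (v := .x) (a := .tab) (e₁ := var .x) (e₂ := const 1)
    (b := mul (mul (mul (add (var .k) (const 1)) (add (var .k) (const 1))) (var .n)) (var .n))
    (x := x) (N := (k + 1) * (k + 1) * n * n) id (fun _ => True) (by simp [hn, hk])
    (fun i _ j _ h => h) (fun i _ σ => by simp) (fun i _ f _ => by simp)).1
  intro i hi j hj v hv
  have hrow : row n k ((initTab.run ρ x).1 .tab) i j v = Finset.range n := by
    ext a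
    rw [mem_row, Finset.mem_range, and_iff_left_iff_imp]
    exact fun ha => (h1 _ (pos_lt hi hj hv ha)).2 trivial
  rw [hrow]
  exact ⟨hH, Finset.mem_range.2 hv, fun m _ hm =>
    ⟨d m, Finset.mem_range.2 (h.digit_lt m (by omega)), Or.inl rfl⟩⟩

/-- All terminals are in a star of a chosen vertex. -/
def cover : Expr Var Arr :=
  all .y (var .n) (or (not (inS .y)) (ex .m (var .k) (touches .m .y)))

/-- The solution from the row of the table with root `v` for all chosen vertices. -/
def solution : Expr Var Arr := or (inSD .x) (tab (const 0) (var .k) .v .x)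

/-- Replace the best solution if the one with root `v` is smaller. -/
def updateBest : Cmd Var Arr :=
  .ifThen (and cover (lt (count .x (var .n) solution) (count .x (var .n) (read .best (var .x)))))
    (.loop .x (var .n) (.write .best (var .x) solution))

/-- The best solution. -/
def best (n : ℕ) (x : Mem) : Finset ℕ := (Finset.range n).filter fun a => x.1 .best a = true

theorem mem_best {x : Mem} {a : ℕ} : a ∈ best n x ↔ a < n ∧ x.1 .best a = true := by simp [best]

/-- The best solution is connected and contains the terminals. -/
def BestGood (H : SimpleGraph ℕ) (n : ℕ) (S : Finset ℕ) (x : Mem) : Prop :=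
  CutConnected H (best n x) ∧ S ⊆ best n x

/-- The memory `y` arises from `x` by improvements of the best solution. -/
structure BestImproves (H : SimpleGraph ℕ) (n : ℕ) (S : Finset ℕ) (x y : Mem) : Prop where
  inp : y.1 .inp = x.1 .inp
  good : BestGood H n S x → BestGood H n S y
  card_le : (best n y).card ≤ (best n x).card

theorem BestImproves.refl (x : Mem) : BestImproves H n S x x := ⟨rfl, id, le_rfl⟩

theorem BestImproves.trans (x y z : Mem) (h : BestImproves H n S x y)
    (h' : BestImproves H n S y z) : BestImproves H n S x z :=
  ⟨h'.inp.trans h.inp, fun hx => h'.good (h.good hx), h'.card_le.trans h.card_le⟩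

theorem BestImproves.of_eq {x y : Mem} (h : y.1 .inp = x.1 .inp) (h' : y.1 .best = x.1 .best) :
    BestImproves H n S x y := by
  have : best n y = best n x := by rw [best, best, h']
  exact ⟨h, fun hx => by rwa [BestGood, this], by rw [this]⟩

theorem Setting.holds_cover {σ : Arr → ℕ → Bool} (h : Setting H n S k d σ) (hn : ρ .n = n)
    (hk : ρ .k = k) : cover.Holds ρ σ ↔ ∀ s ∈ S, ∃ m < k, InStar H S (d m) s := by
  have key : ∀ y < n, ((not (inS .y) : Expr Var Arr).Holds (Function.update ρ .y y) σ ↔ y ∉ S) ∧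
      ((ex .m (var .k) (touches .m .y) : Expr Var Arr).Holds (Function.update ρ .y y) σ ↔
        ∃ m < k, InStar H S (d m) y) := by
    intro y hy
    constructor
    · rw [holds_not, h.holds_inS (by simpa)]
      simp
    · rw [holds_ex, val_var]
      simp only [ne_eq, reduceCtorEq, not_false_eq_true, Function.update_of_ne, hk]
      refine exists_congr fun m => and_congr_right fun hm => ?_
      rw [h.holds_touches (by simpa) (by simpa) (by simpa) (by simp) (by simp)]
      simp
  rw [cover, holds_all, val_var, hn]
  constructor
  · intro h' s hs
    have hsn := h.lt_of_mem s hs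
    have := h' s hsn
    rw [holds_or, (key s hsn).1, (key s hsn).2] at this
    exact this.resolve_left (by simpa)
  · intro h' y hy
    rw [holds_or, (key y hy).1, (key y hy).2]
    by_cases hyS : y ∈ S
    · exact Or.inr (h' y hyS)
    · exact Or.inl hyS

/-- The row for the whole sequence meets all stars, so its union with the terminals and the chosen
vertices is connected as soon as the stars cover the terminals. The replacement is made only if this
test succeeds. -/
theorem updateBest_spec {x : Mem} (h : Setting H n S k d x.1) (hx : AllGood H n S k d x)
    (hn : ρ .n = n) (hk : ρ .k = k) (hv : ρ .v < n) :
    BestImproves H n S x (updateBest.run ρ x) ∧ ((∀ s ∈ S, ∃ m < k, InStar H S (d m) s) →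
      (best n (updateBest.run ρ x)).card ≤
        (centres S k d ∪ row n k (x.1 .tab) 0 k (ρ .v)).card) := by
  set C : Finset ℕ := centres S k d ∪ row n k (x.1 .tab) 0 k (ρ .v) with hC
  have hCn : ∀ a ∈ C, a < n := by
    intro a ha
    simp only [hC, centres, Finset.mem_union, Finset.mem_image, Finset.mem_range, mem_row] at ha
    rcases ha with (ha | ⟨m, hm, rfl⟩) | ha
    · exact h.lt_of_mem a ha
    · exact h.digit_lt m hm
    · exact ha.1
  have hsol : ∀ a < n, ∀ f : ℕ → Bool, solution.Holds (Function.update ρ .x a)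
      (Function.update x.1 .best f) ↔ a ∈ C := by
    intro a ha f
    have hs : Setting H n S k d (Function.update x.1 .best f) := h.congr (by simp) (by simp)
    rw [solution, holds_or, hs.holds_inSD (by simpa) (by simpa) (by simpa) (by simp), hC,
      Finset.mem_union, mem_row, tab, holds_read, val_cell]
    simp [hn, hk, ha]
  have hsol' : ∀ a < n, solution.Holds (Function.update ρ .x a) x.1 ↔ a ∈ C := by
    intro a ha
    have := hsol a ha (x.1 .best)
    rwa [Function.update_eq_self] at this
  have hw₁ : (count .x (var .n) solution).val ρ x.1 = C.card := by
    refine val_count fun a => ?_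
    rw [val_var, hn]
    exact ⟨fun ha => ⟨hCn a ha, (hsol' a (hCn a ha)).2 ha⟩, fun ha => (hsol' a ha.1).1 ha.2⟩
  have hw₂ : (count .x (var .n) (read .best (var .x))).val ρ x.1 = (best n x).card := by
    refine val_count fun a => ?_
    rw [val_var, hn, mem_best]
    simp
  have hcover := h.holds_cover hn hk
  rw [updateBest, run_ifThen]
  split_ifs with hcond
  · rw [holds_and, hcover, holds_lt, hw₁, hw₂] at hcond
    have h1 := (run_loop_write (ρ := ρ) (v := .x) (b := var .n) (a := .best) (e₁ := var .x)
      (e₂ := solution) (x := x) (N := n) id (fun a => a ∈ C) hn (fun i _ j _ h => h)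
      (fun i _ σ => by simp) (fun i hi f _ => hsol i hi f)).1
    have hb : best n ((Cmd.loop .x (var .n) (.write .best (var .x) solution)).run ρ x) = C := by
      ext a
      rw [mem_best]
      exact ⟨fun ha => (h1 a ha.1).1 ha.2, fun ha => ⟨hCn a ha, (h1 a (hCn a ha)).2 ha⟩⟩
    refine ⟨⟨run_of_not_writes (by simp [Writes]) _ _, fun _ => ?_, by rw [hb]; exact hcond.2.le⟩,
      fun _ => by rw [hb]⟩
    obtain ⟨c1, c2, c3⟩ := hx 0 (Nat.zero_le k) k le_rfl _ hv
    rw [BestGood, hb]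
    refine ⟨c1.union_stars (D := (Finset.range k).image d) ?_ ?_, fun s hs => ?_⟩
    · intro a ha
      obtain ⟨m, hm, rfl⟩ := Finset.mem_image.1 ha
      exact c3 m (Nat.zero_le m) (Finset.mem_range.1 hm)
    · intro s hs
      obtain ⟨m, hm, hm'⟩ := hcond.1 s hs
      exact ⟨d m, Finset.mem_image_of_mem d (Finset.mem_range.2 hm), hm'⟩
    · exact Finset.mem_union_left _ (Finset.mem_union_left _ hs)
  · refine ⟨.refl x, fun hS => ?_⟩
    rw [holds_and, hcover, holds_lt, hw₁, hw₂, not_and, not_lt] at hcond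
    exact hcond hS

/-- Process the sequence of vertices given by the digits of the current number. -/
def process : Cmd Var Arr :=
  .seq digits (.seq initTab (.seq (.loop .r (var .n) round) (.loop .v (var .n) updateBest)))

/-- Feasibility of the best solution is kept for every sequence; the bound on its size is claimed
only for sequences whose stars cover the terminals. It adds the weight of the row, which counts just
the vertices outside the centres, to the number of centres. -/
theorem process_spec {x : Mem} (h : InputHolds H n S x.1) (hn : ρ .n = n) (hn0 : 0 < n)
    (hk : ρ .k = k) (hw : ρ .w = w) (hc : ρ .c = c) (hcw : c < w)
    (hH : CutConnected H (Finset.range n)) (hd : d = fun i => c / n ^ i % n) :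
    BestImproves H n S x (process.run ρ x) ∧ ((∀ s ∈ S, ∃ m < k, InStar H S (d m) s) →
      ∀ v < n, ∀ b, Achieves H (fun m => InStar H S (d m))
        (fun a => if a ∈ centres S k d then 0 else 1) n 0 k v b →
        (best n (process.run ρ x)).card ≤ (centres S k d).card + b) := by
  rw [process, run_seq, run_seq, run_seq]
  have hdig := digits_spec (x := x) hn hn0 hk hw hc hcw
  have e₁ : (digits.run ρ x).1 .inp = x.1 .inp ∧ (digits.run ρ x).1 .best = x.1 .best :=
    ⟨run_of_not_writes (by simp [digits, quoInit, quoStep, digStep, Writes]) _ _,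
      run_of_not_writes (by simp [digits, quoInit, quoStep, digStep, Writes]) _ _⟩
  generalize digits.run ρ x = x₁ at *
  have s₁ : Setting H n S k d x₁.1 :=
    ⟨h.congr e₁.1, by subst hd; exact hdig, by subst hd; exact fun _ _ => Nat.mod_lt _ hn0⟩
  have g₂ := initTab_spec s₁ hn hk hH
  have e₂ : ∀ a, a ≠ .tab → (initTab.run ρ x₁).1 a = x₁.1 a := fun a ha =>
    run_of_not_writes (by simpa [initTab, Writes] using ha.symm) _ _
  generalize initTab.run ρ x₁ = x₂ at *
  have s₂ : Setting H n S k d x₂.1 := s₁.congr (e₂ _ (by simp)) (e₂ _ (by simp))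
  obtain ⟨g₃, b₃⟩ := rounds_spec s₂ g₂ hn hk
  have e₃ : ∀ a, a ≠ .tab → ((Cmd.loop .r (var .n) round).run ρ x₂).1 a = x₂.1 a := fun a ha =>
    run_of_not_writes (by simpa [round, base, join, improve, Writes] using ha.symm) _ _
  generalize (Cmd.loop .r (var .n) round).run ρ x₂ = x₃ at *
  have s₃ : Setting H n S k d x₃.1 := s₂.congr (e₃ _ (by simp)) (e₃ _ (by simp))
  have i₃ : BestImproves H n S x x₃ := .of_eq
    ((e₃ _ (by simp)).trans ((e₂ _ (by simp)).trans e₁.1))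
    ((e₃ _ (by simp)).trans ((e₂ _ (by simp)).trans e₁.2))
  -- The relation also records that updates of the best solution leave the table alone, so that
  -- every root is compared with the same table.
  let R : Mem → Mem → Prop := fun y z => BestImproves H n S y z ∧ ∀ a, a ≠ .best → z.1 a = y.1 a
  let P : Mem → Prop := fun y => ∀ a, a ≠ .best → y.1 a = x₃.1 a
  have hR : ∀ v < n, ∀ y, P y → R y (updateBest.run (Function.update ρ .v v) y) ∧
      ((∀ s ∈ S, ∃ m < k, InStar H S (d m) s) →
        (best n (updateBest.run (Function.update ρ .v v) y)).card ≤
        (centres S k d ∪ row n k (x₃.1 .tab) 0 k v).card) := by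
    intro v hv y hy
    have sy : Setting H n S k d y.1 := s₃.congr (hy _ (by simp)) (hy _ (by simp))
    have gy : AllGood H n S k d y := by
      intro i hi j hj v hv
      rw [hy .tab (by simp)]
      exact g₃ i hi j hj v hv
    obtain ⟨u1, u2⟩ := updateBest_spec (ρ := Function.update ρ .v v) sy gy (by simpa) (by simpa)
      (by simpa)
    rw [hy .tab (by simp)] at u2
    refine ⟨⟨u1, fun a ha => run_of_not_writes
      (by simpa [updateBest, Writes] using ha.symm) _ _⟩, ?_⟩
    simpa using u2
  have hval : (var .n : Expr Var Arr).val ρ x₃.1 = n := hn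
  rw [run_loop, hval]
  have hPR : ∀ y z, R y z → P y → P z := fun y z hyz hy a ha => (hyz.2 a ha).trans (hy a ha)
  have hP₃ : P x₃ := fun _ _ => rfl
  refine ⟨i₃.trans _ _ _ (iterFor_rel (R := R) (P := P) (fun y => ⟨.refl y, fun _ _ => rfl⟩)
    (fun a b c h h' => ⟨h.1.trans _ _ _ h'.1, fun e he => (h'.2 e he).trans (h.2 e he)⟩) hPR
    (fun v hv y hy => (hR v hv y hy).1) hP₃).1, fun hS v hv b hb => ?_⟩
  refine (iterFor_establish (R := R) (P := P) hPR (fun v hv y hy => (hR v hv y hy).1) hP₃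
    (Q := fun v y => (best n y).card ≤ (centres S k d ∪ row n k (x₃.1 .tab) 0 k v).card)
    (fun v hv y hy => (hR v hv y hy).2 hS) (fun v y z hyz hy => hyz.1.card_le.trans hy) v hv).trans
    ?_
  have := b₃ 0 (Nat.zero_le k) k le_rfl v hv b hb
  rw [weight] at this
  rw [← Finset.union_sdiff_self_eq_union]
  exact (Finset.card_union_le _ _).trans (by omega)

/-! #### The search -/

/-- Find a small connected set that contains the terminals. -/
def search : Cmd Var Arr :=
  .seq (.loop .x (var .n) (.write .best (var .x) (const 1))) (.loop .c (var .w) process)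

/-- The search starts from the set of all vertices, which is feasible, and never gets worse; so the
bound from any single sequence survives to the end. -/
theorem search_spec {x : Mem} (h : InputHolds H n S x.1) (hn : ρ .n = n) (hn0 : 0 < n)
    (hk : ρ .k = k) (hw : ρ .w = w) (hH : CutConnected H (Finset.range n)) :
    BestGood H n S (search.run ρ x) ∧ (best n (search.run ρ x)).card ≤ n ∧
    ∀ c < w, ∀ d : ℕ → ℕ, (d = fun i => c / n ^ i % n) →
      (∀ s ∈ S, ∃ m < k, InStar H S (d m) s) →
      ∀ v < n, ∀ b, Achieves H (fun m => InStar H S (d m))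
        (fun a => if a ∈ centres S k d then 0 else 1) n 0 k v b →
        (best n (search.run ρ x)).card ≤ (centres S k d).card + b := by
  rw [search, run_seq]
  have h1 := (run_loop_write (ρ := ρ) (v := .x) (b := var .n) (a := .best) (e₁ := var .x)
    (e₂ := const 1) (x := x) (N := n) id (fun _ => True) hn (fun i _ j _ h => h)
    (fun i _ σ => by simp) (fun i _ f _ => by simp)).1
  have e₁ : ((Cmd.loop .x (var .n) (.write .best (var .x) (const 1))).run ρ x).1 .inp =
    x.1 .inp := run_of_not_writes (by simp [Writes]) _ _
  generalize (Cmd.loop .x (var .n) (.write .best (var .x) (const 1))).run ρ x = y at *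
  have hb : best n y = Finset.range n := by
    ext a
    rw [mem_best, Finset.mem_range, and_iff_left_iff_imp]
    exact fun ha => (h1 a ha).2 trivial
  have hg : BestGood H n S y := by
    rw [BestGood, hb]
    exact ⟨hH, fun s hs => Finset.mem_range.2 (h.lt_of_mem s hs)⟩
  have hval : (var .w : Expr Var Arr).val ρ y.1 = w := hw
  rw [run_loop, hval]
  let P : Mem → Prop := fun z => InputHolds H n S z.1
  have hPR : ∀ y z, BestImproves H n S y z → P y → P z := fun y z hyz hy => hy.congr hyz.inp
  have hstep := fun c (hc : c < w) y (hy : P y) => process_spec (ρ := Function.update ρ .c c) hy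
    (by simpa) hn0 (by simpa) (by simpa) (by simp) hc hH rfl
  have hPy : P y := h.congr e₁
  have hrel := iterFor_rel (R := BestImproves H n S) .refl BestImproves.trans (P := P) hPR
    (fun c hc y hy => (hstep c hc y hy).1) hPy
  refine ⟨hrel.good hg, hrel.card_le.trans (by rw [hb, Finset.card_range]), ?_⟩
  rintro c hc d rfl hS v hv b hb'
  exact iterFor_establish (R := BestImproves H n S) (P := P) hPR
    (fun c hc y hy => (hstep c hc y hy).1) hPy
    (Q := fun c' z => c' = c → (best n z).card ≤ (centres S k fun i => c / n ^ i % n).card + b)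
    (fun c' hc' y hy hcc => by
      subst hcc
      exact (hstep c' hc' y hy).2 hS v hv b hb')
    (fun c' y z hyz hy hcc => hyz.card_le.trans (hy hcc)) c hc rfl

end SteinerProg

/-! ### Spanning trees -/

section Subgraph

variable {V : Type*} {G : SimpleGraph V}

/-- This counts vertices and edges in the ambient graph rather than in the subtype. -/
theorem SimpleGraph.Subgraph.isTree_iff_ncard [Finite V] (T : G.Subgraph) :
    T.coe.IsTree ↔ T.Connected ∧ T.edgeSet.ncard + 1 = T.verts.ncard := by
  rw [SimpleGraph.isTree_iff_connected_and_card, ← T.connected_iff', ← T.image_coe_edgeSet_coe,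
    Set.ncard_image_of_injective _ (Sym2.map.injective Subtype.val_injective)]
  rfl

theorem SimpleGraph.Subgraph.isTree_singleton [Finite V] (v : V) :
    (G.singletonSubgraph v).coe.IsTree := by
  rw [SimpleGraph.Subgraph.isTree_iff_ncard]
  exact ⟨SimpleGraph.Subgraph.singletonSubgraph_connected, by simp⟩

/-- Connectedness is kept, and the numbers of vertices and of edges both grow by one. -/
theorem SimpleGraph.Subgraph.isTree_sup_edge [Finite V] {T : G.Subgraph} (hT : T.coe.IsTree)
    {u v : V} (hu : u ∈ T.verts) (hv : v ∉ T.verts) (h : G.Adj u v) :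
    (T ⊔ G.subgraphOfAdj h).coe.IsTree := by
  rw [SimpleGraph.Subgraph.isTree_iff_ncard] at hT ⊢
  refine ⟨SimpleGraph.Subgraph.connected_sup hT.1.preconnected
    (SimpleGraph.Subgraph.subgraphOfAdj_connected h).preconnected ⟨u, hu, by simp⟩, ?_⟩
  have h1 : s(u, v) ∉ T.edgeSet := fun he => hv
    (SimpleGraph.Subgraph.mem_edgeSet.1 he).snd_mem
  have h2 : T.verts ∪ {u, v} = insert v T.verts := by
    ext x
    simp only [Set.mem_union, Set.mem_insert_iff, Set.mem_singleton_iff]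
    constructor
    · rintro (h | rfl | h)
      · exact Or.inr h
      · exact Or.inr hu
      · exact Or.inl h
    · rintro (h | h)
      · exact Or.inr (Or.inr h)
      · exact Or.inl h
  rw [SimpleGraph.Subgraph.edgeSet_sup, SimpleGraph.edgeSet_subgraphOfAdj,
    SimpleGraph.Subgraph.verts_sup, SimpleGraph.subgraphOfAdj_verts, h2, Set.union_singleton,
    Set.ncard_insert_of_notMem h1 (Set.toFinite _), Set.ncard_insert_of_notMem hv (Set.toFinite _),
    hT.2]

/-- The vertex set of a connected subgraph, transported along an embedding, is connected. -/
theorem SimpleGraph.Subgraph.cutConnected {n : ℕ} {G : SimpleGraph (Fin n)} {T : G.Subgraph}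
    (hT : T.coe.Connected) {W : Finset ℕ} (hW : ∀ a, a ∈ W ↔ ∃ v ∈ T.verts, (v : ℕ) = a) :
    CutConnected (G.map Fin.valEmbedding) W := by
  constructor
  · obtain ⟨⟨v, hv⟩⟩ := hT.nonempty
    exact ⟨v, (hW _).2 ⟨v, hv, rfl⟩⟩
  · rintro R hR ⟨a, ha⟩ hne
    obtain ⟨b, hb, hbR⟩ := Finset.exists_of_ssubset (hR.ssubset_of_ne hne)
    obtain ⟨u, hu, rfl⟩ := (hW _).1 (hR ha)
    obtain ⟨v, hv, rfl⟩ := (hW _).1 hb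
    obtain ⟨p⟩ := hT.preconnected ⟨u, hu⟩ ⟨v, hv⟩
    -- A path from inside R to outside R has an edge that leaves R.
    obtain ⟨e, -, he₁, he₂⟩ := p.exists_boundary_dart {x | ((x : Fin n) : ℕ) ∈ R} ha hbR
    refine ⟨_, he₁, _, (hW _).2 ⟨_, e.snd.2, rfl⟩, he₂, ?_⟩
    exact (SimpleGraph.map_adj _ _ _ _).2 ⟨_, _, T.adj_sub e.adj, rfl, rfl⟩

end Subgraph

namespace SteinerProg

set_option linter.constructorNameAsVariable false

open Expr Cmd

/-- Mark the first vertex of the best solution. -/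
def root : Cmd Var Arr :=
  .loop .v (var .n) (.ifThen (and (read .best (var .v)) (not (ex .x (var .n)
    (read .mark (var .x))))) (.write .mark (var .v) (const 1)))

/-- Extend the tree by the edge between `u` and `v` if possible. -/
def growStep : Cmd Var Arr :=
  .ifThen (and (read .mark (var .u)) (and (read .best (var .v))
    (and (not (read .mark (var .v))) (adj .u .v))))
    (.seq (.write .mark (var .v) (const 1))
      (.seq (.write .tree (add (mul (var .u) (var .n)) (var .v)) (const 1))
        (.write .tree (add (mul (var .v) (var .n)) (var .u)) (const 1))))

/-- Extend the tree by all possible edges. -/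
def grow : Cmd Var Arr := .loop .u (var .n) (.loop .v (var .n) growStep)

/-- Compute a spanning tree of the best solution. -/
def span : Cmd Var Arr := .seq root (.loop .r (var .n) grow)

variable {n : ℕ} {G : SimpleGraph (Fin n)} {S : Finset ℕ} {ρ : Var → ℕ}

/-- The arrays hold a tree within the best solution. -/
def TreeHolds (G : SimpleGraph (Fin n)) (y : Mem) (T : G.Subgraph) : Prop :=
  T.coe.IsTree ∧ (∀ v : Fin n, y.1 .mark v = true ↔ v ∈ T.verts) ∧
    (∀ u v : Fin n, y.1 .tree (u * n + v) = true ↔ T.Adj u v) ∧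
    ∀ v ∈ T.verts, y.1 .best (v : ℕ) = true

/-- The memory `z` arises from `y` by extensions of the tree. -/
structure Grows (G : SimpleGraph (Fin n)) (y z : Mem) : Prop where
  inp : z.1 .inp = y.1 .inp
  best : z.1 .best = y.1 .best
  tree : (∃ T, TreeHolds G y T) → ∃ T, TreeHolds G z T
  mark : ∀ a, y.1 .mark a = true → z.1 .mark a = true

theorem Grows.refl (y : Mem) : Grows G y y := ⟨rfl, rfl, id, fun _ => id⟩

theorem Grows.trans (x y z : Mem) (h : Grows G x y) (h' : Grows G y z) : Grows G x z :=
  ⟨h'.inp.trans h.inp, h'.best.trans h.best, fun hx => h'.tree (h.tree hx),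
    fun a ha => h'.mark a (h.mark a ha)⟩

/-- The test that v is unmarked guarantees that the new edge attaches a leaf, so no cycle arises.
Both orientations of the edge are stored to keep the matrix symmetric. -/
theorem growStep_spec {x : Mem} (h : InputHolds (G.map Fin.valEmbedding) n S x.1)
    (hn : ρ .n = n) (hu : ρ .u < n) (hv : ρ .v < n) :
    Grows G x (growStep.run ρ x) ∧ (x.1 .mark (ρ .u) = true → x.1 .best (ρ .v) = true →
      (G.map Fin.valEmbedding).Adj (ρ .u) (ρ .v) →
      (growStep.run ρ x).1 .mark (ρ .v) = true) := by
  classical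
  rw [growStep, run_ifThen]
  have hadj := h.holds_adj (ρ := ρ) (a := .u) (b := .v) hn hu hv
  split_ifs with hcond
  · simp only [holds_and, holds_not, holds_read, val_var, hadj] at hcond
    obtain ⟨c1, c2, c3, c4⟩ := hcond
    have e : ∀ a, a ≠ .mark → a ≠ .tree →
        (((Cmd.write .mark (var .v) (const 1)).seq ((Cmd.write .tree (add (mul (var .u) (var .n))
          (var .v)) (const 1)).seq (.write .tree (add (mul (var .v) (var .n)) (var .u))
            (const 1)))).run ρ x).1 a = x.1 a := fun a ha ha' =>
      run_of_not_writes (by simpa [Writes] using ⟨ha.symm, ha'.symm⟩) _ _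
    rw [run_seq, run_seq] at *
    have m1 : ∀ m, ((Cmd.write .mark (var .v) (const 1)).run ρ x).1 .mark m = true ↔
        m = ρ .v ∨ x.1 .mark m = true := by
      intro m
      rw [run_write_self]
      by_cases hm : m = ρ .v <;> simp [hm]
    have m2 : ((Cmd.write .mark (var .v) (const 1)).run ρ x).1 .tree = x.1 .tree :=
      run_of_not_writes (by simp [Writes]) _ _
    generalize (Cmd.write .mark (var .v) (const 1)).run ρ x = x₁ at *
    have m3 : ∀ m, ((Cmd.write .tree (add (mul (var .u) (var .n)) (var .v)) (const 1)).run ρ x₁).1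
        .tree m = true ↔ m = ρ .u * n + ρ .v ∨ x.1 .tree m = true := by
      intro m
      rw [run_write_self, m2]
      by_cases hm : m = ρ .u * n + ρ .v <;> simp [hm, hn]
    have m4 : ((Cmd.write .tree (add (mul (var .u) (var .n)) (var .v)) (const 1)).run ρ x₁).1
        .mark = x₁.1 .mark := run_of_not_writes (by simp [Writes]) _ _
    generalize (Cmd.write .tree (add (mul (var .u) (var .n)) (var .v)) (const 1)).run ρ x₁ =
      x₂ at *
    have m5 : ∀ m, ((Cmd.write .tree (add (mul (var .v) (var .n)) (var .u)) (const 1)).run ρ x₂).1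
        .tree m = true ↔ m = ρ .v * n + ρ .u ∨ m = ρ .u * n + ρ .v ∨ x.1 .tree m = true := by
      intro m
      rw [run_write_self, ← m3]
      by_cases hm : m = ρ .v * n + ρ .u <;> simp [hm, hn]
    have m6 : ((Cmd.write .tree (add (mul (var .v) (var .n)) (var .u)) (const 1)).run ρ x₂).1
        .mark = x₁.1 .mark := (run_of_not_writes (by simp [Writes]) _ _).trans m4
    generalize (Cmd.write .tree (add (mul (var .v) (var .n)) (var .u)) (const 1)).run ρ x₂ =
      x₃ at *
    refine ⟨⟨e _ (by simp) (by simp), e _ (by simp) (by simp), ?_, fun a ha => ?_⟩,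
      fun _ _ _ => by rw [m6, m1]; exact Or.inl rfl⟩
    · rintro ⟨T, hT, t1, t2, t3⟩
      obtain ⟨u, v, huv, hu', hv'⟩ := (SimpleGraph.map_adj _ _ _ _).1 c4
      simp only [Fin.valEmbedding_apply] at hu' hv'
      rw [← hu', ← hv'] at m5
      rw [← hv'] at m1 c2 c3
      rw [← hu'] at c1
      have huT := (t1 u).1 c1
      have hvT : v ∉ T.verts := fun hv => c3 ((t1 v).2 hv)
      refine ⟨T ⊔ G.subgraphOfAdj huv,
        SimpleGraph.Subgraph.isTree_sup_edge hT huT hvT huv, fun a => ?_, fun a b => ?_, ?_⟩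
      · rw [m6, m1, t1, SimpleGraph.Subgraph.verts_sup, SimpleGraph.subgraphOfAdj_verts]
        simp only [Set.mem_union, Set.mem_insert_iff, Set.mem_singleton_iff, Fin.val_inj]
        constructor
        · rintro (h | h)
          · exact Or.inr (Or.inr h)
          · exact Or.inl h
        · rintro (h | h | h)
          · exact Or.inr h
          · exact Or.inr (h ▸ huT)
          · exact Or.inl h
      · have hpos : ∀ a b c d : Fin n, (a * n + b : ℕ) = c * n + d ↔ a = c ∧ b = d := by
          intro a b c d
          constructor
          · intro h
            obtain ⟨h1, h2⟩ := Nat.mul_add_inj b.2 d.2 h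
            exact ⟨Fin.ext h1, Fin.ext h2⟩
          · rintro ⟨rfl, rfl⟩; rfl
        rw [m5, hpos, hpos, t2, SimpleGraph.Subgraph.sup_adj, SimpleGraph.subgraphOfAdj_adj,
          Sym2.eq_iff]
        constructor
        · rintro (⟨rfl, rfl⟩ | ⟨rfl, rfl⟩ | h)
          · exact Or.inr (Or.inr ⟨rfl, rfl⟩)
          · exact Or.inr (Or.inl ⟨rfl, rfl⟩)
          · exact Or.inl h
        · rintro (h | ⟨rfl, rfl⟩ | ⟨rfl, rfl⟩)
          · exact Or.inr (Or.inr h)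
          · exact Or.inr (Or.inl ⟨rfl, rfl⟩)
          · exact Or.inl ⟨rfl, rfl⟩
      · rintro a (ha | ha)
        · rw [e _ (by simp) (by simp)]; exact t3 a ha
        · rw [e _ (by simp) (by simp)]
          rcases ha with rfl | rfl
          · exact t3 _ huT
          · exact c2
    · rw [m6, m1]; exact Or.inr ha
  · refine ⟨.refl x, fun h1 h2 h3 => ?_⟩
    simp only [holds_and, holds_not, holds_read, val_var, hadj] at hcond
    by_contra h4
    exact hcond ⟨h1, h2, h4, h3⟩

theorem InputHolds.grows (y z : Mem) (h : Grows G y z)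
    (hy : InputHolds (G.map Fin.valEmbedding) n S y.1) :
    InputHolds (G.map Fin.valEmbedding) n S z.1 := hy.congr h.inp

/-- A pass reaches at least the neighbours, within the best solution, of the vertices marked at its
beginning; what else it may reach does not matter. -/
theorem grow_spec {x : Mem} (h : InputHolds (G.map Fin.valEmbedding) n S x.1) (hn : ρ .n = n) :
    Grows G x (grow.run ρ x) ∧ ∀ u < n, ∀ v < n, x.1 .mark u = true → x.1 .best v = true →
      (G.map Fin.valEmbedding).Adj u v → (grow.run ρ x).1 .mark v = true := by
  let P : Mem → Prop := fun y => Grows G x y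
  have hP : ∀ y, P y → InputHolds (G.map Fin.valEmbedding) n S y.1 := fun y hy =>
    InputHolds.grows _ _ hy h
  have hPR : ∀ y z, Grows G y z → P y → P z := fun y z hyz hy => hy.trans _ _ _ hyz
  have h1 : ∀ u < n, ∀ v < n, ∀ y, P y → _ := fun u hu v hv y hy =>
    growStep_spec (ρ := Function.update (Function.update ρ .u u) .v v) (hP y hy)
    (by simpa) (by simpa) (by simpa)
  have hv' : ∀ u y, (var .n : Expr Var Arr).val (Function.update ρ .u u) y = n := by
    intro u y; simpa
  have h2 : ∀ u < n, ∀ y, P y →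
      Grows G y ((Cmd.loop .v (var .n) growStep).run (Function.update ρ .u u) y) ∧
      ∀ v < n, y.1 .mark u = true → y.1 .best v = true → (G.map Fin.valEmbedding).Adj u v →
        ((Cmd.loop .v (var .n) growStep).run (Function.update ρ .u u) y).1 .mark v = true := by
    intro u hu y hy
    rw [run_loop, hv']
    refine ⟨iterFor_rel (R := Grows G) .refl Grows.trans (P := P) hPR
      (fun v hv z hz => (h1 u hu v hv z hz).1) hy, fun v hv m1 m2 m3 => ?_⟩
    -- The invariant also remembers the growth since the start of the inner loop, so the mark of u
    -- and the best solution seen there remain valid.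
    refine iterFor_establish (R := Grows G) (P := fun z => P z ∧ Grows G y z)
      (fun z z' hzz hz => ⟨hPR _ _ hzz hz.1, hz.2.trans _ _ _ hzz⟩)
      (fun v hv z hz => (h1 u hu v hv z hz.1).1) ⟨hy, .refl y⟩
      (Q := fun v' z => v' = v → z.1 .mark v = true) (fun v' hv' z hz hvv => ?_)
      (fun v z z' hzz hz hvv => hzz.mark _ (hz hvv)) v hv rfl
    subst hvv
    have := (h1 u hu v' hv' z hz.1).2
    simp only [ne_eq, reduceCtorEq, not_false_eq_true, Function.update_of_ne,
      Function.update_self] at this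
    exact this (hz.2.mark _ m1) (by rw [hz.2.best]; exact m2) m3
  have hval : (var .n : Expr Var Arr).val ρ x.1 = n := hn
  rw [grow, run_loop, hval]
  refine ⟨iterFor_rel (R := Grows G) .refl Grows.trans (P := P) hPR
    (fun u hu z hz => (h2 u hu z hz).1) (.refl x), fun u hu v hv m1 m2 m3 => ?_⟩
  refine iterFor_establish (R := Grows G) (P := P) hPR
    (fun u hu z hz => (h2 u hu z hz).1) (.refl x)
    (Q := fun u' z => u' = u → z.1 .mark v = true) (fun u' hu' z hz huu => ?_)
    (fun v z z' hzz hz hvv => hzz.mark _ (hz hvv)) u hu rfl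
  subst huu
  exact (h2 u' hu z hz).2 v hv (hz.mark _ m1) (by rw [hz.best]; exact m2) m3

theorem root_spec {x : Mem} (hn : ρ .n = n) (hb : (best n x).Nonempty)
    (hm : x.1 .mark = fun _ => false) (ht : x.1 .tree = fun _ => false) :
    (root.run ρ x).1 .inp = x.1 .inp ∧ (root.run ρ x).1 .best = x.1 .best ∧
      ∃ T, TreeHolds G (root.run ρ x) T := by
  have hval : (var .n : Expr Var Arr).val ρ x.1 = n := hn
  have e : ∀ a, a ≠ .mark → (root.run ρ x).1 a = x.1 a := fun a ha =>
    run_of_not_writes (by simpa [root, Writes] using ha.symm) _ _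
  refine ⟨e _ (by simp), e _ (by simp), ?_⟩
  rw [root, run_loop, hval]
  -- Invariant: either nothing is marked and no vertex below i is in the best solution, or a tree
  -- has been started.
  have key := iterFor_induct (n := n) (x := x) (f := fun v => (Cmd.ifThen (and (read .best (var .v))
    (not (ex .x (var .n) (read .mark (var .x))))) (.write .mark (var .v) (const 1))).run
      (Function.update ρ .v v))
    (fun i y => (∀ a, a ≠ .mark → y.1 a = x.1 a) ∧
      (((∀ a, y.1 .mark a = false) ∧ ∀ a < i, x.1 .best a = false) ∨ ∃ T, TreeHolds G y T))
    ⟨fun _ _ => rfl, Or.inl ⟨fun a => by rw [hm], by simp⟩⟩ fun i hi y hy => ?_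
  · rcases key.2 with h | h
    · obtain ⟨a, ha⟩ := hb
      rw [mem_best] at ha
      rw [h.2 a ha.1] at ha
      exact absurd ha.2 (by simp)
    · exact h
  refine ⟨fun a ha => (run_of_not_writes (by simpa [Writes] using ha.symm) _ _).trans (hy.1 a ha),
    ?_⟩
  rw [run_ifThen]
  have hcond : (and (read .best (var .v)) (not (ex .x (var .n) (read .mark (var .x)))) :
      Expr Var Arr).Holds (Function.update ρ .v i) y.1 ↔
      x.1 .best i = true ∧ ∀ a < n, y.1 .mark a = false := by
    rw [holds_and, holds_not, holds_ex, holds_read, hy.1 .best (by simp)]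
    simp [hn]
  split_ifs with hc
  · rw [hcond] at hc
    refine Or.inr ⟨G.singletonSubgraph ⟨i, hi⟩, SimpleGraph.Subgraph.isTree_singleton _,
      fun v => ?_, fun u v => ?_, fun v hv => ?_⟩
    · rw [run_write_self]
      simp [Fin.ext_iff, hc.2 v v.2]
    · rw [run_of_not_writes (by simp [Writes]), hy.1 .tree (by simp), ht]
      simp
    · rw [run_of_not_writes (by simp [Writes]), hy.1 .best (by simp)]
      rw [SimpleGraph.singletonSubgraph_verts, Set.mem_singleton_iff] at hv
      subst hv
      exact hc.1
  · rcases hy.2 with h | h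
    · refine Or.inl ⟨h.1, fun a ha => ?_⟩
      rcases Nat.lt_succ_iff_lt_or_eq.1 ha with h' | rfl
      · exact h.2 a h'
      · by_contra hb
        exact hc (hcond.2 ⟨by simpa using hb, fun b _ => h.1 b⟩)
    · exact Or.inr h

/-- As long as the tree does not span the best solution, connectedness supplies an edge that leaves
it, and the next pass adds a vertex. So n passes suffice. -/
theorem span_spec {x : Mem} (h : InputHolds (G.map Fin.valEmbedding) n S x.1) (hn : ρ .n = n)
    (hb : CutConnected (G.map Fin.valEmbedding) (best n x))
    (hm : x.1 .mark = fun _ => false) (ht : x.1 .tree = fun _ => false) :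
    ∃ T : G.Subgraph, TreeHolds G (span.run ρ x) T ∧
      ∀ v : Fin n, v ∈ T.verts ↔ (v : ℕ) ∈ best n x := by
  classical
  obtain ⟨r1, r2, r3⟩ := root_spec (G := G) hn hb.1 hm ht
  have hval : (var .n : Expr Var Arr).val ρ (root.run ρ x).1 = n := hn
  rw [span, run_seq, run_loop, hval]
  generalize root.run ρ x = y at *
  have hbest : ∀ z : Mem, z.1 .best = y.1 .best → best n z = best n x := by
    intro z hz
    rw [best, best, hz, r2]
  -- After r passes, the tree spans the best solution or has at least r vertices.
  have key := iterFor_induct (n := n) (x := y) (f := fun r => grow.run (Function.update ρ .r r))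
    (fun r z => Grows G y z ∧ ∃ T : G.Subgraph, TreeHolds G z T ∧
      ((∀ v : Fin n, (v : ℕ) ∈ best n x → v ∈ T.verts) ∨ r ≤ T.verts.ncard))
    ⟨.refl y, by
      obtain ⟨T, hT⟩ := r3
      exact ⟨T, hT, Or.inr (Nat.zero_le _)⟩⟩ fun r hr z hz => ?_
  · obtain ⟨hg, T, hT, hor⟩ := key
    have hsub : ∀ v : Fin n, v ∈ T.verts → (v : ℕ) ∈ best n x := by
      intro v hv
      rw [← hbest _ hg.best, mem_best]
      exact ⟨v.2, hT.2.2.2 v hv⟩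
    refine ⟨T, hT, fun v => ⟨hsub v, ?_⟩⟩
    rcases hor with hor | hor
    · exact hor v
    · have : T.verts = Set.univ := by
        refine Set.eq_of_subset_of_ncard_le (Set.subset_univ _) ?_
        rw [Set.ncard_univ, Nat.card_eq_fintype_card, Fintype.card_fin]
        exact hor
      rw [this]
      exact fun _ => Set.mem_univ v
  obtain ⟨hg, T, hT, hor⟩ := hz
  obtain ⟨s1, s2⟩ := grow_spec (ρ := Function.update ρ .r r) (x := z) (S := S)
    ((h.congr r1).congr hg.inp) (by simpa)
  refine ⟨hg.trans _ _ _ s1, ?_⟩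
  obtain ⟨T', hT'⟩ := s1.tree ⟨T, hT⟩
  refine ⟨T', hT', ?_⟩
  have hTT : T.verts ⊆ T'.verts := fun v hv => (hT'.2.1 v).1 (s1.mark _ ((hT.2.1 v).2 hv))
  rcases hor with hor | hor
  · exact Or.inl fun v hv => hTT (hor v hv)
  by_cases hfull : ∀ v : Fin n, (v : ℕ) ∈ best n x → v ∈ T.verts
  · exact Or.inl fun v hv => hTT (hfull v hv)
  right
  let R : Finset ℕ := (Finset.univ.filter fun v => v ∈ T.verts).map Fin.valEmbedding
  have hmemR : ∀ a, a ∈ R ↔ ∃ v ∈ T.verts, (v : ℕ) = a := by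
    intro a
    simp [R]
  have hRb : R ⊆ best n x := by
    intro a ha
    obtain ⟨v, hv, rfl⟩ := (hmemR a).1 ha
    rw [← hbest _ hg.best, mem_best]
    exact ⟨v.2, hT.2.2.2 v hv⟩
  have hRne : R.Nonempty := by
    obtain ⟨⟨v, hv⟩⟩ := hT.1.connected.nonempty
    exact ⟨v, (hmemR _).2 ⟨v, hv, rfl⟩⟩
  have hRne' : R ≠ best n x := by
    intro h
    refine hfull fun v hv => ?_
    rw [← h] at hv
    obtain ⟨v', hv', h'⟩ := (hmemR _).1 hv
    rwa [← Fin.ext h']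
  obtain ⟨u, hu, v, hv, hvR, huv⟩ := hb.2 R hRb hRne hRne'
  obtain ⟨u', hu', rfl⟩ := (hmemR u).1 hu
  have hvn := (mem_best.1 hv).1
  have hvT : (⟨v, hvn⟩ : Fin n) ∉ T.verts := fun h => hvR ((hmemR v).2 ⟨_, h, rfl⟩)
  have hvT' : (⟨v, hvn⟩ : Fin n) ∈ T'.verts := by
    refine (hT'.2.1 _).1 (s2 u' u'.2 v hvn ((hT.2.1 u').2 hu') ?_ huv)
    rw [← hbest _ hg.best] at hv
    exact (mem_best.1 hv).2
  have : T.verts.ncard < T'.verts.ncard := Set.ncard_lt_ncard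
    (Set.ssubset_iff_subset_ne.2 ⟨hTT, fun h => hvT (h ▸ hvT')⟩) (Set.toFinite _)
  omega

/-! #### Input and output -/

/-- Output the tree. -/
def output : Cmd Var Arr :=
  .seq (.loop .i (mul (var .n) (var .n))
      (.emit (read .tree (sub (mul (var .n) (var .n)) (add (var .i) (const 1))))))
    (.loop .i (var .n) (.emit (read .mark (sub (var .n) (add (var .i) (const 1))))))

/-- Emitted bits are put in front of the output, so the array is read backwards to appear in its
natural order. -/
theorem emit_loop {b e : Expr Var Arr} {x : Mem} {a : Arr} {m : ℕ} (hb : b.val ρ x.1 = m)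
    (he : ∀ i < m, e.val (Function.update ρ .i i) x.1 = m - (i + 1)) :
    (Cmd.loop .i b (.emit (.read a e))).run ρ x =
      (x.1, (List.range m).map (x.1 a) ++ x.2) := by
  rw [run_loop, hb]
  have := iterFor_induct (n := m) (x := x)
    (f := fun i => (Cmd.emit (.read a e)).run (Function.update ρ .i i))
    (fun i y => y = (x.1, (List.range' (m - i) i).map (x.1 a) ++ x.2)) rfl fun i hi y hy => ?_
  · rw [this, Nat.sub_self, List.range_eq_range']
  · have h1 : decide ((read a e).val (Function.update ρ .i i) x.1 ≠ 0) = x.1 a (m - (i + 1)) := by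
      rw [Bool.eq_iff_iff, decide_eq_true_iff, ← he i hi]
      exact holds_read
    subst hy
    rw [run]
    simp only [h1]
    rw [List.range'_succ, show m - (i + 1) + 1 = m - i by omega, List.map_cons, List.cons_append]

/-- The matrix is emitted first because it stands last in the output. -/
theorem output_spec {x : Mem} (hn : ρ .n = n) : (output.run ρ x).2 =
    (List.range n).map (x.1 .mark) ++ ((List.range (n * n)).map (x.1 .tree) ++ x.2) := by
  rw [output, run_seq, emit_loop (a := .tree) (m := n * n) (by simp [hn]) (by simp [hn]),
    emit_loop (a := .mark) (m := n) (by simp [hn]) (by simp [hn])]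

end SteinerProg

/-! ### Bit strings as arrays -/

theorem List.ofFn_eq_map_range {α : Type*} {n : ℕ} (f : ℕ → α) :
    List.ofFn (fun i : Fin n => f i) = (List.range n).map f :=
  List.ext_getElem (by simp) fun i _ _ => by simp

theorem setBits_eq {n : ℕ} {A : Set (Fin n)} {f : ℕ → Bool} (h : ∀ i : Fin n, f i = true ↔ i ∈ A) :
    setBits A = (List.range n).map f := by
  classical
  rw [setBits, ← List.ofFn_eq_map_range]
  congr 1
  funext i
  rw [Bool.eq_iff_iff, decide_eq_true_iff, h]

theorem matrixBits_eq {n : ℕ} {r : Fin n → Fin n → Prop} {f : ℕ → Bool}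
    (h : ∀ i j : Fin n, f (i * n + j) = true ↔ r i j) :
    matrixBits r = (List.range (n * n)).map f := by
  rw [← List.ofFn_eq_map_range, List.ofFn_mul, matrixBits]
  congr 2
  funext i
  rw [setBits_eq (f := fun j => f (i * n + j)) (by simpa using h i), ← List.ofFn_eq_map_range]

theorem length_setBits {n : ℕ} (A : Set (Fin n)) : (setBits A).length = n := by
  simp [setBits]

theorem length_matrixBits {n : ℕ} (r : Fin n → Fin n → Prop) :
    (matrixBits r).length = n * n := by
  classical
  rw [matrixBits_eq (f := fun m => decide (∃ i j : Fin n, m = i * n + j ∧ r i j))]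
  · simp
  · intro i j
    rw [decide_eq_true_iff]
    constructor
    · rintro ⟨i', j', h, hr⟩
      obtain ⟨h1, h2⟩ := Nat.mul_add_inj j.2 j'.2 h
      rwa [Fin.ext h1, Fin.ext h2]
    · exact fun hr => ⟨i, j, rfl, hr⟩

/-- The first n bits are the set of terminals, which explains the offset n of the adjacency matrix
in `InputHolds`. -/
theorem inputHolds_encode {n : ℕ} (G : SimpleGraph (Fin n)) (S : Finset (Fin n))
    {σ : SteinerProg.Arr → ℕ → Bool}
    (hσ : σ .inp = fun i => (setBits (S : Set (Fin n)) ++ matrixBits G.Adj).getD i false) :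
    SteinerProg.InputHolds (G.map Fin.valEmbedding) n (S.map Fin.valEmbedding) σ := by
  classical
  have hS := setBits_eq (A := (S : Set (Fin n))) (f := fun i => decide (i ∈ S.map Fin.valEmbedding))
    (by simp [Fin.val_inj])
  have hG := matrixBits_eq (r := G.Adj)
    (f := fun m => decide (∃ i j : Fin n, m = i * n + j ∧ G.Adj i j)) (by
      intro i j
      rw [decide_eq_true_iff]
      constructor
      · rintro ⟨i', j', h, hr⟩
        obtain ⟨h1, h2⟩ := Nat.mul_add_inj j.2 j'.2 h
        rwa [Fin.ext h1, Fin.ext h2]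
      · exact fun hr => ⟨i, j, rfl, hr⟩)
  refine ⟨fun v hv => ?_, fun u hu v hv => ?_, ?_, ?_⟩
  · rw [hσ, hS]
    simp only
    rw [List.getD_append _ _ _ _ (by simpa), List.getD_eq_getElem _ _ (by simpa)]
    simp
  · have hlt : u * n + v < n * n := SteinerProg.Nat.mul_add_lt_mul hu hv
    rw [hσ]
    simp only
    rw [List.getD_append_right _ _ _ _ (by rw [length_setBits]; omega), length_setBits,
      Nat.add_sub_cancel_left, hG, List.getD_eq_getElem _ _ (by simpa)]
    simp only [List.getElem_map, List.getElem_range, decide_eq_true_iff]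
    refine Iff.trans ?_ (SimpleGraph.map_adj _ _ _ _).symm
    constructor
    · rintro ⟨i, j, h, hr⟩
      obtain ⟨h1, h2⟩ := Nat.mul_add_inj hv j.2 h
      exact ⟨i, j, hr, h1.symm, h2.symm⟩
    · rintro ⟨i, j, hr, rfl, rfl⟩
      exact ⟨i, j, rfl, hr⟩
  · intro u v h
    obtain ⟨i, j, -, rfl, rfl⟩ := (SimpleGraph.map_adj _ _ _ _).1 h
    exact i.2
  · intro v hv
    obtain ⟨i, -, rfl⟩ := Finset.mem_map.1 hv
    exact i.2

/-! ### The number of guesses -/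

theorem one_le_log_add_one (n : ℕ) : 1 ≤ Real.log n + 1 := by
  linarith [Real.log_natCast_nonneg n]

theorem log_add_one_le {n : ℕ} (hn : 2 ≤ n) : Real.log n + 1 ≤ 3 * Real.log n := by
  have h1 := Real.log_two_gt_d9
  have h2 : Real.log 2 ≤ Real.log n := Real.log_le_log (by norm_num) (by exact_mod_cast hn)
  linarith

/-- The algorithm uses ⌈log₂ n⌉ as a computable substitute for log n. It is an upper bound because
log 2 < 1. -/
theorem log_le_clog (n : ℕ) : Real.log n ≤ (Nat.clog 2 n : ℝ) := by
  rcases Nat.eq_zero_or_pos n with rfl | hn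
  · simp
  have h1 : (n : ℝ) ≤ 2 ^ Nat.clog 2 n := by exact_mod_cast Nat.le_pow_clog (by norm_num) n
  have h2 := Real.log_le_log (by exact_mod_cast hn) h1
  rw [Real.log_pow] at h2
  have h3 := Real.log_two_lt_d9
  nlinarith [Nat.cast_nonneg (α := ℝ) (Nat.clog 2 n)]

theorem clog_le_log (n : ℕ) : (Nat.clog 2 n : ℝ) ≤ 2 * (Real.log n + 1) := by
  rcases Nat.lt_or_ge 1 n with hn | hn
  · have h1 : ((2 ^ (Nat.clog 2 n).pred : ℕ) : ℝ) ≤ n := by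
      exact_mod_cast (Nat.pow_pred_clog_lt_self (by norm_num) hn).le
    rw [Nat.cast_pow] at h1
    have h2 := Real.log_le_log (by positivity) h1
    rw [Real.log_pow, Nat.cast_ofNat] at h2
    have h3 := Real.log_two_gt_d9
    have h4 : (Nat.clog 2 n : ℝ) ≤ (Nat.clog 2 n).pred + 1 := by
      exact_mod_cast Nat.le_succ_of_pred_le le_rfl
    nlinarith [Nat.cast_nonneg (α := ℝ) (Nat.clog 2 n).pred]
  · rw [Nat.clog_of_right_le_one hn, Nat.cast_zero]
    linarith [one_le_log_add_one n]

/-- A polylogarithmic function is bounded by a power of the logarithm from `2` on. -/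
theorem IsPolylog.exists_le {ψ : ℕ → ℝ} (hψ : IsPolylog ψ) :
    ∃ C k : ℕ, ∀ n, 2 ≤ n → ψ n ≤ C * Real.log n ^ k := by
  obtain ⟨k, hk⟩ := hψ
  obtain ⟨c, hc⟩ := hk.bound
  obtain ⟨N, hN⟩ := Filter.eventually_atTop.1 hc
  -- The constant of the asymptotic bound serves from N on; the sum takes care of the finitely many
  -- smaller n.
  obtain ⟨C, hC⟩ := exists_nat_ge
    (|c| + ∑ i ∈ Finset.range N, |ψ i| / Real.log i ^ k)
  have hnn : ∀ i ∈ Finset.range N, 0 ≤ |ψ i| / Real.log i ^ k := fun i _ =>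
    div_nonneg (abs_nonneg _) (pow_nonneg (Real.log_natCast_nonneg i) k)
  refine ⟨C, k, fun n hn => ?_⟩
  have hpos : 0 < Real.log n ^ k := pow_pos (Real.log_pos (by exact_mod_cast hn)) k
  rcases le_or_gt N n with h | h
  · have h1 := hN n h
    rw [Real.norm_eq_abs, Real.norm_of_nonneg hpos.le] at h1
    refine (le_abs_self _).trans (h1.trans (mul_le_mul_of_nonneg_right ?_ hpos.le))
    linarith [le_abs_self c, Finset.sum_nonneg hnn]
  · have h1 := Finset.single_le_sum hnn (Finset.mem_range.2 h)
    have h2 : |ψ n| / Real.log n ^ k ≤ C := by linarith [abs_nonneg c]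
    exact (le_abs_self _).trans ((div_le_iff₀ hpos).1 h2)

/-- An upper bound for the size of a greedily chosen dominating set. -/
def greedyBound (C k n : ℕ) : ℕ := C * Nat.clog 2 n ^ k

theorem IsPolylog.exists_greedyBound {ψ : ℕ → ℝ} (hψ : IsPolylog ψ) :
    ∃ C k : ℕ, ∀ n, 2 ≤ n → ψ n * Real.log n + 1 ≤ greedyBound C k n := by
  obtain ⟨C, k, h⟩ := hψ.exists_le
  refine ⟨C + 1, k + 1, fun n hn => ?_⟩
  have h0 : 0 ≤ Real.log n := Real.log_natCast_nonneg n
  have h1 : (1 : ℝ) ≤ (Nat.clog 2 n : ℝ) ^ (k + 1) :=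
    one_le_pow₀ (by exact_mod_cast Nat.clog_pos (by norm_num) hn)
  have h2 : Real.log n ^ (k + 1) ≤ (Nat.clog 2 n : ℝ) ^ (k + 1) :=
    pow_le_pow_left₀ h0 (log_le_clog n) _
  have h3 := mul_le_mul_of_nonneg_right (h n hn) h0
  rw [mul_assoc, ← pow_succ] at h3
  have h4 := mul_le_mul_of_nonneg_left h2 (Nat.cast_nonneg (α := ℝ) C)
  rw [greedyBound]
  push_cast
  linarith

/-- The number of guesses of the algorithm, for accuracy `δ` with denominator `a`. -/
def guesses (C k a n : ℕ) : ℕ := greedyBound C k n * (a + 1) + 1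

/-- The additional guess is absorbed because log n + 1 ≥ 1; the factor 2 ^ k comes from replacing
⌈log₂ n⌉ by 2 (log n + 1). -/
theorem guesses_le (C k a : ℕ) : ∃ c : ℕ, ∀ n : ℕ,
    (guesses C k a n : ℝ) ≤ c * (Real.log n + 1) ^ k := by
  refine ⟨C * 2 ^ k * (a + 1) + 1, fun n => ?_⟩
  have h1 : (Nat.clog 2 n : ℝ) ^ k ≤ (2 * (Real.log n + 1)) ^ k :=
    pow_le_pow_left₀ (Nat.cast_nonneg _) (clog_le_log n) k
  have h2 : (1 : ℝ) ≤ (Real.log n + 1) ^ k := one_le_pow₀ (one_le_log_add_one n)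
  have h3 := mul_le_mul_of_nonneg_left h1 (show (0 : ℝ) ≤ C * (a + 1) by positivity)
  rw [mul_pow] at h3
  rw [guesses, greedyBound]
  push_cast
  linarith

/-! ### Quasi-polynomial functions -/

/-- With log n + 1 ≥ 1 as the base, powers are monotone in the exponent, so bounds with different
exponents can be combined. The factor 3 ^ k is the price of the way back. -/
theorem isQuasiPolynomial_iff {t : ℕ → ℕ} : IsQuasiPolynomial t ↔
    ∃ C k : ℕ, ∀ n : ℕ, 2 ≤ n → (t n : ℝ) ≤ Real.exp (C * (Real.log n + 1) ^ k) := by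
  constructor
  · rintro ⟨C, k, h⟩
    obtain ⟨C', hC⟩ := exists_nat_ge C
    refine ⟨C', k, fun n hn => (h n hn).trans (Real.exp_le_exp.2 ?_)⟩
    have h0 : 0 ≤ Real.log n := Real.log_natCast_nonneg n
    exact mul_le_mul hC (pow_le_pow_left₀ h0 (by linarith) k) (pow_nonneg h0 k) (Nat.cast_nonneg _)
  · rintro ⟨C, k, h⟩
    refine ⟨C * 3 ^ k, k, fun n hn => (h n hn).trans (Real.exp_le_exp.2 ?_)⟩
    rw [mul_assoc, ← mul_pow]
    exact mul_le_mul_of_nonneg_left (pow_le_pow_left₀ (by linarith [one_le_log_add_one n])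
      (log_add_one_le hn) k) (Nat.cast_nonneg _)

namespace IsQuasiPolynomial

variable {s t : ℕ → ℕ}

theorem mono (ht : IsQuasiPolynomial t) (h : ∀ n, 2 ≤ n → s n ≤ t n) : IsQuasiPolynomial s := by
  obtain ⟨C, k, hk⟩ := ht
  exact ⟨C, k, fun n hn => le_trans (by exact_mod_cast h n hn) (hk n hn)⟩

theorem const (c : ℕ) : IsQuasiPolynomial fun _ => c :=
  ⟨c, 0, fun n _ => by rw [pow_zero, mul_one]; linarith [Real.add_one_le_exp (c : ℝ)]⟩

theorem id : IsQuasiPolynomial fun n => n :=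
  ⟨1, 1, fun n hn => by rw [one_mul, pow_one, Real.exp_log (by exact_mod_cast by omega)]⟩

theorem mul (hs : IsQuasiPolynomial s) (ht : IsQuasiPolynomial t) :
    IsQuasiPolynomial fun n => s n * t n := by
  rw [isQuasiPolynomial_iff] at *
  obtain ⟨C, k, h⟩ := hs
  obtain ⟨C', k', h'⟩ := ht
  refine ⟨C + C', k + k', fun n hn => ?_⟩
  have h1 := one_le_log_add_one n
  rw [Nat.cast_mul]
  refine (mul_le_mul (h n hn) (h' n hn) (Nat.cast_nonneg _) (Real.exp_pos _).le).trans ?_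
  rw [← Real.exp_add, Real.exp_le_exp, Nat.cast_add, add_mul]
  exact add_le_add
    (mul_le_mul_of_nonneg_left (pow_le_pow_right₀ h1 (by omega)) (Nat.cast_nonneg _))
    (mul_le_mul_of_nonneg_left (pow_le_pow_right₀ h1 (by omega)) (Nat.cast_nonneg _))

/-- Reduction to products by s + t ≤ (s + 1) (t + 1). -/
theorem add (hs : IsQuasiPolynomial s) (ht : IsQuasiPolynomial t) :
    IsQuasiPolynomial fun n => s n + t n := by
  have h : ∀ {u : ℕ → ℕ}, IsQuasiPolynomial u → IsQuasiPolynomial fun n => u n + 1 := by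
    intro u hu
    rw [isQuasiPolynomial_iff] at *
    obtain ⟨C, k, h⟩ := hu
    refine ⟨C + 1, k, fun n hn => ?_⟩
    have h1 : (1 : ℝ) ≤ (Real.log n + 1) ^ k := one_le_pow₀ (one_le_log_add_one n)
    have h2 : (1 : ℝ) ≤ Real.exp (C * (Real.log n + 1) ^ k) := by
      rw [Real.one_le_exp_iff]
      positivity
    have h3 := Real.add_one_le_exp ((Real.log n + 1) ^ k)
    push_cast
    rw [add_mul, Real.exp_add, one_mul]
    nlinarith [h n hn]
  exact ((h hs).mul (h ht)).mono fun n _ => by nlinarith [Nat.zero_le (s n * t n)]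

theorem pow (ht : IsQuasiPolynomial t) (k : ℕ) : IsQuasiPolynomial fun n => t n ^ k := by
  induction k with
  | zero => simpa using const 1
  | succ k ih => simpa only [pow_succ] using ih.mul ht

theorem eval (ht : IsQuasiPolynomial t) (p : Polynomial ℕ) :
    IsQuasiPolynomial fun n => p.eval (t n) := by
  induction p using Polynomial.induction_on' with
  | add p q hp hq => simpa only [Polynomial.eval_add] using hp.add hq
  | monomial m a => simpa only [Polynomial.eval_monomial] using (const a).mul (ht.pow m)

/-- The logarithm of n ^ guesses is guesses times log n, again polylogarithmic. -/
theorem pow_guesses (C k a : ℕ) : IsQuasiPolynomial fun n => n ^ guesses C k a n := by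
  obtain ⟨c, hc⟩ := guesses_le C k a
  rw [isQuasiPolynomial_iff]
  refine ⟨c, k + 1, fun n hn => ?_⟩
  have hn0 : (0 : ℝ) < n := by exact_mod_cast by omega
  have h1 := one_le_log_add_one n
  rw [Nat.cast_pow, ← Real.exp_log (pow_pos hn0 _), Real.log_pow, Real.exp_le_exp, pow_succ,
    ← mul_assoc]
  exact mul_le_mul (hc n) (by linarith) (by linarith) (by positivity)

end IsQuasiPolynomial

/-! ### Sequences as numbers -/

/-- Every sequence of numbers below `n` is a sequence of digits. -/
theorem exists_digits {n : ℕ} (hn : 0 < n) (l : List ℕ) (h : ∀ a ∈ l, a < n) :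
    ∃ c < n ^ l.length, ∀ i (hi : i < l.length), c / n ^ i % n = l[i] := by
  induction l with
  | nil => exact ⟨0, by simp, by simp⟩
  | cons a l ih =>
    obtain ⟨c, hc, hd⟩ := ih fun b hb => h b (List.mem_cons_of_mem a hb)
    have ha : a < n := h a List.mem_cons_self
    -- The head of the list is the least significant digit.
    refine ⟨a + n * c, ?_, fun i hi => ?_⟩
    · rw [List.length_cons, pow_succ']
      nlinarith
    · cases i with
      | zero => simp [Nat.add_mul_mod_self_left, Nat.mod_eq_of_lt ha]
      | succ i =>
        rw [pow_succ', ← Nat.div_div_eq_div_mul, Nat.add_mul_div_left _ _ hn,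
          Nat.div_eq_of_lt ha, zero_add, hd i (by simpa using hi)]
        simp

namespace SteinerProg

variable {n k w : ℕ} {H : SimpleGraph ℕ} {S W D : Finset ℕ} {ρ : Var → ℕ}

/-- The search finds a solution that is as good as the union of any connected set and any set
that dominates the terminals. -/
theorem search_card_le {x : Mem} (h : InputHolds H n S x.1) (hn : ρ .n = n) (hk : ρ .k = k)
    (hw : ρ .w = n ^ k) (hH : CutConnected H (Finset.range n)) (hW : CutConnected H W)
    (hWn : W ⊆ Finset.range n) (hSW : S ⊆ W) (hDn : D ⊆ Finset.range n) (hD : D.Nonempty)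
    (hDk : D.card ≤ k) (hDW : ∀ d ∈ D, ∃ y ∈ W, InStar H S d y)
    (hDS : ∀ s ∈ S, ∃ d ∈ D, InStar H S d s) :
    (best n (search.run ρ x)).card ≤ W.card + (D \ W).card := by
  obtain ⟨e, he⟩ := hD
  obtain ⟨v, hv⟩ := hW.1
  have hvn := Finset.mem_range.1 (hWn hv)
  -- The guessed sequence has length exactly k, so D is padded with copies of one of its elements.
  have hX : ∀ d, d ∈ D.toList ++ List.replicate (k - D.card) e ↔ d ∈ D := by
    intro d
    rw [List.mem_append, Finset.mem_toList, List.mem_replicate]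
    exact ⟨fun h => h.elim _root_.id fun h => h.2 ▸ he, Or.inl⟩
  obtain ⟨l, hl, hA⟩ := (hW.build hv).achieves S
    (fun a => if a ∈ S ∪ D then 0 else 1) (D.toList ++ List.replicate (k - D.card) e)
    fun d hd => hDW d ((hX d).1 hd)
  have hlD : ∀ d, d ∈ l ↔ d ∈ D := fun d => hl.mem_iff.trans (hX d)
  have hlk : l.length = k := by
    rw [hl.length_eq]
    simp
    omega
  obtain ⟨c, hc, hcd⟩ := exists_digits (by omega) l fun d hd =>
    Finset.mem_range.1 (hDn ((hlD d).1 hd))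
  rw [hlk] at hc
  have hcen : centres S k (fun i => c / n ^ i % n) = S ∪ D := by
    rw [centres]
    congr 1
    ext d
    rw [Finset.mem_image, ← hlD, List.mem_iff_getElem]
    constructor
    · rintro ⟨i, hi, rfl⟩
      have hi' : i < l.length := by rw [hlk]; exact Finset.mem_range.1 hi
      exact ⟨i, hi', (hcd i hi').symm⟩
    · rintro ⟨i, hi, rfl⟩
      exact ⟨i, Finset.mem_range.2 (hlk ▸ hi), hcd i hi⟩
  have hfin := (search_spec h hn (by omega) hk hw hH).2.2 c hc _ rfl (fun s hs => ?_) v hvn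
    (∑ a ∈ W, if a ∈ S ∪ D then 0 else 1) ?_
  · refine hfin.trans ?_
    have h1 : (∑ a ∈ W, if a ∈ S ∪ D then 0 else 1) = (W \ (S ∪ D)).card := by
      rw [Finset.sdiff_eq_filter, Finset.card_filter]
      exact Finset.sum_congr rfl fun a _ => by split_ifs <;> simp_all
    -- As S ⊆ W, the vertices counted are those of W ∪ D.
    have h2 : S ∪ D ∪ W \ (S ∪ D) = W ∪ D \ W := by
      rw [Finset.union_sdiff_self_eq_union, Finset.union_sdiff_self_eq_union,
        Finset.union_comm W D, Finset.union_right_comm, Finset.union_eq_right.2 hSW,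
        Finset.union_comm]
    rw [hcen, h1, ← Finset.card_union_of_disjoint Finset.disjoint_sdiff, h2]
    exact Finset.card_union_le _ _
  · obtain ⟨d, hd, hds⟩ := hDS s hs
    obtain ⟨i, hi, rfl⟩ := List.mem_iff_getElem.1 ((hlD d).2 hd)
    exact ⟨i, hlk ▸ hi, by rwa [hcd i hi]⟩
  · rw [hcen]
    have := (hA (fun i => c / n ^ i % n) 0 (by simpa using hcd)).mono
      ((Finset.card_le_card hWn).trans (by simp) : W.card ≤ n)
    rwa [hlk, zero_add] at this

end SteinerProg

/-! ### The approximation scheme -/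

namespace SteinerProg

open Expr Cmd

variable {n : ℕ} {ρ : Var → ℕ}

/-- The variable `x` is a power of two. -/
def isPowTwo : Expr Var Arr :=
  all .y (add (var .x) (const 1)) (all .z (add (var .x) (const 1))
    (or (not (eq (mul (var .y) (var .z)) (var .x))) (or (eq (var .y) (const 1))
      (ex .u (add (var .x) (const 1)) (eq (var .y) (mul (const 2) (var .u)))))))

/-- A positive number is a power of two if and only if each of its divisors is 1 or even: otherwise
it has an odd prime divisor. -/
theorem holds_isPowTwo {σ : Arr → ℕ → Bool} (h : 0 < ρ .x) :
    isPowTwo.Holds ρ σ ↔ ∃ i, ρ .x = 2 ^ i := by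
  simp only [isPowTwo, holds_all, holds_or, holds_not, holds_eq, holds_ex, val_add, val_mul,
    val_var, val_const, ne_eq, reduceCtorEq, not_false_eq_true, Function.update_self,
    Function.update_of_ne]
  constructor
  · intro hx
    rcases Nat.eq_two_pow_or_exists_odd_prime_and_dvd (ρ .x) with h1 | ⟨p, hp, ⟨q, hq⟩, hodd⟩
    · exact h1
    · have hp' : p ≤ ρ .x := Nat.le_of_dvd h ⟨q, hq⟩
      have hq' : q ≤ ρ .x := Nat.le_of_dvd h ⟨p, by rw [hq, mul_comm]⟩
      rcases hx p (by omega) q (by omega) with h2 | h2 | ⟨u, -, h2⟩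
      · exact absurd hq.symm h2
      · exact absurd h2 hp.one_lt.ne'
      · exact absurd (hodd : Odd p) (by rw [h2]; simp)
  · rintro ⟨i, hi⟩ y hy z hz
    by_cases hyz : y * z = ρ .x
    · obtain ⟨j, -, rfl⟩ := (Nat.dvd_prime_pow Nat.prime_two).1 (hi ▸ Dvd.intro z hyz)
      cases j with
      | zero => simp
      | succ j =>
        refine Or.inr (Or.inr ⟨2 ^ j, ?_, pow_succ' 2 j⟩)
        rw [pow_succ] at hy
        omega
    · exact Or.inl hyz

/-- The logarithm of the number of vertices. -/
def logSize : Expr Var Arr :=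
  count .x (var .n) (and (lt (const 0) (var .x)) isPowTwo)

/-- There are exactly ⌈log₂ n⌉ powers of two below n, since 2 ^ i < n if and only if i < ⌈log₂ n⌉.
-/
theorem val_logSize {σ : Arr → ℕ → Bool} (hn : ρ .n = n) : logSize.val ρ σ = Nat.clog 2 n := by
  rw [logSize, val_count (s := (Finset.range (Nat.clog 2 n)).image (2 ^ ·)),
    Finset.card_image_of_injective _ (Nat.pow_right_injective le_rfl), Finset.card_range]
  intro x
  rw [Finset.mem_image, holds_and, holds_lt, val_const, val_var, val_var, Function.update_self, hn]
  constructor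
  · rintro ⟨i, hi, rfl⟩
    have := (Nat.lt_clog_iff_pow_lt (by norm_num)).1 (Finset.mem_range.1 hi)
    exact ⟨this, by positivity, (holds_isPowTwo (by simp)).2 ⟨i, by simp⟩⟩
  · rintro ⟨hx, hx0, h⟩
    obtain ⟨i, hi⟩ := (holds_isPowTwo (by simpa)).1 h
    rw [Function.update_self] at hi
    subst hi
    exact ⟨i, Finset.mem_range.2 ((Nat.lt_clog_iff_pow_lt (by norm_num)).2 hx), rfl⟩

/-- A power of an expression. -/
def power (e : Expr Var Arr) : ℕ → Expr Var Arr
  | 0 => const 1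
  | k + 1 => mul (power e k) e

theorem val_power {e : Expr Var Arr} {σ : Arr → ℕ → Bool} (k : ℕ) :
    (power e k).val ρ σ = e.val ρ σ ^ k := by
  induction k with
  | zero => rfl
  | succ k ih => rw [power, val_mul, ih, pow_succ]

/-- The number of guesses of the algorithm. -/
def numGuesses (C k : ℕ) : Expr Var Arr :=
  add (mul (mul (const C) (power logSize k)) (add (var .den) (const 1))) (const 1)

theorem val_numGuesses {C k a : ℕ} {σ : Arr → ℕ → Bool} (hn : ρ .n = n) (ha : ρ .den = a) :
    (numGuesses C k).val ρ σ = guesses C k a n := by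
  simp [numGuesses, guesses, greedyBound, val_power, val_logSize hn, ha]

/-- The approximation algorithm. -/
def program : Cmd Var Arr := .seq search (.seq span output)

/-- The program outputs a tree on a set of vertices that is at least as good as the union of any
connected set and any set that dominates the terminals. -/
theorem program_spec {G : SimpleGraph (Fin n)} {S : Finset ℕ} {k : ℕ} {x : Mem} (hn0 : 0 < n)
    (h : InputHolds (G.map Fin.valEmbedding) n S x.1) (hn : ρ .n = n) (hk : ρ .k = k)
    (hw : ρ .w = n ^ k) (hG : G.Connected) (hm : x.1 .mark = fun _ => false)
    (ht : x.1 .tree = fun _ => false) :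
    ∃ T : G.Subgraph, T.coe.IsTree ∧ (∀ v : Fin n, (v : ℕ) ∈ S → v ∈ T.verts) ∧
      (program.run ρ x).2 = setBits T.verts ++ (matrixBits T.Adj ++ x.2) ∧
      T.verts.ncard ≤ n ∧
      ∀ W D : Finset ℕ, CutConnected (G.map Fin.valEmbedding) W → W ⊆ Finset.range n → S ⊆ W →
        D ⊆ Finset.range n → D.Nonempty → D.card ≤ k →
        (∀ d ∈ D, ∃ y ∈ W, InStar (G.map Fin.valEmbedding) S d y) →
        (∀ s ∈ S, ∃ d ∈ D, InStar (G.map Fin.valEmbedding) S d s) →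
        T.verts.ncard ≤ W.card + (D \ W).card := by
  have hH : CutConnected (G.map Fin.valEmbedding) (Finset.range n) := by
    refine SimpleGraph.Subgraph.cutConnected (T := ⊤)
      ((SimpleGraph.Subgraph.topIso (G := G)).connected_iff.2 hG) fun a => ?_
    simp only [Finset.mem_range, SimpleGraph.Subgraph.verts_top, Set.mem_univ, true_and]
    exact ⟨fun ha => ⟨⟨a, ha⟩, rfl⟩, by rintro ⟨v, rfl⟩; exact v.2⟩
  have hs := search_spec h hn hn0 hk hw hH
  -- The search leaves the input and the still empty arrays of the tree alone.
  have hW : ∀ a, a ≠ Arr.quo → a ≠ .dig → a ≠ .tab → a ≠ .best →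
      (search.run ρ x).1 a = x.1 a := fun a h1 h2 h3 h4 =>
    run_of_not_writes (by
      simp [search, process, digits, quoInit, quoStep, digStep, initTab, round, base, join,
        improve, updateBest, Writes, h1.symm, h2.symm, h3.symm, h4.symm]) _ _
  have he : (search.run ρ x).2 = x.2 := run_of_not_emits (by
      simp [search, process, digits, quoInit, quoStep, digStep, initTab, round, base, join,
        improve, updateBest, Emits]) _ _
  obtain ⟨T, hT, hTb⟩ := span_spec
    (h.congr (hW .inp (by simp) (by simp) (by simp) (by simp))) hn hs.1.1
    ((hW .mark (by simp) (by simp) (by simp) (by simp)).trans hm)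
    ((hW .tree (by simp) (by simp) (by simp) (by simp)).trans ht)
  have hcard : T.verts.ncard = (best n (search.run ρ x)).card := by
    rw [← Set.ncard_coe_finset, ← Set.ncard_image_of_injective _ Fin.val_injective]
    congr 1
    ext a
    simp only [Set.mem_image, hTb, Finset.mem_coe]
    constructor
    · rintro ⟨v, hv, rfl⟩
      exact hv
    · exact fun ha => ⟨⟨a, (mem_best.1 ha).1⟩, ha, rfl⟩
  refine ⟨T, hT.1, fun v hv => (hTb v).2 (hs.1.2 hv), ?_, hcard ▸ hs.2.1,
    fun W D hWc hWn hSW hDn hD hDk hDW hDS => ?_⟩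
  · rw [program, run_seq, run_seq, output_spec hn, setBits_eq hT.2.1, matrixBits_eq hT.2.2.1,
      run_of_not_emits (by simp [span, root, grow, growStep, Emits]), he]
  · rw [hcard]
    exact search_card_le h hn hk hw hH hWc hWn hSW hDn hD hDk hDW hDS

end SteinerProg

/-! ### Dominating sets in dense instances -/

/-- In a dense instance, some dominating set adds little to a Steiner tree. -/
theorem SteinerInstance.IsDense.exists_dominating {ψ : ℕ → ℝ} {I : SteinerInstance}
    (hI : I.IsDense ψ) (hψ : 0 < ψ I.n) {C k : ℕ}
    (hC : 2 ≤ I.n → ψ I.n * Real.log I.n + 1 ≤ greedyBound C k I.n) {a : ℕ}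
    (hS : I.S ≠ Finset.univ) {W : Finset (Fin I.n)} (hW : W.Nonempty) (hSW : I.S ⊆ W) :
    ∃ D : Finset (Fin I.n), D.Nonempty ∧ D.card ≤ guesses C k a I.n ∧
      (∀ d ∈ D, ∃ y ∈ W, InStar I.G I.S d y) ∧ (∀ s ∈ I.S, ∃ d ∈ D, InStar I.G I.S d s) ∧
      (D \ W).card * a ≤ W.card - 1 := by
  classical
  -- Without terminals, one vertex of W serves as D; the additional 1 in `guesses` leaves room for
  -- it.
  rcases I.S.eq_empty_or_nonempty with hS0 | hS0
  · obtain ⟨x, hx⟩ := hW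
    refine ⟨{x}, by simp, by simp [guesses], fun d hd => ⟨d, ?_, Or.inl rfl⟩, by simp [hS0], ?_⟩
    · rwa [Finset.mem_singleton.1 hd]
    · rw [Finset.sdiff_eq_empty_iff_subset.2 (Finset.singleton_subset_iff.2 hx)]
      simp
  -- If there are few terminals, D = S: each terminal is the centre of its own star, and D \ W is
  -- empty.
  rcases Nat.lt_or_ge (guesses C k a I.n) I.S.card with hlt | hle
  swap
  · refine ⟨I.S, hS0, hle, fun d hd => ⟨d, hSW hd, Or.inl rfl⟩, fun s hs => ⟨s, hs, Or.inl rfl⟩, ?_⟩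
    rw [Finset.sdiff_eq_empty_iff_subset.2 hSW]
    simp
  have hU : (I.Sᶜ).Nonempty := by
    rwa [Finset.nonempty_iff_ne_empty, Ne, Finset.compl_eq_empty_iff]
  have hdeg : ∀ t ∈ I.S, ((I.Sᶜ).card : ℝ) / ψ I.n ≤
      ({u | u ∈ I.Sᶜ ∧ I.G.Adj t u} : Set (Fin I.n)).ncard := by
    intro t ht
    have h1 := hI t ht
    rw [← Finset.coe_compl, Set.ncard_coe_finset] at h1
    convert h1 using 3
    ext u
    simp [and_comm]
  -- A terminal has at most |V \ S| neighbours in V \ S.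
  have hψ1 : 1 ≤ ψ I.n := by
    obtain ⟨t, ht⟩ := hS0
    have h1 : ({u | u ∈ I.Sᶜ ∧ I.G.Adj t u} : Set (Fin I.n)).ncard ≤ (I.Sᶜ).card := by
      rw [← Set.ncard_coe_finset]
      exact Set.ncard_le_ncard (fun u hu => hu.1) (Set.toFinite _)
    have h2 := (hdeg t ht).trans (Nat.cast_le.2 h1)
    have h3 : (0 : ℝ) < (I.Sᶜ).card := by exact_mod_cast hU.card_pos
    rw [div_le_iff₀ hψ] at h2
    exact le_of_mul_le_mul_left (by linarith) h3
  obtain ⟨D, hDU, hDc, hDS, hSD⟩ := _root_.exists_dominating hψ1 hU hS0 hdeg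
  have hn : I.S.card ≤ I.n := by simpa using Finset.card_le_univ I.S
  have hn2 : 2 ≤ I.n := by
    by_contra hn2
    have : I.S.card + (I.Sᶜ).card = I.n := by simp
    have := hS0.card_pos
    have := hU.card_pos
    omega
  have hDg : D.card ≤ greedyBound C k I.n := by
    have h1 : Real.log I.S.card ≤ Real.log I.n :=
      Real.log_le_log (by exact_mod_cast hS0.card_pos) (by exact_mod_cast hn)
    have h2 := mul_le_mul_of_nonneg_left h1 hψ.le
    exact_mod_cast (by linarith [hC hn2] : (D.card : ℝ) ≤ greedyBound C k I.n)
  refine ⟨D, ?_, hDg.trans ?_, fun d hd => ?_, fun s hs => ?_, ?_⟩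
  · obtain ⟨t, ht⟩ := hS0
    obtain ⟨d, hd, -⟩ := hSD t ht
    exact ⟨d, hd⟩
  · rw [guesses]
    nlinarith [Nat.zero_le (greedyBound C k I.n * a)]
  · obtain ⟨t, ht, h⟩ := hDS d hd
    exact ⟨t, hSW ht, Or.inr ⟨ht, h⟩⟩
  · obtain ⟨d, hd, h⟩ := hSD s hs
    exact ⟨d, hd, Or.inr ⟨hs, h⟩⟩
  -- With g the greedy bound, |D \ W| ≤ g and g (a + 1) + 1 < |S| ≤ |W|.
  · have h1 : (D \ W).card ≤ greedyBound C k I.n :=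
      (Finset.card_le_card Finset.sdiff_subset).trans hDg
    have h2 := Finset.card_le_card hSW
    rw [guesses] at hlt
    have h3 := Nat.mul_le_mul_right a h1
    have h4 : greedyBound C k I.n * a + greedyBound C k I.n = greedyBound C k I.n * (a + 1) := by
      ring
    omega

theorem InStar.map {n : ℕ} {G : SimpleGraph (Fin n)} {S : Finset (Fin n)} {d x : Fin n}
    (h : InStar G S d x) :
    InStar (G.map Fin.valEmbedding) (S.map Fin.valEmbedding) (d : ℕ) (x : ℕ) := by
  rcases h with rfl | ⟨hx, h⟩
  · exact Or.inl rfl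
  · exact Or.inr ⟨Finset.mem_map.2 ⟨x, hx, rfl⟩,
      (SimpleGraph.map_adj _ _ _ _).2 ⟨_, _, h, rfl, rfl⟩⟩

theorem corollary5p3 (ψ : ℕ → ℝ) (hψ_pos : ∀ n, 0 < ψ n) (hψ : IsPolylog ψ) :
    ∃ M : Turing.TM2ComputableAux Bool Bool, IsQPTAS (SteinerInstance.IsDense ψ) M := by
  classical
  obtain ⟨C, k, hC⟩ := hψ.exists_greedyBound
  -- The machine depends only on C and k. The accuracy is part of its input, and of it only the
  -- denominator is used; the numerator is skipped.
  obtain ⟨M, p, hM⟩ := StackProg.exists_machine (SteinerProg.numGuesses C k) SteinerProg.program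
    .den .n .k .w .inp (by decide)
  refine ⟨M, fun δ hδ => ⟨fun n => p.eval (δ.num.toNat + δ.den + n + guesses C k δ.den n +
    n ^ guesses C k δ.den n + 1 + (n + n * n)), ?_, fun I hI => ?_⟩⟩
  · have hq := IsQuasiPolynomial.pow_guesses C k δ.den
    -- For n ≥ 2, the number of guesses is less than n to this power.
    have hg : IsQuasiPolynomial (guesses C k δ.den) :=
      hq.mono fun n hn => (Nat.lt_pow_self (by omega)).le
    have hi := IsQuasiPolynomial.id
    exact ((((((IsQuasiPolynomial.const (δ.num.toNat + δ.den)).add hi).add hg).add hq).add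
      (.const 1)).add (hi.add (hi.mul hi))).eval p
  have hn0 : 0 < I.n := by
    obtain ⟨v⟩ := I.connected.nonempty
    exact v.pos
  have hrun := hM δ.num.toNat δ.den I.n (setBits (I.S : Set (Fin I.n)) ++ matrixBits I.G.Adj)
    _ _ _ _ rfl rfl rfl le_rfl
  rw [SteinerProg.val_numGuesses (a := δ.den) (n := I.n) (by simp) (by simp)] at hrun
  obtain ⟨T, hT, hTS, hTout, hTn, hTbest⟩ := SteinerProg.program_spec (G := I.G)
    (S := I.S.map Fin.valEmbedding) (k := guesses C k δ.den I.n)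
    (ρ := Function.update (Function.update (Function.update (Function.update (fun _ => 0)
      .den δ.den) .n I.n) .k (guesses C k δ.den I.n)) .w (I.n ^ guesses C k δ.den I.n))
    (x := (Function.update (fun _ _ => false) .inp (fun i => (setBits (I.S : Set (Fin I.n)) ++
      matrixBits I.G.Adj).getD i false), [])) hn0
    (inputHolds_encode I.G I.S (by simp)) (by simp) (by simp) (by simp) I.connected
    (by simp) (by simp)
  rw [hTout, List.length_append, length_setBits, length_matrixBits] at hrun
  refine ⟨T, ⟨⟨hT, fun v hv => hTS v (Finset.mem_map_of_mem _ hv)⟩, fun T' hT' => ?_⟩, ?_⟩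
  swap
  · simpa only [encodeInput, encodeOutput, List.append_assoc, List.append_nil] using hrun
  have hc := ((T.isTree_iff_ncard).1 hT).2
  have hc' := ((T'.isTree_iff_ncard).1 hT'.1).2
  let W : Finset (Fin I.n) := Finset.univ.filter fun v => v ∈ T'.verts
  have hWc : T'.verts.ncard = W.card := by
    rw [← Set.ncard_coe_finset]
    simp [W]
  have hWne : W.Nonempty := by
    rw [← Finset.card_pos]
    omega
  have hSW : I.S ⊆ W := fun v hv => by simpa [W] using hT'.2 hv
  have hkey : (T.edgeSet.ncard : ℚ) ≤ (1 + δ) * T'.edgeSet.ncard := by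
    -- If all vertices are terminals, there is nothing to dominate with; but then every Steiner tree
    -- has n vertices and the output is optimal.
    by_cases hS : I.S = Finset.univ
    · have h1 : W.card = I.n := by
        rw [Finset.univ_subset_iff.1 (hS.symm.subset.trans hSW)]
        simp
      have h2 : (T.edgeSet.ncard : ℚ) ≤ T'.edgeSet.ncard := by
        exact_mod_cast (by omega : T.edgeSet.ncard ≤ T'.edgeSet.ncard)
      nlinarith [Nat.cast_nonneg (α := ℚ) T'.edgeSet.ncard]
    · obtain ⟨D, hD, hDk, hDW, hDS, hDc⟩ := hI.exists_dominating (hψ_pos _) (hC I.n)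
        (a := δ.den) hS hWne hSW
      have hsub : ∀ A : Finset (Fin I.n), A.map Fin.valEmbedding ⊆ Finset.range I.n := by
        intro A a ha
        obtain ⟨v, -, rfl⟩ := Finset.mem_map.1 ha
        exact Finset.mem_range.2 v.2
      have h1 := hTbest (W.map Fin.valEmbedding) (D.map Fin.valEmbedding)
        (SimpleGraph.Subgraph.cutConnected hT'.1.connected (by simp [W])) (hsub W)
        (Finset.map_subset_map.2 hSW) (hsub D) (hD.map) (by simpa) ?_ ?_
      · rw [← Finset.map_sdiff, Finset.card_map, Finset.card_map] at h1
        have h2 : (T.edgeSet.ncard : ℚ) ≤ T'.edgeSet.ncard + (D \ W).card := by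
          exact_mod_cast (by omega : T.edgeSet.ncard ≤ T'.edgeSet.ncard + (D \ W).card)
        have h3 : ((D \ W).card : ℚ) * δ.den ≤ T'.edgeSet.ncard := by
          exact_mod_cast hDc.trans (by omega)
        -- The product is the numerator of δ, a positive integer. Hence |D \ W| ≤ δ · den · |D \ W|,
        -- which is at most δ times the number of edges of T'.
        have h4 : 1 ≤ δ * δ.den := by
          rw [Rat.mul_den_eq_num]
          exact_mod_cast Rat.num_pos.2 hδ
        have h5 := mul_le_mul_of_nonneg_left h4 (Nat.cast_nonneg (α := ℚ) (D \ W).card)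
        have h6 := mul_le_mul_of_nonneg_left h3 hδ.le
        linarith
      · intro d hd
        obtain ⟨d, hd', rfl⟩ := Finset.mem_map.1 hd
        obtain ⟨y, hy, h⟩ := hDW d hd'
        exact ⟨y, Finset.mem_map_of_mem Fin.valEmbedding hy, h.map⟩
      · intro s hs
        obtain ⟨s, hs', rfl⟩ := Finset.mem_map.1 hs
        obtain ⟨d, hd, h⟩ := hDS s hs'
        exact ⟨d, Finset.mem_map_of_mem Fin.valEmbedding hd, h.map⟩
  exact hkey
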